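/- Let $(M^n,g)$ be a smooth Riemannian manifold, $\phi\in C^\infty(M)$ and $\lambda\in\mathbb{R}$. For a (pseudo-)Riemannian metric $h$ on a manifold $N$ and a function $f$ on $N$ put $$P_f=\mathrm{Ric}+\nabla^2 f-\lambda h,\qquad F_f=\Delta f-|\nabla f|^2+2\lambda f-\lambda\dim N,\qquad Y_f=-\tfrac12\left[R+|\nabla f|^2-2\lambda f\right].$$ Suppose that $(M,g,\phi,\lambda)$ is a gradient Ricci soliton, i.e. $P_\phi=0$, or that $g$ is flat, i.e. its curvature tensor vanishes. Set $$(g_u)_{ij}=g_{ij}+2u(P_\phi)_{ij}+u^2(P_\phi)_{ik}(P_\phi)_j{}^k,\qquad \phi_u=\phi-uY_\phi,$$ and, on $\mathbb{R}\times M\times\mathbb{R}$ with points $(v,x,u)$, $$\widetilde g=2\,du\,dv+g_u,\qquad \widetilde\phi=\phi_u-v+\lambda uv.$$ Let the dilations be $\delta_s(v,x,u)=(v+(\lambda u-1)^{-1}s,x,u)$ where $\lambda u\ne1$. Let $\mathcal G=M\times\mathbb{R}$ be the cone of pairs $(x,l)$, with projection $\pi(x,l)=x$ and inclusion $\iota(x,l)=(\phi(x)-l,x,0)$,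 whose image is $\{u=0\}$. Call an open set $\widetilde{\mathcal G}\subseteq\mathbb{R}\times M\times\mathbb{R}$ admissible if it contains $\{u=0\}$, is invariant under all dilations, meets every line $\{(v,x)\}\times\mathbb{R}$ in an interval, and satisfies $\lambda u\neq1$ and nondegeneracy of $g_u$ at all of its points. Then admissible sets exist, and for every admissible $\widetilde{\mathcal G}$ the following hold. 1. $(\widetilde{\mathcal G},\widetilde g,\widetilde\phi,\lambda)$ is a weighted ambient space for $(M,g,[\phi],\lambda)$, that is: $\widetilde g$ is a smooth metric of signature $(n+1,1)$ and $\widetilde\phi$ is smooth on $\widetilde{\mathcal G}$; $\widetilde g$ is invariant under the translations in $v$, and $\delta_s^*\widetilde\phi=\widetilde\phi+s$; $\iota^*\widetilde g=\pi^*g$ and $\iota^*\widetilde\phi(x,l)=l$; $\widetilde\nabla_{\partial_v}\partial_v=O(u)$; and $\widetilde P_{\widetilde\phi}=O(u^\infty)$, $\widetilde F_{\widetilde\phi}=O(u^\infty)$ at $u=0$. 2. It is in normal form relative to $(g,\phi)$: for each $(v,x)$ the set $\{u:(v,x,u)\in\widetilde{\mathcal G}\}$ is an open interval containing $0$ on which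 $u\mapsto(v,x,u)$ is a geodesic of $\widetilde g$, and $\widetilde g=g+2\,du\,dv$ at $u=0$. 3. It is exact: $\widetilde P_{\widetilde\phi}=0$ and $\widetilde F_{\widetilde\phi}=0$ on all of $\widetilde{\mathcal G}$. -/

import Mathlib

open Set Filter Topology Bundle Manifold Asymptotics
open scoped ContDiff

set_option maxSynthPendingDepth 3

noncomputable section

namespace WeightedAmbient

/-! ## Pseudo-Riemannian geometry on an open piece of a finite-dimensional vector space

`G : E → E →L[ℝ] E →L[ℝ] ℝ` is a field of symmetric bilinear forms on `E`; all formulas are the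
usual coordinate formulas, written without a choice of basis of `E`. -/

section Coordinates

variable {E : Type*} [NormedAddCommGroup E] [NormedSpace ℝ E]

/-- The Christoffel symbols of the first kind:
`X, Y, Z ↦ (1/2) (D_X G (Y, Z) + D_Y G (X, Z) - D_Z G (X, Y))`. -/
def christoffelFirst (G : E → E →L[ℝ] E →L[ℝ] ℝ) (y : E) : E →L[ℝ] E →L[ℝ] E →L[ℝ] ℝ :=
  let D : E →L[ℝ] E →L[ℝ] E →L[ℝ] ℝ := fderiv ℝ G y
  let T : E →L[ℝ] E →L[ℝ] E →L[ℝ] ℝ :=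
    (ContinuousLinearMap.flipₗᵢ ℝ E E ℝ).toContinuousLinearEquiv.toContinuousLinearMap ∘L D.flip
  (1 / 2 : ℝ) • (D + D.flip - T)

theorem christoffelFirst_apply (G : E → E →L[ℝ] E →L[ℝ] ℝ) (y X Y Z : E) :
    christoffelFirst G y X Y Z =
      1 / 2 * (fderiv ℝ G y X Y Z + fderiv ℝ G y Y X Z - fderiv ℝ G y Z X Y) := rfl

/-- The Christoffel symbols `Γ(X, Y)` of the Levi-Civita connection:
`G (Γ(X, Y), Z) = christoffelFirst G y X Y Z` where `G` is nondegenerate. -/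
def christoffel (G : E → E →L[ℝ] E →L[ℝ] ℝ) (y : E) : E →L[ℝ] E →L[ℝ] E :=
  ContinuousLinearMap.compL ℝ E (E →L[ℝ] ℝ) E (G y).inverse ∘L christoffelFirst G y

theorem christoffel_apply (G : E → E →L[ℝ] E →L[ℝ] ℝ) (y X Y : E) :
    christoffel G y X Y = (G y).inverse (christoffelFirst G y X Y) := rfl

/-- The Riemann curvature `R(X, Y) Z = ∇_X ∇_Y Z - ∇_Y ∇_X Z - ∇_[X, Y] Z`. -/
def riemann (G : E → E →L[ℝ] E →L[ℝ] ℝ) (y : E) : E →L[ℝ] E →L[ℝ] E →L[ℝ] E :=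
  fderiv ℝ (christoffel G) y - (fderiv ℝ (christoffel G) y).flip
    + (ContinuousLinearMap.compL ℝ E E E).bilinearComp (christoffel G y) (christoffel G y)
    - ((ContinuousLinearMap.compL ℝ E E E).bilinearComp (christoffel G y) (christoffel G y)).flip

theorem riemann_apply (G : E → E →L[ℝ] E →L[ℝ] ℝ) (y X Y Z : E) :
    riemann G y X Y Z =
      fderiv ℝ (christoffel G) y X Y Z - fderiv ℝ (christoffel G) y Y X Z
        + christoffel G y X (christoffel G y Y Z)
        - christoffel G y Y (christoffel G y X Z) := rfl

/-- The covariant Hessian `∇²f (X, Y) = D²f (X, Y) - Df (Γ(X, Y))`. -/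
def hessian (G : E → E →L[ℝ] E →L[ℝ] ℝ) (f : E → ℝ) (y : E) : E →L[ℝ] E →L[ℝ] ℝ :=
  fderiv ℝ (fderiv ℝ f) y - ContinuousLinearMap.compL ℝ E E ℝ (fderiv ℝ f y) ∘L christoffel G y

theorem hessian_apply (G : E → E →L[ℝ] E →L[ℝ] ℝ) (f : E → ℝ) (y X Y : E) :
    hessian G f y X Y = fderiv ℝ (fderiv ℝ f) y X Y - fderiv ℝ f y (christoffel G y X Y) := rfl

/-- `|∇f|²`, the square of the differential of `f` for the inverse of `G`. -/
def gradSq (G : E → E →L[ℝ] E →L[ℝ] ℝ) (f : E → ℝ) (y : E) : ℝ :=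
  fderiv ℝ f y ((G y).inverse (fderiv ℝ f y))

/-- The bilinear form with components `P_{ik} P_j^k`, the index being raised by `G`. -/
def metricSquare (G P : E →L[ℝ] E →L[ℝ] ℝ) : E →L[ℝ] E →L[ℝ] ℝ :=
  P.bilinearComp (ContinuousLinearMap.id ℝ E) (G.inverse ∘L P)

theorem metricSquare_apply (G P : E →L[ℝ] E →L[ℝ] ℝ) (X Y : E) :
    metricSquare G P X Y = P X (G.inverse (P Y)) := rfl

variable [FiniteDimensional ℝ E]

variable (E) in
/-- The trace of endomorphisms of `E`, as a continuous linear map. -/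
def traceL : (E →L[ℝ] E) →L[ℝ] ℝ :=
  LinearMap.toContinuousLinearMap (LinearMap.trace ℝ E ∘ₗ ContinuousLinearMap.coeLM ℝ)

/-- The Ricci tensor, `Ric (Y, Z) = tr (X ↦ R(X, Y) Z)`. -/
def ricci (G : E → E →L[ℝ] E →L[ℝ] ℝ) (y : E) : E →L[ℝ] E →L[ℝ] ℝ :=
  ContinuousLinearMap.compL ℝ E (E →L[ℝ] E) ℝ (traceL E) ∘L
    ((ContinuousLinearMap.flipₗᵢ ℝ E E E).toContinuousLinearEquiv.toContinuousLinearMap ∘L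
      (riemann G y).flip)

theorem ricci_apply (G : E → E →L[ℝ] E →L[ℝ] ℝ) (y Y Z : E) :
    ricci G y Y Z =
      LinearMap.trace ℝ E (((riemann G y).flip Y).flip Z : E →L[ℝ] E) := rfl

/-- The trace of a bilinear form `B` with respect to the metric `G`. -/
def metricTrace (G B : E →L[ℝ] E →L[ℝ] ℝ) : ℝ := traceL E (G.inverse ∘L B)

end Coordinates

/-! ## Invariants of a pseudo-Riemannian metric and a function on a manifold

The tangent space of Mathlib at `p` is the model vector space, a tangent vector being given by its
components in the preferred chart at `p`. So a tensor at `p` is computed in that chart. -/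

section Invariants

variable {E : Type*} [NormedAddCommGroup E] [NormedSpace ℝ E]
  {H : Type*} [TopologicalSpace H] (I : ModelWithCorners ℝ E H)
  {N : Type*} [TopologicalSpace N] [ChartedSpace H N]

/-- A field of bilinear forms on the tangent spaces, written in the preferred chart at `p`, i.e.
pulled back by the inverse of that chart. -/
def localMetric (h : ∀ p : N, TangentSpace I p →L[ℝ] TangentSpace I p →L[ℝ] ℝ) (p : N) :
    E → E →L[ℝ] E →L[ℝ] ℝ := fun y =>
  let A : E →L[ℝ] E := mfderiv 𝓘(ℝ, E) I (extChartAt I p).symm y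
  let B : E →L[ℝ] E →L[ℝ] ℝ := h ((extChartAt I p).symm y)
  B.bilinearComp A A

/-- A function written in the preferred chart at `p`. -/
def localFun (f : N → ℝ) (p : N) : E → ℝ := fun y => f ((extChartAt I p).symm y)

variable (h : ∀ p : N, TangentSpace I p →L[ℝ] TangentSpace I p →L[ℝ] ℝ)

/-- The Christoffel symbols at `p` in the preferred chart at `p`. -/
def christoffelAt (p : N) : TangentSpace I p →L[ℝ] TangentSpace I p →L[ℝ] TangentSpace I p :=
  christoffel (E := E) (localMetric I h p) (extChartAt I p p)

/-- The Riemann curvature tensor. -/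
def riemannAt (p : N) :
    TangentSpace I p →L[ℝ] TangentSpace I p →L[ℝ] TangentSpace I p →L[ℝ] TangentSpace I p :=
  riemann (E := E) (localMetric I h p) (extChartAt I p p)

/-- The covariant Hessian of a function. -/
def hessianAt (f : N → ℝ) (p : N) : TangentSpace I p →L[ℝ] TangentSpace I p →L[ℝ] ℝ :=
  hessian (E := E) (localMetric I h p) (localFun I f p) (extChartAt I p p)

/-- `|∇f|²`. -/
def gradSqAt (f : N → ℝ) (p : N) : ℝ :=
  gradSq (E := E) (localMetric I h p) (localFun I f p) (extChartAt I p p)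

/-- The metric is flat: its curvature tensor vanishes identically. -/
def IsFlat : Prop := ∀ p : N, riemannAt I h p = 0

/-- `γ` is a smooth curve on `J` that satisfies the geodesic equation. -/
def IsGeodesicOn (γ : ℝ → N) (J : Set ℝ) : Prop :=
  ContMDiffOn 𝓘(ℝ, ℝ) I ∞ γ J ∧
  ∀ t ∈ J,
    let c : ℝ → E := fun s => extChartAt I (γ t) (γ s)
    deriv (deriv c) t + christoffel (localMetric I h (γ t)) (c t) (deriv c t) (deriv c t) = 0

variable [FiniteDimensional ℝ E]

/-- The Ricci tensor. -/
def ricciAt (p : N) : TangentSpace I p →L[ℝ] TangentSpace I p →L[ℝ] ℝ :=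
  ricci (E := E) (localMetric I h p) (extChartAt I p p)

/-- The trace of a bilinear form at `p` with respect to the metric. -/
def traceAt (p : N) (B : TangentSpace I p →L[ℝ] TangentSpace I p →L[ℝ] ℝ) : ℝ :=
  metricTrace (E := E) (h p) B

/-- The scalar curvature `R`. -/
def scalarAt (p : N) : ℝ := traceAt I h p (ricciAt I h p)

/-- The Laplacian `Δf = tr ∇²f`. -/
def laplacianAt (f : N → ℝ) (p : N) : ℝ := traceAt I h p (hessianAt I h f p)

/-- `P_φ = Ric + ∇²φ - λ g`. -/
def weightedP (φ : N → ℝ) (lam : ℝ) (p : N) :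
    TangentSpace I p →L[ℝ] TangentSpace I p →L[ℝ] ℝ :=
  ricciAt I h p + hessianAt I h φ p - lam • h p

/-- `F_φ = Δφ - |∇φ|² + 2 λ φ - (dim N) λ`. -/
def weightedF (φ : N → ℝ) (lam : ℝ) (p : N) : ℝ :=
  laplacianAt I h φ p - gradSqAt I h φ p + 2 * lam * φ p - (Module.finrank ℝ E : ℝ) * lam

/-- `Y_φ = -(1/2) (R + |∇φ|² - 2 λ φ)`. -/
def weightedY (φ : N → ℝ) (lam : ℝ) (p : N) : ℝ :=
  -(1 / 2) * (scalarAt I h p + gradSqAt I h φ p - 2 * lam * φ p)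

/-- `(N, h, φ, λ)` is a gradient Ricci soliton: `P_φ = 0`. -/
def IsGradientRicciSoliton (φ : N → ℝ) (lam : ℝ) : Prop := ∀ p : N, weightedP I h φ lam p = 0

/-- The bilinear form with components `P_{ik} P_j^k`, where `P = P_φ`. -/
def weightedPSq (φ : N → ℝ) (lam : ℝ) (p : N) :
    TangentSpace I p →L[ℝ] TangentSpace I p →L[ℝ] ℝ :=
  metricSquare (E := E) (h p) (weightedP I h φ lam p)

/-- `g_u = g + 2 u P_φ + u² P_φ²`. -/
def metricFamily (φ : N → ℝ) (lam u : ℝ) (p : N) :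
    TangentSpace I p →L[ℝ] TangentSpace I p →L[ℝ] ℝ :=
  h p + (2 * u) • weightedP I h φ lam p + u ^ 2 • weightedPSq I h φ lam p

/-- `φ_u = φ - u Y_φ`. -/
def potentialFamily (φ : N → ℝ) (lam u : ℝ) (p : N) : ℝ := φ p - u * weightedY I h φ lam p

end Invariants

/-- A bilinear form has signature `(a, b)`: in some basis it is diagonal with `a` entries `1` and
`b` entries `-1`. -/
def HasSignature {V : Type*} [AddCommGroup V] [Module ℝ V] (B : V → V → ℝ) (a b : ℕ) : Prop :=
  ∃ e : Module.Basis (Fin a ⊕ Fin b) ℝ V, ∀ i j : Fin a ⊕ Fin b,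
    B (e i) (e j) = if i = j then Sum.elim (fun _ => (1 : ℝ)) (fun _ => (-1 : ℝ)) i else 0

/-! ## Ambient spaces

The cone `𝒢` of `(M, g, [φ])` consists of the triples `(x, g_x, l)` with `x ∈ M` and `l ∈ ℝ`, and
is `M × ℝ`. A representative `φ` gives the coordinates `(v, x)`, `l = φ(x) - v`, on `𝒢`, and so the
coordinates `(v, x, u)` on `𝒢 × ℝ`, which is thereby identified with `ℝ × M × ℝ`. -/

section Ambient

variable {n : ℕ} {M : Type*} [TopologicalSpace M] [ChartedSpace (EuclideanSpace ℝ (Fin n)) M]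

/-- The model of `ℝ × M × ℝ`. -/
abbrev ambientModel (n : ℕ) := 𝓘(ℝ, ℝ).prod ((𝓡 n).prod 𝓘(ℝ, ℝ))

/-- A field of bilinear forms on the tangent spaces of `ℝ × M × ℝ`. -/
abbrev AmbientForm (n : ℕ) (M : Type*) [TopologicalSpace M]
    [ChartedSpace (EuclideanSpace ℝ (Fin n)) M] :=
  ∀ p : ℝ × M × ℝ, TangentSpace (ambientModel n) p →L[ℝ] TangentSpace (ambientModel n) p →L[ℝ] ℝ

/-- A smooth Riemannian metric on `M`. -/
abbrev SmoothMetric (n : ℕ) (M : Type*) [TopologicalSpace M]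
    [ChartedSpace (EuclideanSpace ℝ (Fin n)) M] [IsManifold (𝓡 n) ∞ M] :=
  ContMDiffRiemannianMetric (𝓡 n) ∞ (EuclideanSpace ℝ (Fin n))
    (fun x : M => TangentSpace (𝓡 n) x)

/-- The inclusion `ι` of the cone, `(x, l) ↦ (φ(x) - l, x, 0)`. -/
def coneInclusion (φ : M → ℝ) (z : M × ℝ) : ℝ × M × ℝ := (φ z.1 - z.2, z.1, 0)

/-- The dilation `δ_s (v, x, u) = (v + (λ u - 1)⁻¹ s, x, u)`; it is defined where `λ u ≠ 1`. -/
def dilation (lam s : ℝ) (p : ℝ × M × ℝ) : ℝ × M × ℝ :=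
  (p.1 + (lam * p.2.2 - 1)⁻¹ * s, p.2.1, p.2.2)

/-- The translation `(v, x, u) ↦ (v + s, x, u)`. -/
def vTranslation (s : ℝ) (p : ℝ × M × ℝ) : ℝ × M × ℝ := (p.1 + s, p.2.1, p.2.2)

/-- The metric `2 du dv + g_u`, with `2 du dv = du ⊗ dv + dv ⊗ du`, for a family `gu` of bilinear
forms on `M`. -/
def normalMetric (gu : ℝ → ∀ x : M, TangentSpace (𝓡 n) x →L[ℝ] TangentSpace (𝓡 n) x →L[ℝ] ℝ) :
    AmbientForm n M := fun p =>
  let E := EuclideanSpace ℝ (Fin n)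
  let dv : ℝ × E × ℝ →L[ℝ] ℝ := ContinuousLinearMap.fst ℝ ℝ (E × ℝ)
  let dx : ℝ × E × ℝ →L[ℝ] E :=
    ContinuousLinearMap.fst ℝ E ℝ ∘L ContinuousLinearMap.snd ℝ ℝ (E × ℝ)
  let du : ℝ × E × ℝ →L[ℝ] ℝ :=
    ContinuousLinearMap.snd ℝ E ℝ ∘L ContinuousLinearMap.snd ℝ ℝ (E × ℝ)
  let B : E →L[ℝ] E →L[ℝ] ℝ := gu p.2.2 p.2.1
  (ContinuousLinearMap.mul ℝ ℝ).bilinearComp du dv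
    + (ContinuousLinearMap.mul ℝ ℝ).bilinearComp dv du + B.bilinearComp dx dx

/-- The function `φ_u - v + λ u v`, for a family `φu` of functions on `M`. -/
def normalPotential (φu : ℝ → M → ℝ) (lam : ℝ) (p : ℝ × M × ℝ) : ℝ :=
  φu p.2.2 p.2.1 - p.1 + lam * p.2.2 * p.1

variable [IsManifold (𝓡 n) ∞ M]

/-- `(D, g', φ', λ)` is a pre-ambient space of `(M, g, [φ], λ)`. Only the restrictions of `g'` and
`φ'` to the open set `D` matter. -/
structure IsPreAmbientSpace (g : SmoothMetric n M) (φ : M → ℝ) (lam : ℝ)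
    (D : Set (ℝ × M × ℝ)) (g' : AmbientForm n M) (φ' : ℝ × M × ℝ → ℝ) : Prop where
  isOpen : IsOpen D
  cone_subset : ∀ z : M × ℝ, coneInclusion φ z ∈ D
  lam_mul_u_ne_one : ∀ p ∈ D, lam * p.2.2 ≠ 1
  dilation_mem : ∀ p ∈ D, ∀ s : ℝ, dilation lam s p ∈ D
  smooth_metric : ContMDiffOn (ambientModel n)
    ((ambientModel n).prod 𝓘(ℝ, (ℝ × EuclideanSpace ℝ (Fin n) × ℝ) →L[ℝ]
      (ℝ × EuclideanSpace ℝ (Fin n) × ℝ) →L[ℝ] ℝ)) ∞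
    (fun p : ℝ × M × ℝ => TotalSpace.mk' ((ℝ × EuclideanSpace ℝ (Fin n) × ℝ) →L[ℝ]
      (ℝ × EuclideanSpace ℝ (Fin n) × ℝ) →L[ℝ] ℝ)
      (E := fun p : ℝ × M × ℝ =>
        TangentSpace (ambientModel n) p →L[ℝ] TangentSpace (ambientModel n) p →L[ℝ] ℝ)
      p (g' p)) D
  signature : ∀ p ∈ D, HasSignature (fun X Y : TangentSpace (ambientModel n) p => g' p X Y) (n + 1) 1
  smooth_potential : ContMDiffOn (ambientModel n) 𝓘(ℝ, ℝ) ∞ φ' D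
  /-- The dilations move the points of `D` along the `v`-lines, and `g'` does not depend on `v`. -/
  metric_invariant : ∀ p ∈ D, ∀ (s : ℝ) (X Y : TangentSpace (ambientModel n) p),
    g' (vTranslation s p)
      (mfderiv (ambientModel n) (ambientModel n) (vTranslation s) p X)
      (mfderiv (ambientModel n) (ambientModel n) (vTranslation s) p Y) = g' p X Y
  potential_dilation : ∀ p ∈ D, ∀ s : ℝ, φ' (dilation lam s p) = φ' p + s
  /-- `ι^* g'` is the tautological form `g_x (π_* X, π_* Y)` of the cone. -/
  metric_on_cone : ∀ (z : M × ℝ) (X Y : TangentSpace ((𝓡 n).prod 𝓘(ℝ, ℝ)) z),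
    g' (coneInclusion φ z)
      (mfderiv ((𝓡 n).prod 𝓘(ℝ, ℝ)) (ambientModel n) (coneInclusion φ) z X)
      (mfderiv ((𝓡 n).prod 𝓘(ℝ, ℝ)) (ambientModel n) (coneInclusion φ) z Y) =
    g.inner z.1 (mfderiv ((𝓡 n).prod 𝓘(ℝ, ℝ)) (𝓡 n) Prod.fst z X)
      (mfderiv ((𝓡 n).prod 𝓘(ℝ, ℝ)) (𝓡 n) Prod.fst z Y)
  /-- `ι^* φ'` is the tautological function `(x, g_x, l) ↦ l` of the cone. -/
  potential_on_cone : ∀ z : M × ℝ, φ' (coneInclusion φ z) = z.2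
  /-- `∇_{∂v} ∂v = O(u)`. -/
  straight : ∀ (v : ℝ) (x : M),
    (fun u : ℝ => (christoffelAt (ambientModel n) g' (v, x, u)
      ((1, 0, 0) : ℝ × EuclideanSpace ℝ (Fin n) × ℝ)
      ((1, 0, 0) : ℝ × EuclideanSpace ℝ (Fin n) × ℝ) : ℝ × EuclideanSpace ℝ (Fin n) × ℝ))
      =O[𝓝 0] (fun u : ℝ => u)

/-- A pre-ambient space is a weighted ambient space if `P = O(u^∞)` and `F = O(u^∞)`. Along a
`u`-line the components of `P` refer to one fixed chart. -/
structure IsWeightedAmbientSpace (g : SmoothMetric n M) (φ : M → ℝ) (lam : ℝ)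
    (D : Set (ℝ × M × ℝ)) (g' : AmbientForm n M) (φ' : ℝ × M × ℝ → ℝ) : Prop
    extends IsPreAmbientSpace g φ lam D g' φ' where
  weightedP_flat : ∀ (v : ℝ) (x : M) (X Y : ℝ × EuclideanSpace ℝ (Fin n) × ℝ) (m : ℕ),
    (fun u : ℝ => weightedP (ambientModel n) g' φ' lam (v, x, u) X Y) =O[𝓝 0] (fun u : ℝ => u ^ m)
  weightedF_flat : ∀ (v : ℝ) (x : M) (m : ℕ),
    (fun u : ℝ => weightedF (ambientModel n) g' φ' lam (v, x, u)) =O[𝓝 0] (fun u : ℝ => u ^ m)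

/-- The pair `(D, g')` is in normal form relative to `(g, φ)`. -/
structure IsInNormalForm (g : SmoothMetric n M) (D : Set (ℝ × M × ℝ)) (g' : AmbientForm n M) :
    Prop where
  interval : ∀ (v : ℝ) (x : M), IsOpen {u : ℝ | (v, x, u) ∈ D} ∧
    OrdConnected {u : ℝ | (v, x, u) ∈ D} ∧ (0 : ℝ) ∈ {u : ℝ | (v, x, u) ∈ D}
  geodesic : ∀ (v : ℝ) (x : M),
    IsGeodesicOn (ambientModel n) g' (fun u : ℝ => (v, x, u)) {u : ℝ | (v, x, u) ∈ D}
  /-- `g' = g + 2 du dv` at the points of the cone. -/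
  metric_at_cone : ∀ (v : ℝ) (x : M), g' (v, x, 0) = normalMetric (fun _ => g.inner) (v, x, 0)

/-- The open sets on which `2 du dv + g_u`, `φ_u - v + λ u v` can be considered as an ambient space
in normal form: dilation-invariant neighbourhoods of the cone `u = 0` that meet the `u`-lines in
intervals and on which the dilations are defined and `g_u` is nondegenerate. -/
structure IsNormalDomain (g : SmoothMetric n M) (φ : M → ℝ) (lam : ℝ)
    (D : Set (ℝ × M × ℝ)) : Prop where
  isOpen : IsOpen D
  cone_subset : ∀ (v : ℝ) (x : M), (v, x, 0) ∈ D
  lam_mul_u_ne_one : ∀ p ∈ D, lam * p.2.2 ≠ 1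
  dilation_mem : ∀ p ∈ D, ∀ s : ℝ, dilation lam s p ∈ D
  interval : ∀ (v : ℝ) (x : M), OrdConnected {u : ℝ | (v, x, u) ∈ D}
  nondegenerate : ∀ p ∈ D, ∀ X : TangentSpace (𝓡 n) p.2.1,
    (∀ Y : TangentSpace (𝓡 n) p.2.1, metricFamily (𝓡 n) g.inner φ lam p.2.2 p.2.1 X Y = 0) → X = 0

end Ambient

end WeightedAmbient

end

/-! Let `A = g⁻¹P` be the endomorphism obtained from `P = P_φ` by raising an index. Completing the
square gives `g_u = g((1 + uA)·, (1 + uA)·)`, so the ambient metric is the pullback of the model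
form `2 du dv + g` by the frame change `T = 1 + uA` acting on the `x`-directions
(`ambientMetric_eq`). In particular `g_u` is nondegenerate exactly where `T` is invertible.

Two facts about `(g, φ)` carry the theorem: `P` is a Codazzi tensor (`localP_codazzi`), and `dY =
-dφ ∘ A` (`fderiv_localY`). For a soliton the first is trivial, and the second says that `R + |∇φ|²
- 2λφ` is locally constant, which is Hamilton's identity and rests on the contracted second Bianchi
identity. For a flat metric `P = ∇²φ - λg`, so the first is the commutation of covariant derivatives
on `dφ`, and the second is the derivative of `|∇φ|²`.

In the frame `T` the Levi-Civita connection of the ambient metric is the explicit `frameConnection`,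
built from `Γ`, `P` and `A` and independent of `u` and `v`. It is metric by inspection, and
torsion-free because `A` is Codazzi (`map_ambient_christoffel`). All new terms of its curvature are
Codazzi defects, so only the curvature of `g` survives (`connectionCurvature_frameConnection`).
Since `A = 0` or the curvature of `g` vanishes, `T` drops out: the ambient curvature and Ricci
tensors are the pullbacks of those of `g`.

By `dY = -dφ ∘ A` the differential of the ambient potential is `α ∘ T` with `α = (λu - 1) dv + dφ +
(λv - Y) du`. Differentiating `α` with `frameConnection` gives `∇²φ̃ = λ g̃ - Ric`
(`ambient_hessian`), that is `P̃ = 0`. Taking the trace reduces `F̃ = 0` to the definition of `Y`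
(`ambient_weightedF`).

All this happens in coordinates. Naturality under changes of chart carries it to the manifold, where
every tensor at a point is computed in the preferred chart at that point. -/

noncomputable section

namespace WeightedAmbient

/-! ### Coordinate calculus of a metric on an open set: compatibility, uniqueness of the connection,
smoothness. -/

section LocalGeometry

variable {E : Type*} [NormedAddCommGroup E] [NormedSpace ℝ E]

/-- `G` is a smooth pseudo-Riemannian metric on the open subset `U` of `E`. -/
structure IsMetricOn (G : E → E →L[ℝ] E →L[ℝ] ℝ) (U : Set E) : Prop where
  isOpen : IsOpen U
  contDiffOn : ContDiffOn ℝ ∞ G U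
  symm : ∀ y ∈ U, ∀ X Y, G y X Y = G y Y X
  invertible : ∀ y ∈ U, (G y).IsInvertible

section Calculus

variable {F F₁ F₂ F₃ : Type*} [NormedAddCommGroup F] [NormedSpace ℝ F]
  [NormedAddCommGroup F₁] [NormedSpace ℝ F₁] [NormedAddCommGroup F₂] [NormedSpace ℝ F₂]
  [NormedAddCommGroup F₃] [NormedSpace ℝ F₃]

theorem hasFDerivAt_apply_const {c : E → F₁ →L[ℝ] F} {c' : E →L[ℝ] F₁ →L[ℝ] F} {y : E}
    (hc : HasFDerivAt c c' y) (a : F₁) : HasFDerivAt (fun z => c z a) (c'.flip a) y :=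
  ((ContinuousLinearMap.apply ℝ F a).hasFDerivAt.comp y hc)

theorem fderiv_apply_const {c : E → F₁ →L[ℝ] F} {y : E} (hc : DifferentiableAt ℝ c y) (a : F₁)
    (X : E) : fderiv ℝ (fun z => c z a) y X = fderiv ℝ c y X a := by
  rw [(hasFDerivAt_apply_const hc.hasFDerivAt a).fderiv]; rfl

theorem fderiv_apply_const₂ {c : E → F₁ →L[ℝ] F₂ →L[ℝ] F} {y : E} (hc : DifferentiableAt ℝ c y)
    (a : F₁) (b : F₂) (X : E) : fderiv ℝ (fun z => c z a b) y X = fderiv ℝ c y X a b := by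
  rw [fderiv_apply_const (c := fun z => c z a) (hc.clm_apply (differentiableAt_const a)) b X,
    fderiv_apply_const hc]

theorem differentiableAt_of_contDiffOn {c : E → F} {U : Set E} (hU : IsOpen U)
    (hc : ContDiffOn ℝ ∞ c U) {y : E} (hy : y ∈ U) : DifferentiableAt ℝ c y :=
  (hc.contDiffAt (hU.mem_nhds hy)).differentiableAt (by simp)

theorem contDiffOn_fderiv {c : E → F} {U : Set E} (hU : IsOpen U) (hc : ContDiffOn ℝ ∞ c U) :
    ContDiffOn ℝ ∞ (fderiv ℝ c) U :=
  hc.fderiv_of_isOpen hU (by simp)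

theorem fderiv_fderiv_symm {c : E → F} {U : Set E} (hU : IsOpen U) (hc : ContDiffOn ℝ ∞ c U)
    {y : E} (hy : y ∈ U) (X Y : E) :
    fderiv ℝ (fderiv ℝ c) y X Y = fderiv ℝ (fderiv ℝ c) y Y X :=
  ((hc.contDiffAt (hU.mem_nhds hy)).isSymmSndFDerivAt
    (by simp only [minSmoothness_of_isRCLikeNormedField]; exact WithTop.coe_le_coe.2 le_top)) X Y

end Calculus

section Christoffel

variable {G : E → E →L[ℝ] E →L[ℝ] ℝ} {U : Set E}

theorem christoffelFirst_congr {G' : E → E →L[ℝ] E →L[ℝ] ℝ} {y : E} (h : G =ᶠ[𝓝 y] G') :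
    christoffelFirst G y = christoffelFirst G' y := by
  ext X Y Z; simp only [christoffelFirst_apply, h.fderiv_eq]

theorem christoffel_congr {G' : E → E →L[ℝ] E →L[ℝ] ℝ} {y : E} (h : G =ᶠ[𝓝 y] G') :
    christoffel G y = christoffel G' y := by
  ext X Y; simp only [christoffel_apply, christoffelFirst_congr h, h.eq_of_nhds]

theorem christoffel_eventuallyEq {G' : E → E →L[ℝ] E →L[ℝ] ℝ} {y : E} (h : G =ᶠ[𝓝 y] G') :
    christoffel G =ᶠ[𝓝 y] christoffel G' :=
  h.eventuallyEq_nhds.mono fun _ hz => christoffel_congr hz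

theorem riemann_congr {G' : E → E →L[ℝ] E →L[ℝ] ℝ} {y : E} (h : G =ᶠ[𝓝 y] G') :
    riemann G y = riemann G' y := by
  ext X Y Z
  simp only [riemann_apply, (christoffel_eventuallyEq h).fderiv_eq, christoffel_congr h]

theorem hessian_congr {G' : E → E →L[ℝ] E →L[ℝ] ℝ} {f f' : E → ℝ} {y : E} (h : G =ᶠ[𝓝 y] G')
    (hf : f =ᶠ[𝓝 y] f') : hessian G f y = hessian G' f' y := by
  ext X Y
  simp only [hessian_apply, christoffel_congr h, hf.fderiv.fderiv_eq, hf.fderiv_eq]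

theorem gradSq_congr {G' : E → E →L[ℝ] E →L[ℝ] ℝ} {f f' : E → ℝ} {y : E} (h : G =ᶠ[𝓝 y] G')
    (hf : f =ᶠ[𝓝 y] f') : gradSq G f y = gradSq G' f' y := by
  simp only [gradSq, hf.fderiv_eq, h.eq_of_nhds]

namespace IsMetricOn

variable (hG : IsMetricOn G U) {y : E}
include hG

theorem differentiableAt (hy : y ∈ U) : DifferentiableAt ℝ G y :=
  differentiableAt_of_contDiffOn hG.isOpen hG.contDiffOn hy

theorem fderiv_symm (hy : y ∈ U) (X Y Z : E) : fderiv ℝ G y X Y Z = fderiv ℝ G y X Z Y := by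
  have hd := hG.differentiableAt hy
  rw [← fderiv_apply_const₂ hd, ← fderiv_apply_const₂ hd]
  have : (fun z => G z Y Z) =ᶠ[𝓝 y] fun z => G z Z Y := by
    filter_upwards [hG.isOpen.mem_nhds hy] with z hz using hG.symm z hz Y Z
  rw [this.fderiv_eq]

theorem apply_inverse (hy : y ∈ U) (α : E →L[ℝ] ℝ) : G y ((G y).inverse α) = α :=
  (hG.invertible y hy).self_apply_inverse α

theorem eq_of_forall (hy : y ∈ U) {X Y : E} (h : ∀ Z, G y X Z = G y Y Z) : X = Y :=
  (hG.invertible y hy).injective (ContinuousLinearMap.ext h)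

theorem apply_christoffel (hy : y ∈ U) (X Y Z : E) :
    G y (christoffel G y X Y) Z = christoffelFirst G y X Y Z := by
  rw [christoffel_apply, hG.apply_inverse hy]

theorem christoffel_symm (hy : y ∈ U) (X Y : E) : christoffel G y X Y = christoffel G y Y X := by
  refine hG.eq_of_forall hy fun Z => ?_
  rw [hG.apply_christoffel hy, hG.apply_christoffel hy, christoffelFirst_apply,
    christoffelFirst_apply, hG.fderiv_symm hy Z X Y]
  ring

/-- Metric compatibility `∇G = 0`: in the sum of the two symbols of the first kind everything
cancels except the `X`-derivative. -/
theorem fderiv_eq (hy : y ∈ U) (X Y Z : E) :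
    fderiv ℝ G y X Y Z = G y (christoffel G y X Y) Z + G y Y (christoffel G y X Z) := by
  rw [hG.symm y hy Y, hG.apply_christoffel hy, hG.apply_christoffel hy, christoffelFirst_apply,
    christoffelFirst_apply, hG.fderiv_symm hy X Z Y]
  ring

/-- A symmetric bilinear map `B` that is compatible with the metric `G = T^* K` is the
Levi-Civita connection of `G`, expressed through `T`. -/
theorem map_christoffel_eq (hy : y ∈ U) {K : E →L[ℝ] E →L[ℝ] ℝ} {T : E →L[ℝ] E} {B : E → E → E}
    (hK : K.IsInvertible) (hKs : ∀ X Y, K X Y = K Y X) (hT : T.IsInvertible)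
    (hGK : ∀ X Y, G y X Y = K (T X) (T Y)) (hB : ∀ X Y, B X Y = B Y X)
    (hD : ∀ X Y Z, fderiv ℝ G y X Y Z = K (B X Y) (T Z) + K (T Y) (B X Z)) (X Y : E) :
    T (christoffel G y X Y) = B X Y := by
  refine hK.injective (ContinuousLinearMap.ext fun Z' => ?_)
  obtain ⟨Z, rfl⟩ := hT.surjective Z'
  -- Koszul's argument: `hD` turns the three derivatives into six terms, which the symmetries of `B`
  -- and `K` pair off, leaving `2 K (B X Y) (T Z)`.
  rw [← hGK, hG.apply_christoffel hy, christoffelFirst_apply, hD, hD, hD, hB Y X, hB Z X, hB Z Y,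
    hKs (T X), hKs (B X Z)]
  ring

variable [FiniteDimensional ℝ E]

theorem contDiffOn_inverse : ContDiffOn ℝ ∞ (fun z => (G z).inverse) U := by
  intro z hz
  have : CompleteSpace E := FiniteDimensional.complete ℝ E
  have h1 := (hG.invertible z hz).contDiffAt_map_inverse (n := ∞) (𝕜 := ℝ)
  exact h1.comp_contDiffWithinAt z (hG.contDiffOn z hz)

theorem contDiffOn_christoffel : ContDiffOn ℝ ∞ (christoffel G) U := by
  have h1 := contDiffOn_fderiv hG.isOpen hG.contDiffOn
  have h2 : ContDiffOn ℝ ∞ (christoffelFirst G) U := by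
    have h3 (X Y Z : E) : ContDiffOn ℝ ∞ (fun z => fderiv ℝ G z X Y Z) U :=
      ((h1.clm_apply contDiffOn_const).clm_apply contDiffOn_const).clm_apply contDiffOn_const
    refine contDiffOn_clm_apply.2 fun X => contDiffOn_clm_apply.2 fun Y =>
      contDiffOn_clm_apply.2 fun Z => ?_
    simp only [christoffelFirst_apply]
    exact contDiffOn_const.mul (((h3 X Y Z).add (h3 Y X Z)).sub (h3 Z X Y))
  refine contDiffOn_clm_apply.2 fun X => contDiffOn_clm_apply.2 fun Y => ?_
  simp only [christoffel_apply]
  exact hG.contDiffOn_inverse.clm_apply ((h2.clm_apply contDiffOn_const).clm_apply contDiffOn_const)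

theorem contDiffOn_riemann : ContDiffOn ℝ ∞ (riemann G) U := by
  have h0 := hG.contDiffOn_christoffel
  have h1 := contDiffOn_fderiv hG.isOpen h0
  have h2 (X Y Z : E) : ContDiffOn ℝ ∞ (fun z => fderiv ℝ (christoffel G) z X Y Z) U :=
    ((h1.clm_apply contDiffOn_const).clm_apply contDiffOn_const).clm_apply contDiffOn_const
  have h3 (X Y Z : E) : ContDiffOn ℝ ∞ (fun z => christoffel G z X (christoffel G z Y Z)) U :=
    (h0.clm_apply contDiffOn_const).clm_apply
      ((h0.clm_apply contDiffOn_const).clm_apply contDiffOn_const)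
  refine contDiffOn_clm_apply.2 fun X => contDiffOn_clm_apply.2 fun Y =>
    contDiffOn_clm_apply.2 fun Z => ?_
  simp only [riemann_apply]
  exact (((h2 X Y Z).sub (h2 Y X Z)).add (h3 X Y Z)).sub (h3 Y X Z)

theorem contDiffOn_hessian {f : E → ℝ} (hf : ContDiffOn ℝ ∞ f U) :
    ContDiffOn ℝ ∞ (hessian G f) U := by
  have h1 := contDiffOn_fderiv hG.isOpen hf
  have h2 := contDiffOn_fderiv hG.isOpen h1
  refine contDiffOn_clm_apply.2 fun X => contDiffOn_clm_apply.2 fun Y => ?_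
  simp only [hessian_apply]
  exact ((h2.clm_apply contDiffOn_const).clm_apply contDiffOn_const).sub
    (h1.clm_apply ((hG.contDiffOn_christoffel.clm_apply contDiffOn_const).clm_apply
      contDiffOn_const))

theorem contDiffOn_gradSq {f : E → ℝ} (hf : ContDiffOn ℝ ∞ f U) :
    ContDiffOn ℝ ∞ (gradSq G f) U := by
  have h1 := contDiffOn_fderiv hG.isOpen hf
  exact h1.clm_apply (hG.contDiffOn_inverse.clm_apply h1)

theorem contDiffOn_ricci : ContDiffOn ℝ ∞ (ricci G) U := by
  refine contDiffOn_clm_apply.2 fun X => contDiffOn_clm_apply.2 fun Y => ?_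
  have h1 : ContDiffOn ℝ ∞ (fun z => ((riemann G z).flip X).flip Y) U := by
    refine contDiffOn_clm_apply.2 fun Z => ?_
    simp only [ContinuousLinearMap.flip_apply]
    exact ((hG.contDiffOn_riemann.clm_apply contDiffOn_const).clm_apply contDiffOn_const).clm_apply
      contDiffOn_const
  have h2 : ContDiffOn ℝ ∞ (fun z => traceL E (((riemann G z).flip X).flip Y)) U :=
    (traceL E).contDiff.comp_contDiffOn h1
  exact h2.congr fun z _ => ricci_apply G z X Y

theorem contDiffOn_metricTrace {B : E → E →L[ℝ] E →L[ℝ] ℝ} (hB : ContDiffOn ℝ ∞ B U) :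
    ContDiffOn ℝ ∞ (fun z => metricTrace (G z) (B z)) U :=
  (traceL E).contDiff.comp_contDiffOn (hG.contDiffOn_inverse.clm_comp hB)

end IsMetricOn

end Christoffel

end LocalGeometry

/-! ### Naturality of connection, curvature, Hessian and traces under local diffeomorphisms. -/

section Naturality

variable {E : Type*} [NormedAddCommGroup E] [NormedSpace ℝ E]

/-- The curvature of the connection `∇_X = D_X + θ(X)` on the trivial bundle with fibre `E`. -/
def connectionCurvature (θ : E → E →L[ℝ] E →L[ℝ] E) (y X Y Z : E) : E :=
  fderiv ℝ θ y X Y Z - fderiv ℝ θ y Y X Z + θ y X (θ y Y Z) - θ y Y (θ y X Z)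

/-- The curvature is natural: if `T` intertwines the connection `θ'` and the pullback of the
connection `θ` by `Ψ`, it intertwines their curvatures. -/
theorem map_connectionCurvature {U V : Set E} (hU : IsOpen U) (hV : IsOpen V) {Ψ : E → E}
    {T : E → E →L[ℝ] E} {θ θ' : E → E →L[ℝ] E →L[ℝ] E} (hΨ : ContDiffOn ℝ ∞ Ψ U)
    (hT : ContDiffOn ℝ ∞ T U) (hθ : ContDiffOn ℝ ∞ θ V) (hθ' : ContDiffOn ℝ ∞ θ' U)
    (hUV : MapsTo Ψ U V)
    (h : ∀ z ∈ U, ∀ X Y, T z (θ' z X Y) = fderiv ℝ T z X Y + θ (Ψ z) (fderiv ℝ Ψ z X) (T z Y))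
    {y : E} (hy : y ∈ U) (X Y Z : E) :
    T y (connectionCurvature θ' y X Y Z) =
      connectionCurvature θ (Ψ y) (fderiv ℝ Ψ y X) (fderiv ℝ Ψ y Y) (T y Z) := by
  have dΨ := (differentiableAt_of_contDiffOn hU hΨ hy).hasFDerivAt
  have dT := (differentiableAt_of_contDiffOn hU hT hy).hasFDerivAt
  have dθ := (differentiableAt_of_contDiffOn hV hθ (hUV hy)).hasFDerivAt
  have dθ' := (differentiableAt_of_contDiffOn hU hθ' hy).hasFDerivAt
  have dΨ2 := (differentiableAt_of_contDiffOn hU (contDiffOn_fderiv hU hΨ) hy).hasFDerivAt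
  have dT2 := (differentiableAt_of_contDiffOn hU (contDiffOn_fderiv hU hT) hy).hasFDerivAt
  -- The intertwining relation differentiated along `X`, with `Y` and `Z` constant. Antisymmetrizing
  -- in `X` and `Y` removes the second derivatives of `T` and `Ψ`.
  have key (X Y Z : E) : fderiv ℝ T y X (θ' y Y Z) + T y (fderiv ℝ θ' y X Y Z) =
      fderiv ℝ (fderiv ℝ T) y X Y Z + fderiv ℝ θ (Ψ y) (fderiv ℝ Ψ y X) (fderiv ℝ Ψ y Y) (T y Z)
        + θ (Ψ y) (fderiv ℝ (fderiv ℝ Ψ) y X Y) (T y Z)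
        + θ (Ψ y) (fderiv ℝ Ψ y Y) (fderiv ℝ T y X Z) := by
    have h1 := dT.clm_apply (hasFDerivAt_apply_const (hasFDerivAt_apply_const dθ' Y) Z)
    have h2 := (hasFDerivAt_apply_const (hasFDerivAt_apply_const dT2 Y) Z).add
      (((dθ.comp y dΨ).clm_apply (hasFDerivAt_apply_const dΨ2 Y)).clm_apply
        (hasFDerivAt_apply_const dT Z))
    have h3 := h1.unique (h2.congr_of_eventuallyEq (by
      filter_upwards [hU.mem_nhds hy] with z hz
      exact h z hz Y Z))
    have h4 := congrArg (fun A : E →L[ℝ] E => A X) h3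
    simp only [add_apply, ContinuousLinearMap.comp_apply,
      ContinuousLinearMap.flip_apply, Function.comp_apply] at h4
    linear_combination (norm := module) h4
  have k1 := key X Y Z
  have k2 := key Y X Z
  rw [fderiv_fderiv_symm hU hΨ hy Y X, fderiv_fderiv_symm hU hT hy Y X] at k2
  have a1 := h y hy X (θ' y Y Z)
  have a2 := h y hy Y (θ' y X Z)
  rw [h y hy Y Z, map_add] at a1
  rw [h y hy X Z, map_add] at a2
  simp only [connectionCurvature, map_add, map_sub]
  linear_combination (norm := module) k1 - k2 + a1 - a2

section Algebra

variable {K G : E →L[ℝ] E →L[ℝ] ℝ} {T : E →L[ℝ] E}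

theorem isInvertible_of_pullback (hK : K.IsInvertible) (hT : T.IsInvertible)
    (h : ∀ X Y, G X Y = K (T X) (T Y)) : G.IsInvertible := by
  obtain ⟨K, rfl⟩ := hK
  obtain ⟨T, rfl⟩ := hT
  refine ⟨T.trans (K.trans (T.symm.arrowCongr (ContinuousLinearEquiv.refl ℝ ℝ))), ?_⟩
  ext X Y
  simp [h]

/-- Here `β = T^*α`: raising an index commutes with pullback. Gradients, metric traces and the
square `P_{ik} P_j^k` all transform through this. -/
theorem map_inverse_pullback (hK : K.IsInvertible) (hT : T.IsInvertible)
    (h : ∀ X Y, G X Y = K (T X) (T Y)) {α β : E →L[ℝ] ℝ} (hα : ∀ X, β X = α (T X)) :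
    T (G.inverse β) = K.inverse α := by
  refine hK.injective (ContinuousLinearMap.ext fun Z' => ?_)
  obtain ⟨Z, rfl⟩ := hT.surjective Z'
  rw [← h, (isInvertible_of_pullback hK hT h).self_apply_inverse, hK.self_apply_inverse, hα]

theorem metricSquare_pullback (hK : K.IsInvertible) (hT : T.IsInvertible)
    (h : ∀ X Y, G X Y = K (T X) (T Y)) {P Q : E →L[ℝ] E →L[ℝ] ℝ}
    (hP : ∀ X Y, Q X Y = P (T X) (T Y)) (X Y : E) :
    metricSquare G Q X Y = metricSquare K P (T X) (T Y) := by
  rw [metricSquare_apply, metricSquare_apply, hP,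
    map_inverse_pullback hK hT h (α := P (T Y)) (hP Y)]

variable [FiniteDimensional ℝ E]

theorem trace_eq_of_intertwine {A B : E →L[ℝ] E} (hT : T.IsInvertible)
    (h : ∀ X, T (A X) = B (T X)) : traceL E A = traceL E B := by
  obtain ⟨T, rfl⟩ := hT
  have : (B : E →ₗ[ℝ] E) = T.toLinearEquiv.conj (A : E →ₗ[ℝ] E) := by
    ext X
    have := h (T.symm X)
    simp at this
    simp [LinearEquiv.conj_apply, this]
  change LinearMap.trace ℝ E (A : E →ₗ[ℝ] E) = LinearMap.trace ℝ E (B : E →ₗ[ℝ] E)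
  rw [this, LinearMap.trace_conj']

theorem metricTrace_pullback (hK : K.IsInvertible) (hT : T.IsInvertible)
    (h : ∀ X Y, G X Y = K (T X) (T Y)) {P Q : E →L[ℝ] E →L[ℝ] ℝ}
    (hP : ∀ X Y, Q X Y = P (T X) (T Y)) : metricTrace G Q = metricTrace K P :=
  trace_eq_of_intertwine hT fun X => map_inverse_pullback hK hT h (α := P (T X)) (hP X)

end Algebra

/-- On `U`, the smooth metric `G'` is the pullback of the metric `G` on `V` by the local
diffeomorphism `Ψ`. -/
structure IsPullbackOn (G' G : E → E →L[ℝ] E →L[ℝ] ℝ) (Ψ : E → E) (U V : Set E) : Prop where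
  source : IsMetricOn G' U
  target : IsMetricOn G V
  contDiffOn : ContDiffOn ℝ ∞ Ψ U
  mapsTo : MapsTo Ψ U V
  invertible : ∀ z ∈ U, (fderiv ℝ Ψ z).IsInvertible
  eq : ∀ z ∈ U, ∀ X Y, G' z X Y = G (Ψ z) (fderiv ℝ Ψ z X) (fderiv ℝ Ψ z Y)

/-- Smoothness, symmetry and invertibility of the pullback are inherited from the target, so only
the target has to be known to be a metric. -/
theorem IsMetricOn.isPullbackOn {G' G : E → E →L[ℝ] E →L[ℝ] ℝ} {Ψ : E → E} {U V : Set E}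
    (hG : IsMetricOn G V) (hU : IsOpen U) (hΨ : ContDiffOn ℝ ∞ Ψ U) (hUV : MapsTo Ψ U V)
    (hinv : ∀ z ∈ U, (fderiv ℝ Ψ z).IsInvertible)
    (h : ∀ z ∈ U, ∀ X Y, G' z X Y = G (Ψ z) (fderiv ℝ Ψ z X) (fderiv ℝ Ψ z Y))
    [FiniteDimensional ℝ E] : IsPullbackOn G' G Ψ U V := by
  refine ⟨⟨hU, ?_, ?_, ?_⟩, hG, hΨ, hUV, hinv, h⟩
  · have h1 := contDiffOn_fderiv hU hΨ
    have h2 : ContDiffOn ℝ ∞ (fun z => G (Ψ z)) U := hG.contDiffOn.comp hΨ hUV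
    refine contDiffOn_clm_apply.2 fun X => contDiffOn_clm_apply.2 fun Y => ?_
    exact ((h2.clm_apply (h1.clm_apply contDiffOn_const)).clm_apply
      (h1.clm_apply contDiffOn_const)).congr fun z hz => h z hz X Y
  · intro y hy X Y
    rw [h y hy, h y hy, hG.symm _ (hUV hy)]
  · exact fun y hy => isInvertible_of_pullback (hG.invertible _ (hUV hy)) (hinv y hy) (h y hy)

namespace IsPullbackOn

variable {G' G : E → E →L[ℝ] E →L[ℝ] ℝ} {Ψ : E → E} {U V : Set E}
  (h : IsPullbackOn G' G Ψ U V) {y : E}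
include h

theorem fderiv_metric (hy : y ∈ U) (X Y Z : E) :
    fderiv ℝ G' y X Y Z =
      fderiv ℝ G (Ψ y) (fderiv ℝ Ψ y X) (fderiv ℝ Ψ y Y) (fderiv ℝ Ψ y Z)
        + G (Ψ y) (fderiv ℝ (fderiv ℝ Ψ) y X Y) (fderiv ℝ Ψ y Z)
        + G (Ψ y) (fderiv ℝ Ψ y Y) (fderiv ℝ (fderiv ℝ Ψ) y X Z) := by
  have hU := h.source.isOpen
  have dΨ := (differentiableAt_of_contDiffOn hU h.contDiffOn hy).hasFDerivAt
  have dΨ2 := (differentiableAt_of_contDiffOn hU (contDiffOn_fderiv hU h.contDiffOn) hy).hasFDerivAt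
  have dG := (h.target.differentiableAt (h.mapsTo hy)).hasFDerivAt
  have dG' := (h.source.differentiableAt hy).hasFDerivAt
  have h1 := ((dG.comp y dΨ).clm_apply (hasFDerivAt_apply_const dΨ2 Y)).clm_apply
    (hasFDerivAt_apply_const dΨ2 Z)
  have h2 := (hasFDerivAt_apply_const (hasFDerivAt_apply_const dG' Y) Z).unique
    (h1.congr_of_eventuallyEq (by
      filter_upwards [hU.mem_nhds hy] with z hz
      exact h.eq z hz Y Z))
  have h4 := congrArg (fun A : E →L[ℝ] ℝ => A X) h2
  simp only [add_apply, ContinuousLinearMap.comp_apply,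
    ContinuousLinearMap.flip_apply, Function.comp_apply] at h4
  linear_combination h4

/-- The transformation law follows from uniqueness of the Levi-Civita connection: the right side is
symmetric and compatible with the pulled back metric. -/
theorem map_christoffel (hy : y ∈ U) (X Y : E) :
    fderiv ℝ Ψ y (christoffel G' y X Y) =
      fderiv ℝ (fderiv ℝ Ψ) y X Y
        + christoffel G (Ψ y) (fderiv ℝ Ψ y X) (fderiv ℝ Ψ y Y) := by
  have hy' := h.mapsTo hy
  refine h.source.map_christoffel_eq hy (K := G (Ψ y)) (T := fderiv ℝ Ψ y)
    (B := fun X Y => fderiv ℝ (fderiv ℝ Ψ) y X Y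
        + christoffel G (Ψ y) (fderiv ℝ Ψ y X) (fderiv ℝ Ψ y Y))
    (h.target.invertible _ hy') (h.target.symm _ hy') (h.invertible y hy) (h.eq y hy) ?_ ?_ X Y
  · intro X Y
    rw [fderiv_fderiv_symm h.source.isOpen h.contDiffOn hy, h.target.christoffel_symm hy']
  · intro X Y Z
    rw [h.fderiv_metric hy, h.target.fderiv_eq hy']
    simp only [map_add, add_apply]
    ring

theorem hessian_eq {f : E → ℝ} (hf : ContDiffOn ℝ ∞ f V) (hy : y ∈ U) (X Y : E) :
    hessian G' (fun z => f (Ψ z)) y X Y =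
      hessian G f (Ψ y) (fderiv ℝ Ψ y X) (fderiv ℝ Ψ y Y) := by
  have hU := h.source.isOpen
  have hV := h.target.isOpen
  have dΨ := (differentiableAt_of_contDiffOn hU h.contDiffOn hy).hasFDerivAt
  have dΨ2 := (differentiableAt_of_contDiffOn hU (contDiffOn_fderiv hU h.contDiffOn) hy).hasFDerivAt
  have df2 := (differentiableAt_of_contDiffOn hV (contDiffOn_fderiv hV hf)
    (h.mapsTo hy)).hasFDerivAt
  have h0 : ∀ z ∈ U, fderiv ℝ (fun z => f (Ψ z)) z = fderiv ℝ f (Ψ z) ∘L fderiv ℝ Ψ z := by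
    intro z hz
    exact fderiv_comp z (differentiableAt_of_contDiffOn hV hf (h.mapsTo hz))
      (differentiableAt_of_contDiffOn hU h.contDiffOn hz)
  have h1 := (df2.comp y dΨ).clm_comp dΨ2
  have h2 := h1.congr_of_eventuallyEq (f₁ := fderiv ℝ (fun z => f (Ψ z))) (by
      filter_upwards [hU.mem_nhds hy] with z hz
      exact h0 z hz)
  rw [hessian_apply, hessian_apply, h2.fderiv, h0 y hy, ContinuousLinearMap.comp_apply,
    h.map_christoffel hy]
  simp

theorem gradSq_eq {f : E → ℝ} (hf : ContDiffOn ℝ ∞ f V) (hy : y ∈ U) :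
    gradSq G' (fun z => f (Ψ z)) y = gradSq G f (Ψ y) := by
  have hy' := h.mapsTo hy
  have h0 : fderiv ℝ (fun z => f (Ψ z)) y = fderiv ℝ f (Ψ y) ∘L fderiv ℝ Ψ y :=
    fderiv_comp y (differentiableAt_of_contDiffOn h.target.isOpen hf hy')
      (differentiableAt_of_contDiffOn h.source.isOpen h.contDiffOn hy)
  rw [gradSq, gradSq, ← map_inverse_pullback (h.target.invertible _ hy') (h.invertible y hy)
    (h.eq y hy) (α := fderiv ℝ f (Ψ y)) (β := fderiv ℝ (fun z => f (Ψ z)) y) (by simp [h0]), h0]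
  rfl

variable [FiniteDimensional ℝ E]

/-- `map_connectionCurvature` with `T = dΨ`; its intertwining hypothesis is then the transformation
law of the Christoffel symbols. -/
theorem map_riemann (hy : y ∈ U) (X Y Z : E) :
    fderiv ℝ Ψ y (riemann G' y X Y Z) =
      riemann G (Ψ y) (fderiv ℝ Ψ y X) (fderiv ℝ Ψ y Y) (fderiv ℝ Ψ y Z) :=
  map_connectionCurvature h.source.isOpen h.target.isOpen h.contDiffOn
    (contDiffOn_fderiv h.source.isOpen h.contDiffOn) h.target.contDiffOn_christoffel
    h.source.contDiffOn_christoffel h.mapsTo (fun _ hz X Y => h.map_christoffel hz X Y) hy X Y Z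

theorem ricci_eq (hy : y ∈ U) (Y Z : E) :
    ricci G' y Y Z = ricci G (Ψ y) (fderiv ℝ Ψ y Y) (fderiv ℝ Ψ y Z) :=
  trace_eq_of_intertwine (h.invertible y hy)
    (A := ((riemann G' y).flip Y).flip Z)
    (B := ((riemann G (Ψ y)).flip (fderiv ℝ Ψ y Y)).flip (fderiv ℝ Ψ y Z))
    fun X => h.map_riemann hy X Y Z

theorem metricTrace_eq (hy : y ∈ U) {P Q : E →L[ℝ] E →L[ℝ] ℝ}
    (hP : ∀ X Y, Q X Y = P (fderiv ℝ Ψ y X) (fderiv ℝ Ψ y Y)) :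
    metricTrace (G' y) Q = metricTrace (G (Ψ y)) P :=
  metricTrace_pullback (h.target.invertible _ (h.mapsTo hy)) (h.invertible y hy) (h.eq y hy) hP

end IsPullbackOn

end Naturality

/-! ### Commutation identities for metric, gradient and Hessian. -/

section Codazzi

variable {E : Type*} [NormedAddCommGroup E] [NormedSpace ℝ E]

namespace IsMetricOn

variable {G : E → E →L[ℝ] E →L[ℝ] ℝ} {U : Set E} (hG : IsMetricOn G U) {f : E → ℝ} {y : E}
include hG

theorem hessian_symm (hf : ContDiffOn ℝ ∞ f U) (hy : y ∈ U) (X Y : E) :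
    hessian G f y X Y = hessian G f y Y X := by
  rw [hessian_apply, hessian_apply, fderiv_fderiv_symm hG.isOpen hf hy, hG.christoffel_symm hy]

theorem apply_gradient (hy : y ∈ U) (X : E) :
    G y X ((G y).inverse (fderiv ℝ f y)) = fderiv ℝ f y X := by
  rw [hG.symm y hy, hG.apply_inverse hy]

/-- Since `∇G = 0`, the metric itself is a Codazzi tensor; this disposes of the summand `λ G` of
`P`. -/
theorem fderiv_codazzi (hy : y ∈ U) (X Y Z : E) :
    fderiv ℝ G y X Y Z - fderiv ℝ G y Y X Z + G y X (christoffel G y Y Z)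
      - G y Y (christoffel G y X Z) = 0 := by
  rw [hG.fderiv_eq hy, hG.fderiv_eq hy, hG.christoffel_symm hy Y X]
  ring

theorem fderiv_eq_zero_of_christoffel_eq_zero (hy : y ∈ U) (hΓ : christoffel G y = 0) :
    fderiv ℝ G y = 0 := by
  ext X Y Z
  simp [hG.fderiv_eq hy, hΓ]

variable [FiniteDimensional ℝ E]

theorem differentiableAt_christoffel (hy : y ∈ U) : DifferentiableAt ℝ (christoffel G) y :=
  differentiableAt_of_contDiffOn hG.isOpen hG.contDiffOn_christoffel hy

/-- The differential of `|∇f|²` is `2 ∇²f (·, ∇f)`. -/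
theorem fderiv_gradSq (hf : ContDiffOn ℝ ∞ f U) (hy : y ∈ U) (X : E) :
    fderiv ℝ (gradSq G f) y X = 2 * hessian G f y X ((G y).inverse (fderiv ℝ f y)) := by
  have hf1 := contDiffOn_fderiv hG.isOpen hf
  have df := (differentiableAt_of_contDiffOn hG.isOpen hf1 hy).hasFDerivAt
  have dG := (hG.differentiableAt hy).hasFDerivAt
  have dV := (differentiableAt_of_contDiffOn hG.isOpen (hG.contDiffOn_inverse.clm_apply hf1)
    hy).hasFDerivAt
  set V := fun z => (G z).inverse (fderiv ℝ f z) with hV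
  -- Differentiating `G(∇f, ·) = df` avoids any formula for the derivative of the inverse metric.
  have h1 := (dG.clm_apply dV).unique (df.congr_of_eventuallyEq (by
    filter_upwards [hG.isOpen.mem_nhds hy] with z hz
    exact hG.apply_inverse hz _))
  have h2 := congrArg (fun A : E →L[ℝ] E →L[ℝ] ℝ => A X (V y)) h1
  have h3 : fderiv ℝ (gradSq G f) y X = _ :=
    congrArg (fun A : E →L[ℝ] ℝ => A X) (df.clm_apply dV).fderiv
  simp only [add_apply, ContinuousLinearMap.comp_apply, ContinuousLinearMap.flip_apply] at h2 h3
  rw [h3, hessian_apply]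
  change _ = 2 * (fderiv ℝ (fderiv ℝ f) y X (V y) - fderiv ℝ f y (christoffel G y X (V y)))
  rw [hG.fderiv_eq hy, hG.symm y hy (V y), hG.apply_gradient hy, hG.apply_gradient hy] at h2
  linear_combination h2

/-- The commutation of covariant derivatives for `df`. -/
theorem fderiv_hessian_sub (hf : ContDiffOn ℝ ∞ f U) (hy : y ∈ U) (X Y Z : E) :
    fderiv ℝ (hessian G f) y X Y Z - fderiv ℝ (hessian G f) y Y X Z
      + hessian G f y X (christoffel G y Y Z) - hessian G f y Y (christoffel G y X Z) =
    - fderiv ℝ f y (riemann G y X Y Z) := by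
  have hf1 := contDiffOn_fderiv hG.isOpen hf
  have hf2 := contDiffOn_fderiv hG.isOpen hf1
  have df1 := (differentiableAt_of_contDiffOn hG.isOpen hf1 hy).hasFDerivAt
  have df2 := (differentiableAt_of_contDiffOn hG.isOpen hf2 hy).hasFDerivAt
  have dΓ := (hG.differentiableAt_christoffel hy).hasFDerivAt
  have dH := (differentiableAt_of_contDiffOn hG.isOpen (hG.contDiffOn_hessian hf) hy)
  have key (X Y Z : E) : fderiv ℝ (hessian G f) y X Y Z =
      fderiv ℝ (fderiv ℝ (fderiv ℝ f)) y X Y Z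
        - fderiv ℝ (fderiv ℝ f) y X (christoffel G y Y Z)
        - fderiv ℝ f y (fderiv ℝ (christoffel G) y X Y Z) := by
    have h1 := (hasFDerivAt_apply_const (hasFDerivAt_apply_const df2 Y) Z).sub
      (df1.clm_apply (hasFDerivAt_apply_const (hasFDerivAt_apply_const dΓ Y) Z))
    rw [← fderiv_apply_const₂ dH]
    have h2 : fderiv ℝ (fun z => hessian G f z Y Z) y X = _ :=
      congrArg (fun A : E →L[ℝ] ℝ => A X) h1.fderiv
    simp only [add_apply, sub_apply, ContinuousLinearMap.comp_apply,
      ContinuousLinearMap.flip_apply] at h2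
    linear_combination h2
  rw [key, key, hessian_apply, hessian_apply, riemann_apply,
    fderiv_fderiv_symm hG.isOpen hf1 hy Y X]
  simp only [map_add, map_sub]
  ring

/-- The curvature operators are skew-adjoint. -/
theorem riemann_skew (hy : y ∈ U) (X Y Z W : E) :
    G y (riemann G y X Y Z) W = - G y Z (riemann G y X Y W) := by
  have hG1 := contDiffOn_fderiv hG.isOpen hG.contDiffOn
  have dG := (hG.differentiableAt hy).hasFDerivAt
  have dG1 := (differentiableAt_of_contDiffOn hG.isOpen hG1 hy).hasFDerivAt
  have dΓ := (hG.differentiableAt_christoffel hy).hasFDerivAt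
  -- A second derivative of `∇G = 0`. The left side is symmetric in `X` and `Y`, so the
  -- antisymmetric part of the right side, which is the curvature term, vanishes.
  have key (X Y Z W : E) : fderiv ℝ (fderiv ℝ G) y X Y Z W =
      fderiv ℝ G y X (christoffel G y Y Z) W + G y (fderiv ℝ (christoffel G) y X Y Z) W
        + fderiv ℝ G y X Z (christoffel G y Y W) + G y Z (fderiv ℝ (christoffel G) y X Y W) := by
    have h0 := hasFDerivAt_apply_const (hasFDerivAt_apply_const
      (hasFDerivAt_apply_const dG1 Y) Z) W
    have h1 := (hasFDerivAt_apply_const (dG.clm_apply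
        (hasFDerivAt_apply_const (hasFDerivAt_apply_const dΓ Y) Z)) W).add
      ((hasFDerivAt_apply_const dG Z).clm_apply
        (hasFDerivAt_apply_const (hasFDerivAt_apply_const dΓ Y) W))
    have h2 := h0.unique (h1.congr_of_eventuallyEq (by
      filter_upwards [hG.isOpen.mem_nhds hy] with z hz
      exact hG.fderiv_eq hz Y Z W))
    have h3 := congrArg (fun A : E →L[ℝ] ℝ => A X) h2
    simp only [add_apply, ContinuousLinearMap.comp_apply, ContinuousLinearMap.flip_apply] at h3
    linear_combination h3
  have k1 := key X Y Z W
  have k2 := key Y X Z W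
  rw [fderiv_fderiv_symm hG.isOpen hG.contDiffOn hy Y X] at k2
  simp only [hG.fderiv_eq hy] at k1 k2
  simp only [riemann_apply, map_add, map_sub, add_apply, sub_apply]
  linear_combination k2 - k1

end IsMetricOn

theorem riemann_antisymm (G : E → E →L[ℝ] E →L[ℝ] ℝ) (y X Y Z : E) :
    riemann G y X Y Z = - riemann G y Y X Z := by
  simp only [riemann_apply]; module

end Codazzi

/-! ### Normal coordinates and the contracted second Bianchi identity. -/

section Bianchi

variable {E : Type*} [NormedAddCommGroup E] [NormedSpace ℝ E] [FiniteDimensional ℝ E]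

theorem traceL_eq_sum {ι : Type*} [Fintype ι] (b : Module.Basis ι ℝ E) (A : E →L[ℝ] E) :
    traceL E A = ∑ i, b.coord i (A (b i)) := by
  classical
  change LinearMap.trace ℝ E (A : E →ₗ[ℝ] E) = _
  rw [LinearMap.trace_eq_matrix_trace ℝ b, Matrix.trace]
  simp [LinearMap.toMatrix_apply]

/-- Only `Γ(y) = 0` is wanted, so a quadratic change of coordinates suffices, with no exponential
map. Since `dΨ(y)` is the identity, tensors at `y` keep their components. -/
theorem IsMetricOn.exists_normal_coordinates {G : E → E →L[ℝ] E →L[ℝ] ℝ} {V : Set E}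
    (hG : IsMetricOn G V) {y : E} (hy : y ∈ V) :
    ∃ (G' : E → E →L[ℝ] E →L[ℝ] ℝ) (Ψ : E → E) (U : Set E), IsPullbackOn G' G Ψ U V ∧ y ∈ U ∧
      Ψ y = y ∧ fderiv ℝ Ψ y = ContinuousLinearMap.id ℝ E ∧ christoffel G' y = 0 := by
  have : CompleteSpace E := FiniteDimensional.complete ℝ E
  set Γ := christoffel G y with hΓ
  -- The second derivative of this map at `y` is `-Γ`, which cancels the inhomogeneous term in the
  -- transformation law of the Christoffel symbols.
  set Ψ : E → E := fun z => z - (1 / 2 : ℝ) • Γ (z - y) (z - y) with hΨ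
  have hsmooth : ContDiff ℝ ∞ Ψ := by
    have h1 : ContDiff ℝ ∞ (fun z : E => z - y) := contDiff_id.sub contDiff_const
    exact contDiff_id.sub (contDiff_const.smul ((Γ.contDiff.comp h1).clm_apply h1))
  have hder (z : E) : HasFDerivAt Ψ (ContinuousLinearMap.id ℝ E - Γ (z - y)) z := by
    have h1 : HasFDerivAt (fun z : E => z - y) (ContinuousLinearMap.id ℝ E) z :=
      (hasFDerivAt_id z).sub_const y
    have h2 := (hasFDerivAt_id z).sub
      (((Γ.hasFDerivAt.comp z h1).clm_apply h1).const_smul (1 / 2 : ℝ))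
    refine h2.congr_fderiv ?_
    ext X
    change X - (1 / 2 : ℝ) • (Γ (z - y) X + Γ X (z - y)) = X - Γ (z - y) X
    rw [hΓ, hG.christoffel_symm hy X (z - y)]
    module
  have hfd : fderiv ℝ Ψ = fun z => ContinuousLinearMap.id ℝ E - Γ (z - y) :=
    funext fun z => (hder z).fderiv
  have hfd2 : fderiv ℝ (fderiv ℝ Ψ) y = - Γ := by
    have h1 : HasFDerivAt (fun z : E => z - y) (ContinuousLinearMap.id ℝ E) y :=
      (hasFDerivAt_id y).sub_const y
    have h2 := (Γ.hasFDerivAt.comp y h1).const_sub (ContinuousLinearMap.id ℝ E)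
    rw [hfd]
    exact h2.fderiv
  have hyy : Ψ y = y := by simp [hΨ]
  have hid : fderiv ℝ Ψ y = ContinuousLinearMap.id ℝ E := by simp [hfd]
  have hopen : IsOpen {z | (fderiv ℝ Ψ z).IsInvertible} :=
    (ContinuousLinearEquiv.isOpen (𝕜 := ℝ) (E := E) (F := E)).preimage
      (hsmooth.continuous_fderiv (by simp))
  set U := Ψ ⁻¹' V ∩ {z | (fderiv ℝ Ψ z).IsInvertible} with hU
  have hpull := hG.isPullbackOn (Ψ := Ψ) (U := U)
    (G' := fun z => (G (Ψ z)).bilinearComp (fderiv ℝ Ψ z) (fderiv ℝ Ψ z))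
    ((hG.isOpen.preimage hsmooth.continuous).inter hopen) hsmooth.contDiffOn
    (fun z hz => hz.1) (fun z hz => hz.2) (fun z hz X Y => rfl)
  have hyU : y ∈ U := by
    refine ⟨by simpa [hyy] using hy, ?_⟩
    change (fderiv ℝ Ψ y).IsInvertible
    rw [hid]
    exact ⟨ContinuousLinearEquiv.refl ℝ E, rfl⟩
  refine ⟨_, Ψ, U, hpull, hyU, hyy, hid, ?_⟩
  ext X Y
  have := hpull.map_christoffel hyU X Y
  rw [hfd2, hid, hyy] at this
  simpa [hΓ] using this

namespace IsMetricOn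

variable {G : E → E →L[ℝ] E →L[ℝ] ℝ} {U : Set E} (hG : IsMetricOn G U) {f : E → ℝ} {y : E}
include hG

/-- The raised dual basis is `G`-dual to `b`, so traces become sums over pairs of vectors in any
signature, without an orthonormal basis. -/
theorem metricTrace_eq_sum (hy : y ∈ U) {ι : Type*} [Fintype ι] (b : Module.Basis ι ℝ E)
    (B : E →L[ℝ] E →L[ℝ] ℝ) :
    metricTrace (G y) B =
      ∑ i, B (b i) ((G y).inverse (LinearMap.toContinuousLinearMap (b.coord i))) := by
  rw [metricTrace, traceL_eq_sum b]
  refine Finset.sum_congr rfl fun i _ => ?_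
  have h1 : b.coord i ((G y).inverse (B (b i))) =
      G y ((G y).inverse (LinearMap.toContinuousLinearMap (b.coord i)))
        ((G y).inverse (B (b i))) := by
    rw [hG.apply_inverse hy]; rfl
  rw [ContinuousLinearMap.comp_apply, h1, hG.symm y hy, hG.apply_inverse hy]

theorem trace_eq_sum (hy : y ∈ U) {ι : Type*} [Fintype ι] (b : Module.Basis ι ℝ E)
    (A : E →L[ℝ] E) :
    traceL E A =
      ∑ i, G y ((G y).inverse (LinearMap.toContinuousLinearMap (b.coord i))) (A (b i)) := by
  rw [traceL_eq_sum b]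
  refine Finset.sum_congr rfl fun i _ => ?_
  rw [hG.apply_inverse hy]; rfl

theorem differentiableAt_riemann (hy : y ∈ U) : DifferentiableAt ℝ (riemann G) y :=
  differentiableAt_of_contDiffOn hG.isOpen hG.contDiffOn_riemann hy

theorem differentiableAt_ricci (hy : y ∈ U) : DifferentiableAt ℝ (ricci G) y :=
  differentiableAt_of_contDiffOn hG.isOpen hG.contDiffOn_ricci hy

theorem fderiv_riemann_apply (hy : y ∈ U) (W X Y Z : E) :
    fderiv ℝ (fun z => riemann G z X Y Z) y W = fderiv ℝ (riemann G) y W X Y Z := by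
  have hR := hG.differentiableAt_riemann hy
  rw [fderiv_apply_const₂ (c := fun z => riemann G z X)
    (hR.clm_apply (differentiableAt_const X)) Y Z W, fderiv_apply_const hR]

theorem fderiv_riemann_antisymm (hy : y ∈ U) (W X Y Z : E) :
    fderiv ℝ (riemann G) y W X Y Z = - fderiv ℝ (riemann G) y W Y X Z := by
  rw [← hG.fderiv_riemann_apply hy, ← hG.fderiv_riemann_apply hy]
  simp_rw [fun z => riemann_antisymm G z X Y Z]
  rw [fderiv_fun_neg]; rfl

theorem fderiv_ricci (hy : y ∈ U) (W Y Z : E) :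
    fderiv ℝ (ricci G) y W Y Z = traceL E (((fderiv ℝ (riemann G) y W).flip Y).flip Z) := by
  rw [← fderiv_apply_const₂ (hG.differentiableAt_ricci hy)]
  have hR := (hG.differentiableAt_riemann hy).hasFDerivAt
  -- For fixed `Y` and `Z` the Ricci tensor is a constant linear function `L` of the curvature, so
  -- it commutes with differentiation.
  let L : (E →L[ℝ] E →L[ℝ] E →L[ℝ] E) →L[ℝ] ℝ :=
    traceL E ∘L ContinuousLinearMap.apply ℝ (E →L[ℝ] E) Z ∘L
      (ContinuousLinearMap.flipₗᵢ ℝ E E E).toContinuousLinearEquiv.toContinuousLinearMap ∘L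
      ContinuousLinearMap.apply ℝ (E →L[ℝ] E →L[ℝ] E) Y ∘L
      (ContinuousLinearMap.flipₗᵢ ℝ E E (E →L[ℝ] E)).toContinuousLinearEquiv.toContinuousLinearMap
  have h1 : (fun z => ricci G z Y Z) = fun z => L (riemann G z) := rfl
  have h2 : fderiv ℝ (fun z => L (riemann G z)) y = L ∘L fderiv ℝ (riemann G) y :=
    (L.hasFDerivAt.comp y hR).fderiv
  rw [h1, h2]
  rfl

section NormalCoordinates

variable (hy : y ∈ U) (hΓ : christoffel G y = 0)
include hy hΓ

/-- Differentiate `G (G⁻¹ α) = α`, using `DG = 0` at the centre of normal coordinates. -/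
theorem fderiv_inverse_eq_zero : fderiv ℝ (fun z => (G z).inverse) y = 0 := by
  have dG := (hG.differentiableAt hy).hasFDerivAt
  have dI := (differentiableAt_of_contDiffOn hG.isOpen hG.contDiffOn_inverse hy).hasFDerivAt
  ext X α
  have h1 := (dG.clm_apply (hasFDerivAt_apply_const dI α)).unique
    ((hasFDerivAt_const α y).congr_of_eventuallyEq (by
      filter_upwards [hG.isOpen.mem_nhds hy] with z hz
      exact hG.apply_inverse hz α))
  have h2 := congrArg (fun A : E →L[ℝ] E →L[ℝ] ℝ => A X) h1
  simp only [add_apply, ContinuousLinearMap.comp_apply, ContinuousLinearMap.flip_apply,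
    hG.fderiv_eq_zero_of_christoffel_eq_zero hy hΓ, zero_apply, add_zero] at h2
  exact (hG.invertible y hy).injective (by simpa using h2)

theorem fderiv_scalar (X : E) :
    fderiv ℝ (fun z => metricTrace (G z) (ricci G z)) y X =
      metricTrace (G y) (fderiv ℝ (ricci G) y X) := by
  have dI := (differentiableAt_of_contDiffOn hG.isOpen hG.contDiffOn_inverse hy).hasFDerivAt
  have dR := (hG.differentiableAt_ricci hy).hasFDerivAt
  have h1 := (traceL E).hasFDerivAt.comp y (dI.clm_comp dR)
  have h2 : fderiv ℝ (fun z => metricTrace (G z) (ricci G z)) y = _ := h1.fderiv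
  rw [h2, hG.fderiv_inverse_eq_zero hy hΓ]
  simp [metricTrace]

theorem fderiv_riemann_skew (W X Y Z V : E) :
    G y (fderiv ℝ (riemann G) y W X Y Z) V = - G y Z (fderiv ℝ (riemann G) y W X Y V) := by
  have dG := (hG.differentiableAt hy).hasFDerivAt
  have dR (Z : E) := hasFDerivAt_apply_const (hasFDerivAt_apply_const
    (hasFDerivAt_apply_const (hG.differentiableAt_riemann hy).hasFDerivAt X) Y) Z
  have h1 := hasFDerivAt_apply_const (dG.clm_apply (dR Z)) V
  have h2 := ((hasFDerivAt_apply_const dG Z).clm_apply (dR V)).neg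
  have h3 := h1.unique (h2.congr_of_eventuallyEq (by
    filter_upwards [hG.isOpen.mem_nhds hy] with z hz
    exact hG.riemann_skew hz X Y Z V))
  have h4 := congrArg (fun A : E →L[ℝ] ℝ => A W) h3
  simpa [hG.fderiv_eq_zero_of_christoffel_eq_zero hy hΓ] using h4

/-- The second Bianchi identity at the centre of normal coordinates. -/
theorem second_bianchi (W X Y Z : E) :
    fderiv ℝ (riemann G) y W X Y Z + fderiv ℝ (riemann G) y X Y W Z
      + fderiv ℝ (riemann G) y Y W X Z = 0 := by
  have hΓ1 := contDiffOn_fderiv hG.isOpen hG.contDiffOn_christoffel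
  have d1 := (hG.differentiableAt_christoffel hy).hasFDerivAt
  have d2 := (differentiableAt_of_contDiffOn hG.isOpen hΓ1 hy).hasFDerivAt
  -- The quadratic terms in `Γ` have zero derivative where `Γ = 0`. Only second derivatives of `Γ`
  -- remain, and their symmetry makes the cyclic sum cancel.
  have key (W X Y Z : E) : fderiv ℝ (riemann G) y W X Y Z =
      fderiv ℝ (fderiv ℝ (christoffel G)) y W X Y Z
        - fderiv ℝ (fderiv ℝ (christoffel G)) y W Y X Z := by
    have a (X Y : E) := hasFDerivAt_apply_const (hasFDerivAt_apply_const
      (hasFDerivAt_apply_const d2 X) Y) Z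
    have c (X Y : E) := (hasFDerivAt_apply_const d1 X).clm_apply
      (hasFDerivAt_apply_const (hasFDerivAt_apply_const d1 Y) Z)
    have h1 := (((a X Y).sub (a Y X)).add (c X Y)).sub (c Y X)
    rw [← hG.fderiv_riemann_apply hy]
    have h2 : fderiv ℝ (fun z => riemann G z X Y Z) y W = _ :=
      congrArg (fun A : E →L[ℝ] E => A W) h1.fderiv
    rw [h2]
    simp [hΓ]
  have s := fderiv_fderiv_symm hG.isOpen hG.contDiffOn_christoffel hy
  rw [key, key, key, s X W, s Y X, s Y W]
  module

/-- The contracted second Bianchi identity at the centre of normal coordinates. -/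
theorem contracted_bianchi {ι : Type*} [Fintype ι] (b : Module.Basis ι ℝ E) (Y : E) :
    2 * ∑ i, fderiv ℝ (ricci G) y (b i) Y
        ((G y).inverse (LinearMap.toContinuousLinearMap (b.coord i))) =
      metricTrace (G y) (fderiv ℝ (ricci G) y Y) := by
  set d := fun i => (G y).inverse (LinearMap.toContinuousLinearMap (b.coord i)) with hd
  set Q := fderiv ℝ (riemann G) y with hQ
  have hric (W Y Z : E) : fderiv ℝ (ricci G) y W Y Z = ∑ i, G y (d i) (Q W (b i) Y Z) := by
    rw [hG.fderiv_ricci hy, hG.trace_eq_sum hy b]; rfl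
  -- The cyclic identity traced twice. By the skew symmetries `h2` the second sum repeats the first,
  -- giving twice the divergence of Ricci; by `h3` the third is minus the derivative of the scalar
  -- curvature.
  have h1 : ∑ j, ∑ i, (G y (d i) (Q (b j) (b i) Y (d j)) + G y (d i) (Q (b i) Y (b j) (d j))
      + G y (d i) (Q Y (b j) (b i) (d j))) = 0 := by
    refine Finset.sum_eq_zero fun j _ => Finset.sum_eq_zero fun i _ => ?_
    rw [← map_add, ← map_add, hG.second_bianchi hy hΓ, map_zero]
  have h2 (i j : ι) : G y (d i) (Q (b i) Y (b j) (d j)) = G y (d j) (Q (b i) (b j) Y (d i)) := by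
    have e1 := hG.fderiv_riemann_skew hy hΓ (b i) Y (b j) (d i) (d j)
    rw [hG.fderiv_riemann_antisymm hy (b i) (b j) Y, map_neg, hG.symm y hy (d j)]
    linear_combination e1
  have h3 (i j : ι) : G y (d i) (Q Y (b j) (b i) (d j)) = - G y (d i) (Q Y (b i) (b j) (d j)) := by
    rw [hG.fderiv_riemann_antisymm hy Y (b j) (b i), map_neg]
  simp only [h2, h3, Finset.sum_add_distrib, Finset.sum_neg_distrib, ← hric] at h1
  rw [Finset.sum_comm] at h1
  simp only [← hric] at h1
  rw [hG.metricTrace_eq_sum hy b]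
  linear_combination h1

end NormalCoordinates

end IsMetricOn

end Bianchi

/-! ### What the hypothesis gives: `P` is Codazzi and `dY = -df ∘ A`. -/

section SolitonOrFlat

variable {E : Type*} [NormedAddCommGroup E] [NormedSpace ℝ E] [FiniteDimensional ℝ E]

/-- The tensor `P_f = Ric + ∇²f - λ G` in coordinates. -/
def localP (G : E → E →L[ℝ] E →L[ℝ] ℝ) (f : E → ℝ) (lam : ℝ) (y : E) : E →L[ℝ] E →L[ℝ] ℝ :=
  ricci G y + hessian G f y - lam • G y

/-- The function `Y_f` in coordinates. -/
def localY (G : E → E →L[ℝ] E →L[ℝ] ℝ) (f : E → ℝ) (lam : ℝ) (y : E) : ℝ :=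
  -(1 / 2) * (metricTrace (G y) (ricci G y) + gradSq G f y - 2 * lam * f y)

/-- The endomorphism `P_i^j` in coordinates. -/
def localA (G : E → E →L[ℝ] E →L[ℝ] ℝ) (f : E → ℝ) (lam : ℝ) (y : E) : E →L[ℝ] E :=
  (G y).inverse ∘L localP G f lam y

theorem ricci_eq_zero {G : E → E →L[ℝ] E →L[ℝ] ℝ} {y : E} (h : riemann G y = 0) :
    ricci G y = 0 := by
  ext Y Z
  have : ((riemann G y).flip Y).flip Z = 0 := by rw [h]; rfl
  rw [ricci_apply, this]
  simp

theorem ricci_congr {G G' : E → E →L[ℝ] E →L[ℝ] ℝ} {y : E} (h : G =ᶠ[𝓝 y] G') :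
    ricci G y = ricci G' y := by
  ext Y Z
  rw [ricci_apply, ricci_apply, riemann_congr h]

theorem metricTrace_zero (G : E →L[ℝ] E →L[ℝ] ℝ) : metricTrace G 0 = 0 := by
  simp [metricTrace]

namespace IsPullbackOn

variable {G' G : E → E →L[ℝ] E →L[ℝ] ℝ} {Ψ : E → E} {U V : Set E}
  (h : IsPullbackOn G' G Ψ U V) {f : E → ℝ} (hf : ContDiffOn ℝ ∞ f V) {y : E} (hy : y ∈ U)
include h hf hy

theorem localP_eq (lam : ℝ) (X Y : E) :
    localP G' (fun z => f (Ψ z)) lam y X Y =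
      localP G f lam (Ψ y) (fderiv ℝ Ψ y X) (fderiv ℝ Ψ y Y) := by
  simp only [localP, add_apply, sub_apply, smul_apply, h.ricci_eq hy,
    h.hessian_eq hf hy, h.eq y hy]

theorem localY_eq (lam : ℝ) : localY G' (fun z => f (Ψ z)) lam y = localY G f lam (Ψ y) := by
  rw [localY, localY, h.gradSq_eq hf hy, h.metricTrace_eq hy (h.ricci_eq hy)]

end IsPullbackOn

namespace IsMetricOn

variable {G : E → E →L[ℝ] E →L[ℝ] ℝ} {U : Set E} (hG : IsMetricOn G U) {f : E → ℝ}
  (hf : ContDiffOn ℝ ∞ f U) (lam : ℝ) {y : E}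
include hG hf

theorem contDiffOn_localP : ContDiffOn ℝ ∞ (localP G f lam) U :=
  (hG.contDiffOn_ricci.add (hG.contDiffOn_hessian hf)).sub (hG.contDiffOn.const_smul lam)

theorem contDiffOn_localY : ContDiffOn ℝ ∞ (localY G f lam) U :=
  contDiffOn_const.mul (((hG.contDiffOn_metricTrace hG.contDiffOn_ricci).add
    (hG.contDiffOn_gradSq hf)).sub (contDiffOn_const.mul hf))

theorem contDiffOn_localA : ContDiffOn ℝ ∞ (localA G f lam) U :=
  hG.contDiffOn_inverse.clm_comp (hG.contDiffOn_localP hf lam)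

theorem fderiv_localY (hy : y ∈ U) (X : E) :
    fderiv ℝ (localY G f lam) y X =
      -(1 / 2) * (fderiv ℝ (fun z => metricTrace (G z) (ricci G z)) y X
        + 2 * hessian G f y X ((G y).inverse (fderiv ℝ f y)) - 2 * lam * fderiv ℝ f y X) := by
  have d1 := (differentiableAt_of_contDiffOn hG.isOpen
    (hG.contDiffOn_metricTrace hG.contDiffOn_ricci) hy).hasFDerivAt
  have d2 := (differentiableAt_of_contDiffOn hG.isOpen (hG.contDiffOn_gradSq hf) hy).hasFDerivAt
  have d3 := (differentiableAt_of_contDiffOn hG.isOpen hf hy).hasFDerivAt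
  have h : HasFDerivAt (localY G f lam) _ y :=
    ((d1.add d2).sub (d3.const_mul (2 * lam))).const_mul (-(1 / 2))
  rw [h.fderiv, ← hG.fderiv_gradSq hf hy]
  simp

omit hf in
theorem apply_localA (hy : y ∈ U) (X Y : E) : G y (localA G f lam y X) Y = localP G f lam y X Y := by
  rw [localA, ContinuousLinearMap.comp_apply, hG.apply_inverse hy]

/-- On a gradient Ricci soliton `R + |∇f|² - 2 λ f` is locally constant: the case of coordinates
that are normal at `y`. -/
theorem fderiv_localY_eq_zero_of_normal (hP : ∀ z ∈ U, localP G f lam z = 0) (hy : y ∈ U)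
    (hΓ : christoffel G y = 0) : fderiv ℝ (localY G f lam) y = 0 := by
  ext Y
  set V := (G y).inverse (fderiv ℝ f y) with hV
  let b := Module.finBasis ℝ E
  have hric : ∀ z ∈ U, ricci G z = lam • G z - hessian G f z := by
    intro z hz
    ext X Y
    have h0 := congrArg (fun B : E →L[ℝ] E →L[ℝ] ℝ => B X Y) (hP z hz)
    simp only [localP, add_apply, sub_apply, zero_apply] at h0 ⊢
    linear_combination h0
  have hDric (W Y Z : E) : fderiv ℝ (ricci G) y W Y Z = - fderiv ℝ (hessian G f) y W Y Z := by
    have d1 := (hG.differentiableAt hy).hasFDerivAt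
    have d2 := (differentiableAt_of_contDiffOn hG.isOpen (hG.contDiffOn_hessian hf) hy).hasFDerivAt
    have h1 := ((d1.const_smul lam).sub d2).congr_of_eventuallyEq (f₁ := ricci G) (by
      filter_upwards [hG.isOpen.mem_nhds hy] with z hz using hric z hz)
    rw [h1.fderiv, hG.fderiv_eq_zero_of_christoffel_eq_zero hy hΓ]
    change lam * 0 - fderiv ℝ (hessian G f) y W Y Z = _
    ring
  -- With `Ric = λ G - ∇²f` and `DG = 0` at `y`, the Codazzi defect of Ricci is that of `-∇²f`,
  -- which is a curvature term.
  have hcomm (W Y Z : E) : fderiv ℝ (ricci G) y W Y Z - fderiv ℝ (ricci G) y Y W Z =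
      fderiv ℝ f y (riemann G y W Y Z) := by
    have := hG.fderiv_hessian_sub hf hy W Y Z
    simp only [hΓ, zero_apply, map_zero] at this
    rw [hDric, hDric]
    linear_combination -this
  -- Contracting that curvature term with skewness gives `-Ric(Y, ∇f)`. With the contracted Bianchi
  -- identity this becomes `dR = 2 Ric(∇f, ·)`.
  have hsum : ∑ i, fderiv ℝ f y (riemann G y (b i) Y
      ((G y).inverse (LinearMap.toContinuousLinearMap (b.coord i)))) = - ricci G y Y V := by
    have h1 : ricci G y Y V = traceL E (((riemann G y).flip Y).flip V) := ricci_apply G y Y V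
    rw [h1, hG.trace_eq_sum hy b, ← Finset.sum_neg_distrib]
    refine Finset.sum_congr rfl fun i _ => ?_
    rw [← hG.apply_gradient hy, hG.riemann_skew hy]
    rfl
  have hB := hG.contracted_bianchi hy hΓ b Y
  have hS := hG.metricTrace_eq_sum hy b (fderiv ℝ (ricci G) y Y)
  simp only [← hcomm, Finset.sum_sub_distrib, ← hS] at hsum
  rw [hG.fderiv_localY hf lam hy, hG.fderiv_scalar hy hΓ, ← hV]
  have h2 : ricci G y Y V = lam * fderiv ℝ f y Y - hessian G f y Y V := by
    rw [hric y hy, ← hG.apply_gradient hy]; rfl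
  simp only [zero_apply]
  linear_combination hsum - 1 / 2 * hB - h2

/-- On a gradient Ricci soliton `R + |∇f|² - 2 λ f` is locally constant. -/
theorem fderiv_localY_eq_zero (hP : ∀ z ∈ U, localP G f lam z = 0) (hy : y ∈ U) :
    fderiv ℝ (localY G f lam) y = 0 := by
  obtain ⟨G', Ψ, U', h, hyU, hΨy, hid, hΓ⟩ := hG.exists_normal_coordinates hy
  have hf' : ContDiffOn ℝ ∞ (fun z => f (Ψ z)) U' := hf.comp h.contDiffOn h.mapsTo
  have h1 : fderiv ℝ (localY G' (fun z => f (Ψ z)) lam) y = 0 := by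
    refine h.source.fderiv_localY_eq_zero_of_normal hf' lam (fun z hz => ?_) hyU hΓ
    ext X Y
    rw [h.localP_eq hf hz, hP _ (h.mapsTo hz)]
    rfl
  have h2 : localY G' (fun z => f (Ψ z)) lam =ᶠ[𝓝 y] fun z => localY G f lam (Ψ z) := by
    filter_upwards [h.source.isOpen.mem_nhds hyU] with z hz using h.localY_eq hf hz lam
  have d1 : DifferentiableAt ℝ (localY G f lam) (Ψ y) :=
    differentiableAt_of_contDiffOn hG.isOpen (hG.contDiffOn_localY hf lam) (h.mapsTo hyU)
  have d2 : DifferentiableAt ℝ Ψ y :=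
    differentiableAt_of_contDiffOn h.source.isOpen h.contDiffOn hyU
  have h3 : fderiv ℝ (fun z => localY G f lam (Ψ z)) y = _ :=
    fderiv_comp (g := localY G f lam) (f := Ψ) y d1 d2
  rw [h2.fderiv_eq, h3, hid, hΨy, ContinuousLinearMap.comp_id] at h1
  exact h1

end IsMetricOn

/-- `(U, G, f, λ)` is a gradient Ricci soliton, or `G` is flat on `U`. -/
structure IsSolitonOrFlatOn (G : E → E →L[ℝ] E →L[ℝ] ℝ) (f : E → ℝ) (lam : ℝ) (U : Set E) :
    Prop where
  metric : IsMetricOn G U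
  contDiffOn : ContDiffOn ℝ ∞ f U
  soliton_or_flat : (∀ y ∈ U, localP G f lam y = 0) ∨ (∀ y ∈ U, riemann G y = 0)

namespace IsSolitonOrFlatOn

variable {G : E → E →L[ℝ] E →L[ℝ] ℝ} {U : Set E} {f : E → ℝ} {lam : ℝ}
  (h : IsSolitonOrFlatOn G f lam U) {y : E} (hy : y ∈ U)
include h hy

theorem localP_symm (X Y : E) : localP G f lam y X Y = localP G f lam y Y X := by
  rcases h.soliton_or_flat with h1 | h1
  · simp [h1 y hy]
  · simp only [localP, ricci_eq_zero (h1 y hy), add_apply, sub_apply, smul_apply, zero_apply,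
      h.metric.hessian_symm h.contDiffOn hy X Y, h.metric.symm y hy X Y]

/-- `P` is a Codazzi tensor. -/
theorem localP_codazzi (X Y Z : E) :
    fderiv ℝ (localP G f lam) y X Y Z - fderiv ℝ (localP G f lam) y Y X Z
      + localP G f lam y X (christoffel G y Y Z) - localP G f lam y Y (christoffel G y X Z) = 0 := by
  have hU := h.metric.isOpen.mem_nhds hy
  rcases h.soliton_or_flat with h1 | h1
  · have h2 : localP G f lam =ᶠ[𝓝 y] fun _ => 0 := by
      filter_upwards [hU] with z hz using h1 z hz
    rw [h2.fderiv_eq, h1 y hy]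
    simp
  -- Flat case: near `y` the tensor is `∇²f - λ G`; the Codazzi defect of the Hessian is a curvature
  -- term, hence zero, and `G` has none.
  · have h2 : localP G f lam =ᶠ[𝓝 y] fun z => hessian G f z - lam • G z := by
      filter_upwards [hU] with z hz
      rw [localP, ricci_eq_zero (h1 z hz), zero_add]
    have d1 := (h.metric.differentiableAt hy).hasFDerivAt
    have d2 := (differentiableAt_of_contDiffOn h.metric.isOpen
      (h.metric.contDiffOn_hessian h.contDiffOn) hy).hasFDerivAt
    have h3 : fderiv ℝ (fun z => hessian G f z - lam • G z) y = _ :=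
      (d2.sub (d1.const_smul lam)).fderiv
    rw [h2.fderiv_eq, h3, h2.eq_of_nhds]
    have k1 := h.metric.fderiv_codazzi hy X Y Z
    have k2 := h.metric.fderiv_hessian_sub h.contDiffOn hy X Y Z
    rw [h1 y hy] at k2
    simp only [sub_apply, smul_apply, smul_eq_mul, zero_apply, map_zero] at k2 ⊢
    linear_combination k2 - lam * k1

/-- Raising an index preserves the Codazzi equation because `G` is parallel. In this form it is the
vanishing of the ambient torsion. -/
theorem localA_codazzi (X Y : E) :
    fderiv ℝ (localA G f lam) y X Y + christoffel G y X (localA G f lam y Y) =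
      fderiv ℝ (localA G f lam) y Y X + christoffel G y Y (localA G f lam y X) := by
  have hU := h.metric.isOpen
  refine h.metric.eq_of_forall hy fun Z => ?_
  have dG := (h.metric.differentiableAt hy).hasFDerivAt
  have dA := (differentiableAt_of_contDiffOn hU
    (h.metric.contDiffOn_localA h.contDiffOn lam) hy).hasFDerivAt
  have dP := (differentiableAt_of_contDiffOn hU
    (h.metric.contDiffOn_localP h.contDiffOn lam) hy).hasFDerivAt
  have key (X Y : E) : fderiv ℝ G y X (localA G f lam y Y) Z
      + G y (fderiv ℝ (localA G f lam) y X Y) Z = fderiv ℝ (localP G f lam) y X Y Z := by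
    have h1 := hasFDerivAt_apply_const (dG.clm_apply (hasFDerivAt_apply_const dA Y)) Z
    have h2 := h1.unique ((hasFDerivAt_apply_const
      (hasFDerivAt_apply_const dP Y) Z).congr_of_eventuallyEq (by
        filter_upwards [hU.mem_nhds hy] with z hz
        exact h.metric.apply_localA lam hz Y Z))
    have h3 := congrArg (fun A : E →L[ℝ] ℝ => A X) h2
    simp only [add_apply, ContinuousLinearMap.comp_apply, ContinuousLinearMap.flip_apply] at h3
    linear_combination h3
  have k1 := key X Y
  have k2 := key Y X
  have k3 := h.localP_codazzi hy X Y Z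
  rw [h.metric.fderiv_eq hy, h.metric.apply_localA lam hy] at k1 k2
  simp only [map_add, add_apply]
  linear_combination k1 - k2 + k3

/-- The right side is `-P(X, ∇f)`. For a soliton both sides vanish; in the flat case `R = 0` near
`y` and the derivative of `|∇f|²` gives the Hessian part of `P`. This identity is what makes `φ - u
Y` the right potential. -/
theorem fderiv_localY (X : E) :
    fderiv ℝ (localY G f lam) y X = - fderiv ℝ f y (localA G f lam y X) := by
  rw [← h.metric.apply_gradient hy (f := f), h.metric.apply_localA lam hy]
  rcases h.soliton_or_flat with h1 | h1
  · rw [h.metric.fderiv_localY_eq_zero h.contDiffOn lam h1 hy, h1 y hy]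
    simp
  · have h2 : (fun z => metricTrace (G z) (ricci G z)) =ᶠ[𝓝 y] fun _ => 0 := by
      filter_upwards [h.metric.isOpen.mem_nhds hy] with z hz
      rw [ricci_eq_zero (h1 z hz), metricTrace_zero]
    rw [h.metric.fderiv_localY h.contDiffOn lam hy, h2.fderiv_eq, localP, ricci_eq_zero (h1 y hy)]
    simp only [add_apply, sub_apply, smul_apply, smul_eq_mul, zero_apply,
      h.metric.apply_gradient hy, fderiv_fun_const, Pi.zero_apply]
    ring

/-- Both sides equal `G(A X, A Y)`. -/
theorem localP_localA_symm (X Y : E) :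
    localP G f lam y X (localA G f lam y Y) = localP G f lam y Y (localA G f lam y X) := by
  rw [← h.metric.apply_localA lam hy, ← h.metric.apply_localA lam hy, h.metric.symm y hy]

end IsSolitonOrFlatOn

end SolitonOrFlat

/-! ### The ambient metric as the pullback of `2 du dv + G` by the frame change `1 + uA`. -/

section AmbientCoordinates

variable {E : Type*} [NormedAddCommGroup E] [NormedSpace ℝ E]

/-- The differential of `x` on `ℝ × E × ℝ`. -/
abbrev dxL (E : Type*) [NormedAddCommGroup E] [NormedSpace ℝ E] : ℝ × E × ℝ →L[ℝ] E :=
  ContinuousLinearMap.fst ℝ E ℝ ∘L ContinuousLinearMap.snd ℝ ℝ (E × ℝ)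

/-- The differential of `v` on `ℝ × E × ℝ`. -/
abbrev dvL (E : Type*) [NormedAddCommGroup E] [NormedSpace ℝ E] : ℝ × E × ℝ →L[ℝ] ℝ :=
  ContinuousLinearMap.fst ℝ ℝ (E × ℝ)

/-- The differential of `u` on `ℝ × E × ℝ`. -/
abbrev duL (E : Type*) [NormedAddCommGroup E] [NormedSpace ℝ E] : ℝ × E × ℝ →L[ℝ] ℝ :=
  ContinuousLinearMap.snd ℝ E ℝ ∘L ContinuousLinearMap.snd ℝ ℝ (E × ℝ)

/-- The inclusion `E → ℝ × E × ℝ`. -/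
abbrev inclX (E : Type*) [NormedAddCommGroup E] [NormedSpace ℝ E] : E →L[ℝ] ℝ × E × ℝ :=
  ContinuousLinearMap.inr ℝ ℝ (E × ℝ) ∘L ContinuousLinearMap.inl ℝ E ℝ

/-- The bilinear form `2 du dv + B`. -/
def lorentzSum (B : E →L[ℝ] E →L[ℝ] ℝ) : ℝ × E × ℝ →L[ℝ] ℝ × E × ℝ →L[ℝ] ℝ :=
  (ContinuousLinearMap.mul ℝ ℝ).bilinearComp (duL E) (dvL E)
    + (ContinuousLinearMap.mul ℝ ℝ).bilinearComp (dvL E) (duL E) + B.bilinearComp (dxL E) (dxL E)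

theorem lorentzSum_apply (B : E →L[ℝ] E →L[ℝ] ℝ) (X Y : ℝ × E × ℝ) :
    lorentzSum B X Y = X.2.2 * Y.1 + X.1 * Y.2.2 + B X.2.1 Y.2.1 := rfl

theorem isInvertible_of_injective {F : Type*} [NormedAddCommGroup F] [NormedSpace ℝ F]
    [FiniteDimensional ℝ E] [FiniteDimensional ℝ F] {T : E →L[ℝ] F}
    (hd : Module.finrank ℝ E = Module.finrank ℝ F) (h : ∀ X, T X = 0 → X = 0) :
    T.IsInvertible := by
  have hinj : Function.Injective (T : E →ₗ[ℝ] F) := (injective_iff_map_eq_zero _).2 h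
  exact ⟨(LinearEquiv.ofInjectiveOfFinrankEq (T : E →ₗ[ℝ] F) hinj hd).toContinuousLinearEquiv, by
    ext X; rfl⟩

theorem finrank_dual_eq [FiniteDimensional ℝ E] :
    Module.finrank ℝ E = Module.finrank ℝ (E →L[ℝ] ℝ) := by
  rw [← (LinearMap.toContinuousLinearMap : (E →ₗ[ℝ] ℝ) ≃ₗ[ℝ] (E →L[ℝ] ℝ)).finrank_eq]
  exact (Subspace.dual_finrank_eq).symm

theorem lorentzSum_isInvertible [FiniteDimensional ℝ E] {B : E →L[ℝ] E →L[ℝ] ℝ}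
    (hB : B.IsInvertible) : (lorentzSum B).IsInvertible := by
  refine isInvertible_of_injective finrank_dual_eq fun X hX => ?_
  have h (Y : ℝ × E × ℝ) : X.2.2 * Y.1 + X.1 * Y.2.2 + B X.2.1 Y.2.1 = 0 := by
    rw [← lorentzSum_apply, hX]; rfl
  have h1 := h (1, 0, 0)
  have h2 := h (0, 0, 1)
  have h3 : X.2.1 = 0 := hB.injective (by
    ext Y
    simpa using h (0, Y, 0))
  simp only [mul_one, mul_zero, map_zero, add_zero, zero_add] at h1 h2
  exact Prod.ext h2 (Prod.ext h3 h1)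

theorem contDiffOn_comp_dxL {F : Type*} [NormedAddCommGroup F] [NormedSpace ℝ F] {c : E → F} {U : Set E}
    (hc : ContDiffOn ℝ ∞ c U) :
    ContDiffOn ℝ ∞ (fun p : ℝ × E × ℝ => c p.2.1) {p : ℝ × E × ℝ | p.2.1 ∈ U} :=
  hc.comp (dxL E).contDiff.contDiffOn fun _ hp => hp

theorem hasFDerivAt_comp_dxL {F : Type*} [NormedAddCommGroup F] [NormedSpace ℝ F] {c : E → F}
    {U : Set E} (hU : IsOpen U) (hc : ContDiffOn ℝ ∞ c U) {p : ℝ × E × ℝ} (hp : p.2.1 ∈ U) :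
    HasFDerivAt (fun p : ℝ × E × ℝ => c p.2.1) (fderiv ℝ c p.2.1 ∘L dxL E) p :=
  (differentiableAt_of_contDiffOn hU hc hp).hasFDerivAt.comp p (dxL E).hasFDerivAt

variable [FiniteDimensional ℝ E] (G : E → E →L[ℝ] E →L[ℝ] ℝ) (f : E → ℝ) (lam : ℝ)

/-- The metric `2 du dv + G + 2 u P + u² P²` in coordinates. -/
def ambientMetric (p : ℝ × E × ℝ) : ℝ × E × ℝ →L[ℝ] ℝ × E × ℝ →L[ℝ] ℝ :=
  lorentzSum (G p.2.1 + (2 * p.2.2) • localP G f lam p.2.1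
    + p.2.2 ^ 2 • metricSquare (G p.2.1) (localP G f lam p.2.1))

/-- The potential `f - u Y - v + λ u v` in coordinates. -/
def ambientPotential (p : ℝ × E × ℝ) : ℝ :=
  f p.2.1 - p.2.2 * localY G f lam p.2.1 - p.1 + lam * p.2.2 * p.1

/-- The frame change `(a, ξ, b) ↦ (a, ξ + u A ξ, b)`. -/
def frameChange (p : ℝ × E × ℝ) : ℝ × E × ℝ →L[ℝ] ℝ × E × ℝ :=
  ContinuousLinearMap.id ℝ (ℝ × E × ℝ) + p.2.2 • (inclX E ∘L localA G f lam p.2.1 ∘L dxL E)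

theorem frameChange_apply (p X : ℝ × E × ℝ) :
    frameChange G f lam p X = (X.1, X.2.1 + p.2.2 • localA G f lam p.2.1 X.2.1, X.2.2) := by
  ext <;> simp [frameChange]

/-- The ambient Levi-Civita connection in the frame given by `frameChange`. -/
def frameConnection (p : ℝ × E × ℝ) : ℝ × E × ℝ →L[ℝ] ℝ × E × ℝ →L[ℝ] ℝ × E × ℝ :=
  ContinuousLinearMap.compL ℝ (ℝ × E × ℝ) E (ℝ × E × ℝ) (inclX E) ∘L
      ((christoffel G p.2.1).bilinearComp (dxL E) (dxL E)
        + ContinuousLinearMap.smulRightL ℝ (ℝ × E × ℝ) E (duL E) ∘L localA G f lam p.2.1 ∘L dxL E)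
    - ContinuousLinearMap.compL ℝ (ℝ × E × ℝ) ℝ (ℝ × E × ℝ) (ContinuousLinearMap.inl ℝ ℝ (E × ℝ)) ∘L
      (localP G f lam p.2.1).bilinearComp (dxL E) (dxL E)

/-- Neither `u` nor `v` occurs, so only derivatives along `x` enter the curvature of this
connection. -/
theorem frameConnection_apply (p X Y : ℝ × E × ℝ) :
    frameConnection G f lam p X Y = (- localP G f lam p.2.1 X.2.1 Y.2.1,
      christoffel G p.2.1 X.2.1 Y.2.1 + Y.2.2 • localA G f lam p.2.1 X.2.1, 0) := by
  ext <;> simp [frameConnection]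

/-- The points over `U` where the frame change is invertible. -/
def ambientDomain (U : Set E) : Set (ℝ × E × ℝ) :=
  {p | p.2.1 ∈ U ∧ (frameChange G f lam p).IsInvertible}

variable {G f lam}

namespace IsSolitonOrFlatOn

variable {U : Set E} (h : IsSolitonOrFlatOn G f lam U) {p : ℝ × E × ℝ}
include h

theorem isOpen_preimage : IsOpen {p : ℝ × E × ℝ | p.2.1 ∈ U} :=
  h.metric.isOpen.preimage (dxL E).continuous

theorem contDiffOn_frameChange :
    ContDiffOn ℝ ∞ (frameChange G f lam) {p : ℝ × E × ℝ | p.2.1 ∈ U} := by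
  have h1 := contDiffOn_comp_dxL (h.metric.contDiffOn_localA h.contDiffOn lam)
  have h2 : ContDiffOn ℝ ∞ (fun p : ℝ × E × ℝ => p.2.2) {p : ℝ × E × ℝ | p.2.1 ∈ U} :=
    (duL E).contDiff.contDiffOn
  exact contDiffOn_const.add (h2.smul (contDiffOn_const.clm_comp (h1.clm_comp contDiffOn_const)))

theorem contDiffOn_frameConnection :
    ContDiffOn ℝ ∞ (frameConnection G f lam) {p : ℝ × E × ℝ | p.2.1 ∈ U} := by
  have hA := contDiffOn_comp_dxL (h.metric.contDiffOn_localA h.contDiffOn lam)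
  have hP := contDiffOn_comp_dxL (h.metric.contDiffOn_localP h.contDiffOn lam)
  have hΓ := contDiffOn_comp_dxL h.metric.contDiffOn_christoffel
  refine contDiffOn_clm_apply.2 fun X => contDiffOn_clm_apply.2 fun Y => ?_
  simp only [frameConnection_apply]
  exact ((hP.clm_apply contDiffOn_const).clm_apply contDiffOn_const).neg.prodMk
    ((((hΓ.clm_apply contDiffOn_const).clm_apply contDiffOn_const).add
      (contDiffOn_const.smul (hA.clm_apply contDiffOn_const))).prodMk contDiffOn_const)

theorem contDiffOn_ambientPotential :
    ContDiffOn ℝ ∞ (ambientPotential G f lam) {p : ℝ × E × ℝ | p.2.1 ∈ U} := by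
  have hY := contDiffOn_comp_dxL (h.metric.contDiffOn_localY h.contDiffOn lam)
  have hf := contDiffOn_comp_dxL h.contDiffOn
  have hu : ContDiffOn ℝ ∞ (fun p : ℝ × E × ℝ => p.2.2) {p : ℝ × E × ℝ | p.2.1 ∈ U} :=
    (duL E).contDiff.contDiffOn
  have hv : ContDiffOn ℝ ∞ (fun p : ℝ × E × ℝ => p.1) {p : ℝ × E × ℝ | p.2.1 ∈ U} :=
    (dvL E).contDiff.contDiffOn
  exact ((hf.sub (hu.mul hY)).sub hv).add ((contDiffOn_const.mul hu).mul hv)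

/-- Completing the square: `G + 2uP + u²P²` is the pullback of `G` by `1 + uA`, since `P = G(A·, ·)`
and `P` is symmetric. -/
theorem metricFamily_eq (hp : p.2.1 ∈ U) (ξ η : E) :
    (G p.2.1 + (2 * p.2.2) • localP G f lam p.2.1
      + p.2.2 ^ 2 • metricSquare (G p.2.1) (localP G f lam p.2.1)) ξ η =
    G p.2.1 (ξ + p.2.2 • localA G f lam p.2.1 ξ) (η + p.2.2 • localA G f lam p.2.1 η) := by
  have e1 : G p.2.1 ξ (localA G f lam p.2.1 η) = localP G f lam p.2.1 ξ η := by
    rw [h.metric.symm _ hp, h.metric.apply_localA lam hp, h.localP_symm hp]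
  have e2 : metricSquare (G p.2.1) (localP G f lam p.2.1) ξ η =
      localP G f lam p.2.1 ξ (localA G f lam p.2.1 η) := rfl
  simp only [add_apply, smul_apply, map_add, map_smul, smul_eq_mul, e1, e2,
    h.metric.apply_localA lam hp]
  ring

theorem ambientMetric_eq (hp : p.2.1 ∈ U) (X Y : ℝ × E × ℝ) :
    ambientMetric G f lam p X Y =
      lorentzSum (G p.2.1) (frameChange G f lam p X) (frameChange G f lam p Y) := by
  rw [ambientMetric, lorentzSum_apply, lorentzSum_apply, h.metricFamily_eq hp, frameChange_apply,
    frameChange_apply]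

theorem isOpen_ambientDomain : IsOpen (ambientDomain G f lam U) := by
  have : CompleteSpace E := FiniteDimensional.complete ℝ E
  exact h.contDiffOn_frameChange.continuousOn.isOpen_inter_preimage h.isOpen_preimage
    (ContinuousLinearEquiv.isOpen (𝕜 := ℝ) (E := ℝ × E × ℝ) (F := ℝ × E × ℝ))

/-- A vector killed by `1 + uA` lies in the radical of `g_u`. With the converse
`nondegenerate_of_mem`, nondegeneracy of `g_u` amounts to invertibility of the frame change. -/
theorem mem_ambientDomain (hp : p.2.1 ∈ U)
    (hnd : ∀ ξ, (∀ η, (G p.2.1 + (2 * p.2.2) • localP G f lam p.2.1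
      + p.2.2 ^ 2 • metricSquare (G p.2.1) (localP G f lam p.2.1)) ξ η = 0) → ξ = 0) :
    p ∈ ambientDomain G f lam U := by
  refine ⟨hp, isInvertible_of_injective rfl fun X hX => ?_⟩
  rw [frameChange_apply] at hX
  simp only [Prod.mk_eq_zero] at hX
  have h1 : X.2.1 = 0 := hnd _ fun η => by
    rw [h.metricFamily_eq hp, hX.2.1]; simp
  exact Prod.ext hX.1 (Prod.ext h1 hX.2.2)

theorem nondegenerate_of_mem (hp : p ∈ ambientDomain G f lam U) {ξ : E}
    (hξ : ∀ η, (G p.2.1 + (2 * p.2.2) • localP G f lam p.2.1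
      + p.2.2 ^ 2 • metricSquare (G p.2.1) (localP G f lam p.2.1)) ξ η = 0) : ξ = 0 := by
  have h1 : frameChange G f lam p (0, ξ, 0) = 0 := by
    refine (lorentzSum_isInvertible (h.metric.invertible _ hp.1)).injective
      (ContinuousLinearMap.ext fun Y' => ?_)
    obtain ⟨Y, rfl⟩ := hp.2.surjective Y'
    rw [← h.ambientMetric_eq hp.1, ambientMetric, lorentzSum_apply, hξ]
    simp
  have h2 : ((0, ξ, 0) : ℝ × E × ℝ) = 0 := hp.2.injective (by rw [h1, map_zero])
  simpa using h2

theorem lorentzSum_symm (hp : p.2.1 ∈ U) (X Y : ℝ × E × ℝ) :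
    lorentzSum (G p.2.1) X Y = lorentzSum (G p.2.1) Y X := by
  rw [lorentzSum_apply, lorentzSum_apply, h.metric.symm _ hp]; ring

theorem contDiffOn_lorentzSum :
    ContDiffOn ℝ ∞ (fun p : ℝ × E × ℝ => lorentzSum (G p.2.1)) {p : ℝ × E × ℝ | p.2.1 ∈ U} := by
  have hG := contDiffOn_comp_dxL h.metric.contDiffOn
  refine contDiffOn_clm_apply.2 fun X => contDiffOn_clm_apply.2 fun Y => ?_
  simp only [lorentzSum_apply]
  exact contDiffOn_const.add ((hG.clm_apply contDiffOn_const).clm_apply contDiffOn_const)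

theorem ambient_isMetricOn : IsMetricOn (ambientMetric G f lam) (ambientDomain G f lam U) where
  isOpen := h.isOpen_ambientDomain
  contDiffOn := by
    have hT := h.contDiffOn_frameChange
    have hK := h.contDiffOn_lorentzSum
    refine contDiffOn_clm_apply.2 fun X => contDiffOn_clm_apply.2 fun Y => ?_
    refine ContDiffOn.congr (f := fun p => lorentzSum (G p.2.1) (frameChange G f lam p X)
      (frameChange G f lam p Y)) (ContDiffOn.mono ?_ fun p hp => hp.1)
      fun p hp => h.ambientMetric_eq hp.1 X Y
    exact (hK.clm_apply (hT.clm_apply contDiffOn_const)).clm_apply (hT.clm_apply contDiffOn_const)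
  symm := fun p hp X Y => by
    rw [h.ambientMetric_eq hp.1, h.ambientMetric_eq hp.1, h.lorentzSum_symm hp.1]
  invertible := fun p hp => isInvertible_of_pullback
    (lorentzSum_isInvertible (h.metric.invertible _ hp.1)) hp.2 (h.ambientMetric_eq hp.1)

theorem fderiv_frameChange (hp : p.2.1 ∈ U) (X Y : ℝ × E × ℝ) :
    fderiv ℝ (frameChange G f lam) p X Y =
      (0, X.2.2 • localA G f lam p.2.1 Y.2.1
        + p.2.2 • fderiv ℝ (localA G f lam) p.2.1 X.2.1 Y.2.1, 0) := by
  have d0 := differentiableAt_of_contDiffOn h.isOpen_preimage h.contDiffOn_frameChange hp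
  have dA := hasFDerivAt_apply_const (hasFDerivAt_comp_dxL h.metric.isOpen
    (h.metric.contDiffOn_localA h.contDiffOn lam) hp) Y.2.1
  have du : HasFDerivAt (fun p : ℝ × E × ℝ => p.2.2) (duL E) p := (duL E).hasFDerivAt
  have h1 := (hasFDerivAt_const Y.1 p).prodMk (((du.smul dA).const_add Y.2.1).prodMk
    (hasFDerivAt_const Y.2.2 p))
  rw [← fderiv_apply_const d0]
  simp only [frameChange_apply]
  have h2 : fderiv ℝ (fun p : ℝ × E × ℝ => (Y.1, Y.2.1 + p.2.2 • localA G f lam p.2.1 Y.2.1,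
    Y.2.2)) p = _ := h1.fderiv
  rw [h2]
  ext <;> simp [add_comm]

theorem fderiv_frameConnection (hp : p.2.1 ∈ U) (X Y Z : ℝ × E × ℝ) :
    fderiv ℝ (frameConnection G f lam) p X Y Z =
      (- fderiv ℝ (localP G f lam) p.2.1 X.2.1 Y.2.1 Z.2.1,
        fderiv ℝ (christoffel G) p.2.1 X.2.1 Y.2.1 Z.2.1
          + Z.2.2 • fderiv ℝ (localA G f lam) p.2.1 X.2.1 Y.2.1, 0) := by
  have hU := h.metric.isOpen
  have d0 := differentiableAt_of_contDiffOn h.isOpen_preimage h.contDiffOn_frameConnection hp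
  have dA := hasFDerivAt_apply_const (hasFDerivAt_comp_dxL hU
    (h.metric.contDiffOn_localA h.contDiffOn lam) hp) Y.2.1
  have dP := hasFDerivAt_apply_const (hasFDerivAt_apply_const (hasFDerivAt_comp_dxL hU
    (h.metric.contDiffOn_localP h.contDiffOn lam) hp) Y.2.1) Z.2.1
  have dΓ := hasFDerivAt_apply_const (hasFDerivAt_apply_const (hasFDerivAt_comp_dxL hU
    h.metric.contDiffOn_christoffel hp) Y.2.1) Z.2.1
  have h1 := dP.neg.prodMk ((dΓ.add (dA.const_smul Z.2.2)).prodMk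
    (hasFDerivAt_const (0 : ℝ) p))
  rw [← fderiv_apply_const₂ d0]
  simp only [frameConnection_apply]
  have h2 : fderiv ℝ (fun p : ℝ × E × ℝ => (- localP G f lam p.2.1 Y.2.1 Z.2.1,
      christoffel G p.2.1 Y.2.1 Z.2.1 + Z.2.2 • localA G f lam p.2.1 Y.2.1, (0 : ℝ))) p = _ :=
    h1.fderiv
  rw [h2]
  rfl

theorem fderiv_lorentzSum (hp : p.2.1 ∈ U) (X Y Z : ℝ × E × ℝ) :
    fderiv ℝ (fun p : ℝ × E × ℝ => lorentzSum (G p.2.1)) p X Y Z =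
      fderiv ℝ G p.2.1 X.2.1 Y.2.1 Z.2.1 := by
  have d0 := differentiableAt_of_contDiffOn h.isOpen_preimage h.contDiffOn_lorentzSum hp
  have dG := hasFDerivAt_apply_const (hasFDerivAt_apply_const (hasFDerivAt_comp_dxL h.metric.isOpen
    h.metric.contDiffOn hp) Y.2.1) Z.2.1
  rw [← fderiv_apply_const₂ d0]
  simp only [lorentzSum_apply]
  have h2 : fderiv ℝ (fun p : ℝ × E × ℝ => Y.2.2 * Z.1 + Y.1 * Z.2.2 + G p.2.1 Y.2.1 Z.2.1) p = _ :=
    (dG.const_add (Y.2.2 * Z.1 + Y.1 * Z.2.2)).fderiv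
  rw [h2]
  rfl

end IsSolitonOrFlatOn

end AmbientCoordinates

/-! ### The ambient connection, curvature and Hessian, and the vanishing of `P` and `F`. -/

section AmbientCurvature

variable {E : Type*} [NormedAddCommGroup E] [NormedSpace ℝ E] [FiniteDimensional ℝ E]
  {G : E → E →L[ℝ] E →L[ℝ] ℝ} {f : E → ℝ} {lam : ℝ}

theorem traceL_inclX_comp (A : E →L[ℝ] E) :
    traceL (ℝ × E × ℝ) (inclX E ∘L A ∘L dxL E) = traceL E A :=
  (LinearMap.trace_comp_comm' (R := ℝ) (inclX E : E →ₗ[ℝ] ℝ × E × ℝ)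
    ((A ∘L dxL E : ℝ × E × ℝ →L[ℝ] E) : ℝ × E × ℝ →ₗ[ℝ] E)).symm

namespace IsSolitonOrFlatOn

variable {U : Set E} (h : IsSolitonOrFlatOn G f lam U) {p : ℝ × E × ℝ}
include h

/-- `frameConnection` is compatible with the metric `2 du dv + G`. -/
theorem lorentzSum_frameConnection (hp : p.2.1 ∈ U) (X Y Z : ℝ × E × ℝ) :
    lorentzSum (G p.2.1) (frameConnection G f lam p X Y) Z
      + lorentzSum (G p.2.1) Y (frameConnection G f lam p X Z) =
    fderiv ℝ G p.2.1 X.2.1 Y.2.1 Z.2.1 := by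
  have e1 : G p.2.1 Y.2.1 (localA G f lam p.2.1 X.2.1) = localP G f lam p.2.1 X.2.1 Y.2.1 := by
    rw [h.metric.symm _ hp, h.metric.apply_localA lam hp]
  simp only [lorentzSum_apply, frameConnection_apply, map_add, map_smul, add_apply, smul_apply,
    smul_eq_mul, h.metric.apply_localA lam hp, e1, h.metric.fderiv_eq hp]
  ring

/-- The ambient Levi-Civita connection. -/
theorem map_ambient_christoffel (hp : p ∈ ambientDomain G f lam U) (X Y : ℝ × E × ℝ) :
    frameChange G f lam p (christoffel (ambientMetric G f lam) p X Y) =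
      fderiv ℝ (frameChange G f lam) p X Y
        + frameConnection G f lam p X (frameChange G f lam p Y) := by
  refine h.ambient_isMetricOn.map_christoffel_eq hp (K := lorentzSum (G p.2.1))
    (B := fun X Y => fderiv ℝ (frameChange G f lam) p X Y
        + frameConnection G f lam p X (frameChange G f lam p Y))
    (lorentzSum_isInvertible (h.metric.invertible _ hp.1)) (h.lorentzSum_symm hp.1) hp.2
    (h.ambientMetric_eq hp.1) ?_ ?_ X Y
  -- Vanishing torsion. The `v`-component is symmetric because `P` and `P(·, A·)` are; the
  -- `x`-component differs from its transpose by `u` times the Codazzi defect of `A`.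
  · intro X Y
    have hc := h.localA_codazzi hp.1 X.2.1 Y.2.1
    have hs := h.metric.christoffel_symm hp.1 X.2.1 Y.2.1
    have hP := h.localP_symm hp.1 X.2.1 Y.2.1
    have hPA := h.localP_localA_symm hp.1 X.2.1 Y.2.1
    simp only [h.fderiv_frameChange hp.1, frameConnection_apply, frameChange_apply, map_add,
      map_smul, Prod.mk_add_mk, smul_eq_mul, hP, hPA, hs]
    refine Prod.ext rfl (Prod.ext ?_ rfl)
    linear_combination (norm := module) p.2.2 • hc
  -- Metric compatibility: the product rule on `G̃ = T^*(2 du dv + G)`, where the derivative of the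
  -- model form is supplied by `lorentzSum_frameConnection`.
  · intro X Y Z
    have dT := (differentiableAt_of_contDiffOn h.isOpen_preimage h.contDiffOn_frameChange
      hp.1).hasFDerivAt
    have dK := (differentiableAt_of_contDiffOn h.isOpen_preimage h.contDiffOn_lorentzSum
      hp.1).hasFDerivAt
    have h1 := (dK.clm_apply (hasFDerivAt_apply_const dT Y)).clm_apply
      (hasFDerivAt_apply_const dT Z)
    have h2 := (hasFDerivAt_apply_const (hasFDerivAt_apply_const
      (h.ambient_isMetricOn.differentiableAt hp).hasFDerivAt Y) Z).unique
      (h1.congr_of_eventuallyEq (by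
        filter_upwards [h.isOpen_preimage.mem_nhds hp.1] with q hq
        exact h.ambientMetric_eq hq Y Z))
    have h3 := congrArg (fun A : ℝ × E × ℝ →L[ℝ] ℝ => A X) h2
    simp only [add_apply, ContinuousLinearMap.comp_apply, ContinuousLinearMap.flip_apply,
      h.fderiv_lorentzSum hp.1] at h3
    rw [← h.lorentzSum_frameConnection hp.1] at h3
    simp only [map_add, add_apply]
    linear_combination h3

/-- Besides the curvature of `G` there are only Codazzi defects: that of `P` and the asymmetry of
`P(·, A·)` along `v`, that of `A` along `x`. -/
theorem connectionCurvature_frameConnection (hp : p.2.1 ∈ U)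
    (X Y Z : ℝ × E × ℝ) :
    connectionCurvature (frameConnection G f lam) p X Y Z =
      (0, riemann G p.2.1 X.2.1 Y.2.1 Z.2.1, 0) := by
  have c1 := h.localP_codazzi hp X.2.1 Y.2.1 Z.2.1
  have c2 := h.localA_codazzi hp X.2.1 Y.2.1
  have c3 := h.localP_localA_symm hp X.2.1 Y.2.1
  simp only [connectionCurvature, h.fderiv_frameConnection hp, frameConnection_apply,
    riemann_apply, map_add, map_smul, Prod.mk_add_mk, Prod.mk_sub_mk, smul_eq_mul, zero_smul]
  refine Prod.ext ?_ (Prod.ext ?_ ?_)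
  · simp only
    linear_combination -c1 - Z.2.2 * c3
  · simp only
    linear_combination (norm := module) Z.2.2 • c2
  · simp

/-- `map_connectionCurvature` with the base map the identity: `T` acts as a change of frame between
the ambient connection and `frameConnection`. -/
theorem map_ambient_riemann (hp : p ∈ ambientDomain G f lam U) (X Y Z : ℝ × E × ℝ) :
    frameChange G f lam p (riemann (ambientMetric G f lam) p X Y Z) =
      (0, riemann G p.2.1 X.2.1 Y.2.1 (frameChange G f lam p Z).2.1, 0) := by
  have h1 := map_connectionCurvature (Ψ := fun q => q) (T := frameChange G f lam)
    (θ := frameConnection G f lam) (θ' := christoffel (ambientMetric G f lam))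
    h.isOpen_ambientDomain h.isOpen_preimage contDiffOn_id
    (h.contDiffOn_frameChange.mono fun p hp => hp.1) h.contDiffOn_frameConnection
    h.ambient_isMetricOn.contDiffOn_christoffel (fun q hq => hq.1)
    (fun q hq X Y => by simp only [fderiv_fun_id, ContinuousLinearMap.id_apply]
                        exact h.map_ambient_christoffel hq X Y) hp X Y Z
  rw [h.connectionCurvature_frameConnection hp.1] at h1
  simp only [fderiv_fun_id, ContinuousLinearMap.id_apply] at h1
  exact h1

/-- The dichotomy used to discard the frame change: where it meets curvature, either `T` is the
identity or the curvature is zero. -/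
theorem localA_eq_zero_or : (∀ y ∈ U, localA G f lam y = 0) ∨ (∀ y ∈ U, riemann G y = 0) := by
  refine h.soliton_or_flat.imp_left fun h1 y hy => ?_
  rw [localA, h1 y hy, ContinuousLinearMap.comp_zero]

omit h in
theorem frameChange_eq_id (hA : localA G f lam p.2.1 = 0) :
    frameChange G f lam p = ContinuousLinearMap.id ℝ (ℝ × E × ℝ) := by
  ext X <;> simp [frameChange_apply, hA]

theorem ambient_riemann (hp : p ∈ ambientDomain G f lam U) (X Y Z : ℝ × E × ℝ) :
    riemann (ambientMetric G f lam) p X Y Z = (0, riemann G p.2.1 X.2.1 Y.2.1 Z.2.1, 0) := by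
  have h1 := h.map_ambient_riemann hp X Y Z
  rcases h.localA_eq_zero_or with hA | hR
  · simpa [frameChange_eq_id (hA _ hp.1)] using h1
  · refine hp.2.injective ?_
    rw [h1, hR _ hp.1]
    simp [frameChange_apply]

theorem ambient_ricci (hp : p ∈ ambientDomain G f lam U) (Y Z : ℝ × E × ℝ) :
    ricci (ambientMetric G f lam) p Y Z = ricci G p.2.1 Y.2.1 Z.2.1 := by
  have h1 : (((riemann (ambientMetric G f lam) p).flip Y).flip Z : ℝ × E × ℝ →L[ℝ] ℝ × E × ℝ) =
      inclX E ∘L (((riemann G p.2.1).flip Y.2.1).flip Z.2.1) ∘L dxL E := by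
    refine ContinuousLinearMap.ext fun X => ?_
    simpa using h.ambient_riemann hp X Y Z
  rw [ricci_apply, ricci_apply, h1]
  exact traceL_inclX_comp _

/-- The differential of the ambient potential in the frame given by `frameChange`. -/
def frameDifferential (G : E → E →L[ℝ] E →L[ℝ] ℝ) (f : E → ℝ) (lam : ℝ) (p : ℝ × E × ℝ) :
    ℝ × E × ℝ →L[ℝ] ℝ :=
  (-1 + lam * p.2.2) • dvL E + fderiv ℝ f p.2.1 ∘L dxL E
    + (- localY G f lam p.2.1 + lam * p.1) • duL E

omit h in
theorem frameDifferential_apply (X : ℝ × E × ℝ) : frameDifferential G f lam p X =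
    (-1 + lam * p.2.2) * X.1 + fderiv ℝ f p.2.1 X.2.1
      + (- localY G f lam p.2.1 + lam * p.1) * X.2.2 := rfl

/-- Along `x` the differential is `df - u dY`, which equals `df ∘ (1 + uA)` because `dY = -df ∘ A`.
-/
theorem fderiv_ambientPotential (hp : p.2.1 ∈ U) :
    fderiv ℝ (ambientPotential G f lam) p =
      frameDifferential G f lam p ∘L frameChange G f lam p := by
  have dY := hasFDerivAt_comp_dxL h.metric.isOpen (h.metric.contDiffOn_localY h.contDiffOn lam) hp
  have df := hasFDerivAt_comp_dxL h.metric.isOpen h.contDiffOn hp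
  have du : HasFDerivAt (fun p : ℝ × E × ℝ => p.2.2) (duL E) p := (duL E).hasFDerivAt
  have dv : HasFDerivAt (fun p : ℝ × E × ℝ => p.1) (dvL E) p := (dvL E).hasFDerivAt
  have h1 : HasFDerivAt (ambientPotential G f lam) _ p :=
    ((df.sub (du.mul dY)).sub dv).add ((du.const_mul lam).mul dv)
  rw [h1.fderiv]
  refine ContinuousLinearMap.ext fun X => ?_
  have h2 := h.fderiv_localY hp X.2.1
  rw [ContinuousLinearMap.comp_apply, frameDifferential_apply, frameChange_apply]
  simp only [add_apply, sub_apply, smul_apply, ContinuousLinearMap.comp_apply, smul_eq_mul,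
    ContinuousLinearMap.coe_fst', ContinuousLinearMap.coe_snd', map_add, map_smul]
  linear_combination -p.2.2 * h2

/-- With `dφ̃ = α ∘ T` the derivatives of `T` cancel, and the Hessian is `(D_X α)(TY) - α(θ(X) TY)`,
where `θ` is `frameConnection`. Its `du` terms cancel by `dY = -df ∘ A`. What is left is `2λ du dv +
∇²f(X, TY) - (1 - λu) P(X, TY)`; substituting `∇²f = P - Ric + λ G` produces `λ G̃ - Ric(X, TY)`,
and `T` drops out of the Ricci term. -/
theorem ambient_hessian (hp : p ∈ ambientDomain G f lam U) (X Y : ℝ × E × ℝ) :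
    hessian (ambientMetric G f lam) (ambientPotential G f lam) p X Y =
      lam * ambientMetric G f lam p X Y - ricci G p.2.1 X.2.1 Y.2.1 := by
  have hU := h.metric.isOpen
  have dY := hasFDerivAt_comp_dxL hU (h.metric.contDiffOn_localY h.contDiffOn lam) hp.1
  have df := hasFDerivAt_comp_dxL hU (contDiffOn_fderiv hU h.contDiffOn) hp.1
  have dT := (differentiableAt_of_contDiffOn h.isOpen_preimage h.contDiffOn_frameChange
    hp.1).hasFDerivAt
  have du : HasFDerivAt (fun p : ℝ × E × ℝ => p.2.2) (duL E) p := (duL E).hasFDerivAt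
  have dv : HasFDerivAt (fun p : ℝ × E × ℝ => p.1) (dvL E) p := (dvL E).hasFDerivAt
  have hd : DifferentiableAt ℝ (fderiv ℝ (ambientPotential G f lam)) p :=
    differentiableAt_of_contDiffOn h.isOpen_preimage
      (contDiffOn_fderiv h.isOpen_preimage h.contDiffOn_ambientPotential) hp.1
  have dTY := hasFDerivAt_apply_const dT Y
  have h1 := (((((du.const_mul lam).const_add (-1)).mul ((dvL E).hasFDerivAt.comp p dTY)).add
    (df.clm_apply ((dxL E).hasFDerivAt.comp p dTY))).add
    ((dY.neg.add (dv.const_mul lam)).mul ((duL E).hasFDerivAt.comp p dTY)))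
  have h2 := h1.congr_of_eventuallyEq
    (f₁ := fun q => fderiv ℝ (ambientPotential G f lam) q Y) (by
      filter_upwards [h.isOpen_preimage.mem_nhds hp.1] with q hq
      rw [h.fderiv_ambientPotential hq]
      rfl)
  have h3 : fderiv ℝ (fderiv ℝ (ambientPotential G f lam)) p X Y = _ :=
    (fderiv_apply_const hd Y X).symm.trans (congrArg (fun A : ℝ × E × ℝ →L[ℝ] ℝ => A X) h2.fderiv)
  rw [hessian_apply, h3, h.fderiv_ambientPotential hp.1, ContinuousLinearMap.comp_apply,
    h.map_ambient_christoffel hp, map_add, frameDifferential_apply, frameDifferential_apply,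
    frameConnection_apply]
  have e1 := h.fderiv_localY hp.1 X.2.1
  have e2 : hessian G f p.2.1 X.2.1 (frameChange G f lam p Y).2.1 = _ := hessian_apply _ _ _ _ _
  have e3 : localP G f lam p.2.1 X.2.1 (frameChange G f lam p Y).2.1 =
    ricci G p.2.1 X.2.1 (frameChange G f lam p Y).2.1
      + hessian G f p.2.1 X.2.1 (frameChange G f lam p Y).2.1
      - lam * G p.2.1 X.2.1 (frameChange G f lam p Y).2.1 := rfl
  have e4 : ricci G p.2.1 X.2.1 (frameChange G f lam p Y).2.1 = ricci G p.2.1 X.2.1 Y.2.1 := by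
    rcases h.localA_eq_zero_or with hA | hR
    · simp [frameChange_eq_id (hA _ hp.1)]
    · simp [ricci_eq_zero (hR _ hp.1)]
  have e5 : ambientMetric G f lam p X Y = X.2.2 * Y.1 + X.1 * Y.2.2
      + G p.2.1 X.2.1 (frameChange G f lam p Y).2.1
      + p.2.2 * localP G f lam p.2.1 X.2.1 (frameChange G f lam p Y).2.1 := by
    rw [h.ambientMetric_eq hp.1, lorentzSum_apply, ← h.metric.apply_localA lam hp.1]
    simp only [frameChange_apply, map_add, map_smul, add_apply, smul_apply, smul_eq_mul]
    ring
  have f1 : (frameChange G f lam p Y).1 = Y.1 := by rw [frameChange_apply]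
  have f2 : (frameChange G f lam p Y).2.2 = Y.2.2 := by rw [frameChange_apply]
  simp only [add_apply, neg_apply, smul_apply, ContinuousLinearMap.comp_apply, smul_eq_mul,
    ContinuousLinearMap.coe_fst', ContinuousLinearMap.coe_snd', map_add, map_smul,
    ContinuousLinearMap.flip_apply, Function.comp_apply, Pi.add_apply, Pi.neg_apply, f1, f2]
  rw [e5]
  linear_combination -e2 - e3 - Y.2.2 * e1 - e4

theorem ambient_weightedP (hp : p ∈ ambientDomain G f lam U) :
    localP (ambientMetric G f lam) (ambientPotential G f lam) lam p = 0 := by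
  refine ContinuousLinearMap.ext fun X => ContinuousLinearMap.ext fun Y => ?_
  simp only [localP, add_apply, sub_apply, smul_apply, smul_eq_mul, h.ambient_ricci hp,
    h.ambient_hessian hp, zero_apply]
  ring

/-- Computed in the frame: `dv` and `du` are null and dual to each other for `2 du dv + G`, so their
coefficients enter as twice their product. -/
theorem ambient_gradSq (hp : p ∈ ambientDomain G f lam U) :
    gradSq (ambientMetric G f lam) (ambientPotential G f lam) p =
      2 * (-1 + lam * p.2.2) * (- localY G f lam p.2.1 + lam * p.1) + gradSq G f p.2.1 := by
  have hK := lorentzSum_isInvertible (h.metric.invertible _ hp.1)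
  have h0 := h.fderiv_ambientPotential hp.1
  have h1 := map_inverse_pullback hK hp.2 (h.ambientMetric_eq hp.1)
    (α := frameDifferential G f lam p) (β := fderiv ℝ (ambientPotential G f lam) p)
    (fun X => by rw [h0]; rfl)
  have h2 : (lorentzSum (G p.2.1)).inverse (frameDifferential G f lam p) =
      (- localY G f lam p.2.1 + lam * p.1, (G p.2.1).inverse (fderiv ℝ f p.2.1),
        -1 + lam * p.2.2) := by
    refine hK.injective (ContinuousLinearMap.ext fun Z => ?_)
    rw [hK.self_apply_inverse, lorentzSum_apply, frameDifferential_apply,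
      h.metric.apply_inverse hp.1]
    ring
  rw [gradSq, h0, ContinuousLinearMap.comp_apply, ← h0, h1, h2, frameDifferential_apply, gradSq]
  ring

theorem ambient_scalar (hp : p ∈ ambientDomain G f lam U) :
    metricTrace (ambientMetric G f lam p) (ricci (ambientMetric G f lam) p) =
      metricTrace (G p.2.1) (ricci G p.2.1) := by
  rcases h.localA_eq_zero_or with hA | hR
  · have hK := lorentzSum_isInvertible (h.metric.invertible _ hp.1)
    have h0 : ambientMetric G f lam p = lorentzSum (G p.2.1) := by
      refine ContinuousLinearMap.ext fun X => ContinuousLinearMap.ext fun Y => ?_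
      rw [h.ambientMetric_eq hp.1, frameChange_eq_id (hA _ hp.1)]
      rfl
    have h1 : (ambientMetric G f lam p).inverse ∘L ricci (ambientMetric G f lam) p =
        inclX E ∘L ((G p.2.1).inverse ∘L ricci G p.2.1) ∘L dxL E := by
      refine ContinuousLinearMap.ext fun X => ?_
      rw [h0]
      refine hK.injective (ContinuousLinearMap.ext fun Z => ?_)
      rw [ContinuousLinearMap.comp_apply, hK.self_apply_inverse, h.ambient_ricci hp,
        lorentzSum_apply]
      simp [h.metric.apply_inverse hp.1]
    rw [metricTrace, metricTrace, h1]
    exact traceL_inclX_comp _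
  · have h1 : ricci (ambientMetric G f lam) p = 0 := by
      refine ContinuousLinearMap.ext fun X => ContinuousLinearMap.ext fun Y => ?_
      rw [h.ambient_ricci hp, ricci_eq_zero (hR _ hp.1)]
      rfl
    rw [h1, ricci_eq_zero (hR _ hp.1), metricTrace_zero, metricTrace_zero]

/-- The trace of `∇²φ̃ = λ G̃ - Ric` is `λ` times the ambient dimension minus `R`. All terms with
`u` or `v` cancel, leaving `-R - |∇f|² + 2λf - 2Y`, which is zero by the definition of `Y`. -/
theorem ambient_weightedF (hp : p ∈ ambientDomain G f lam U) :
    metricTrace (ambientMetric G f lam p)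
        (hessian (ambientMetric G f lam) (ambientPotential G f lam) p)
      - gradSq (ambientMetric G f lam) (ambientPotential G f lam) p
      + 2 * lam * ambientPotential G f lam p
      - (Module.finrank ℝ (ℝ × E × ℝ) : ℝ) * lam = 0 := by
  have h1 : hessian (ambientMetric G f lam) (ambientPotential G f lam) p =
      lam • ambientMetric G f lam p - ricci (ambientMetric G f lam) p := by
    refine ContinuousLinearMap.ext fun X => ContinuousLinearMap.ext fun Y => ?_
    rw [h.ambient_hessian hp, sub_apply, sub_apply, smul_apply, smul_apply, h.ambient_ricci hp]
    rfl
  have h2 : metricTrace (ambientMetric G f lam p)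
      (hessian (ambientMetric G f lam) (ambientPotential G f lam) p) =
      lam * Module.finrank ℝ (ℝ × E × ℝ) - metricTrace (G p.2.1) (ricci G p.2.1) := by
    rw [← h.ambient_scalar hp, metricTrace, h1, ContinuousLinearMap.comp_sub,
      ContinuousLinearMap.comp_smul, map_sub, map_smul,
      (h.ambient_isMetricOn.invertible p hp).inverse_comp_self]
    have h3 : traceL (ℝ × E × ℝ) (ContinuousLinearMap.id ℝ (ℝ × E × ℝ)) =
      Module.finrank ℝ (ℝ × E × ℝ) := LinearMap.trace_id ℝ (ℝ × E × ℝ)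
    rw [h3]
    rfl
  have h4 : localY G f lam p.2.1 = -(1 / 2) * (metricTrace (G p.2.1) (ricci G p.2.1)
    + gradSq G f p.2.1 - 2 * lam * f p.2.1) := rfl
  rw [h2, h.ambient_gradSq hp, ambientPotential]
  linear_combination -2 * h4

theorem ambient_christoffel_v_v (hp : p ∈ ambientDomain G f lam U) :
    christoffel (ambientMetric G f lam) p (1, 0, 0) (1, 0, 0) = 0 := by
  refine hp.2.injective ?_
  rw [h.map_ambient_christoffel hp, h.fderiv_frameChange hp.1, frameConnection_apply,
    frameChange_apply]
  simp

theorem ambient_christoffel_u_u (hp : p ∈ ambientDomain G f lam U) :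
    christoffel (ambientMetric G f lam) p (0, 0, 1) (0, 0, 1) = 0 := by
  refine hp.2.injective ?_
  rw [h.map_ambient_christoffel hp, h.fderiv_frameChange hp.1, frameConnection_apply,
    frameChange_apply]
  simp

end IsSolitonOrFlatOn

end AmbientCurvature

/-! ### Changes of chart: the coordinate expressions compute the tensors of the manifold. -/

section Charts

variable {E : Type*} [NormedAddCommGroup E] [NormedSpace ℝ E]
  {H : Type*} [TopologicalSpace H] (I : ModelWithCorners ℝ E H)
  {N : Type*} [TopologicalSpace N] [ChartedSpace H N]

/-- The change of coordinates from the preferred chart at `p` to the one at `q`. -/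
def chartChange (p q : N) : E → E := fun z => extChartAt I q ((extChartAt I p).symm z)

/-- The domain of the change of coordinates from the preferred chart at `p` to the one at `q`. -/
def chartOverlap (p q : N) : Set E := ((extChartAt I p).symm ≫ extChartAt I q).source

theorem mem_chartOverlap {p q : N} {z : E} : z ∈ chartOverlap I p q ↔
    z ∈ (extChartAt I p).target ∧ (extChartAt I p).symm z ∈ (extChartAt I q).source := by
  simp only [chartOverlap, PartialEquiv.trans_source, PartialEquiv.symm_source]; rfl

theorem chartChange_mem {p q : N} {z : E} (hz : z ∈ chartOverlap I p q) :
    chartChange I p q z ∈ (extChartAt I q).target :=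
  (extChartAt I q).map_source ((mem_chartOverlap I).1 hz).2

theorem symm_chartChange {p q : N} {z : E} (hz : z ∈ chartOverlap I p q) :
    (extChartAt I q).symm (chartChange I p q z) = (extChartAt I p).symm z :=
  (extChartAt I q).left_inv ((mem_chartOverlap I).1 hz).2

theorem mem_chartOverlap_symm {p : N} {z : E} (hz : z ∈ (extChartAt I p).target) :
    z ∈ chartOverlap I p ((extChartAt I p).symm z) :=
  (mem_chartOverlap I).2 ⟨hz, mem_extChartAt_source _⟩

variable [I.Boundaryless]

theorem isOpen_chartOverlap (p q : N) : IsOpen (chartOverlap I p q) := by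
  have : chartOverlap I p q =
      (extChartAt I p).target ∩ (extChartAt I p).symm ⁻¹' (extChartAt I q).source :=
    Set.ext fun z => mem_chartOverlap I
  rw [this]
  exact (continuousOn_extChartAt_symm p).isOpen_inter_preimage (isOpen_extChartAt_target p)
    (isOpen_extChartAt_source q)

theorem localFun_chartChange_eventuallyEq {p q : N} {z : E} {f : N → ℝ} (hz : z ∈ chartOverlap I p q) :
    localFun I f p =ᶠ[𝓝 z] fun w => localFun I f q (chartChange I p q w) := by
  filter_upwards [(isOpen_chartOverlap I p q).mem_nhds hz] with w hw
  rw [localFun, localFun, symm_chartChange I hw]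

variable [IsManifold I ∞ N]

omit [I.Boundaryless] in
theorem contDiffOn_chartChange (p q : N) :
    ContDiffOn ℝ ∞ (chartChange I p q) (chartOverlap I p q) :=
  contDiffOn_ext_coord_change q p

theorem fderiv_chartChange_comp {p q r : N} {z : E} (hz : z ∈ chartOverlap I p q)
    (hr : (extChartAt I p).symm z ∈ (extChartAt I r).source) :
    fderiv ℝ (chartChange I p r) z =
      fderiv ℝ (chartChange I q r) (chartChange I p q z) ∘L fderiv ℝ (chartChange I p q) z := by
  have h1 : chartChange I p q z ∈ chartOverlap I q r :=
    (mem_chartOverlap I).2 ⟨chartChange_mem I hz, by rwa [symm_chartChange I hz]⟩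
  have d1 := differentiableAt_of_contDiffOn (isOpen_chartOverlap I q r)
    (contDiffOn_chartChange I q r) h1
  have d2 := differentiableAt_of_contDiffOn (isOpen_chartOverlap I p q)
    (contDiffOn_chartChange I p q) hz
  have h2 : chartChange I p r =ᶠ[𝓝 z] chartChange I q r ∘ chartChange I p q := by
    filter_upwards [(isOpen_chartOverlap I p q).mem_nhds hz] with w hw
    simp only [Function.comp_apply]
    rw [chartChange, chartChange, symm_chartChange I hw]
  rw [h2.fderiv_eq, fderiv_comp z d1 d2]

omit [IsManifold I ∞ N] in
theorem fderiv_chartChange_self {p : N} {z : E} (hz : z ∈ (extChartAt I p).target) :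
    fderiv ℝ (chartChange I p p) z = ContinuousLinearMap.id ℝ E := by
  have h : chartChange I p p =ᶠ[𝓝 z] fun w => w := by
    filter_upwards [(isOpen_extChartAt_target (I := I) p).mem_nhds hz] with w hw
    exact (extChartAt I p).right_inv hw
  rw [h.fderiv_eq, fderiv_fun_id]

theorem isInvertible_fderiv_chartChange {p q : N} {z : E} (hz : z ∈ chartOverlap I p q) :
    (fderiv ℝ (chartChange I p q) z).IsInvertible := by
  have hz' := (mem_chartOverlap I).1 hz
  have hz2 : chartChange I p q z ∈ chartOverlap I q p :=
    (mem_chartOverlap I).2 ⟨chartChange_mem I hz, by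
      rw [symm_chartChange I hz]; exact (extChartAt I p).map_target hz'.1⟩
  have h1 := fderiv_chartChange_comp I hz (r := p) ((extChartAt I p).map_target hz'.1)
  have h2 := fderiv_chartChange_comp I hz2 (r := q) (by rw [symm_chartChange I hz]; exact hz'.2)
  have h3 : chartChange I q p (chartChange I p q z) = z := by
    rw [chartChange, symm_chartChange I hz]
    exact (extChartAt I p).right_inv hz'.1
  rw [fderiv_chartChange_self I hz'.1] at h1
  rw [fderiv_chartChange_self I (chartChange_mem I hz), h3] at h2
  exact ContinuousLinearMap.IsInvertible.of_inverse h2.symm h1.symm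

/-- Tangent vectors at a point are given by components in its own preferred chart, so the derivative
of an inverse chart is that of a change of charts. -/
theorem mfderiv_extChartAt_symm {p : N} {z : E} (hz : z ∈ (extChartAt I p).target) :
    (mfderiv 𝓘(ℝ, E) I (extChartAt I p).symm z : E →L[ℝ] E) =
      fderiv ℝ (chartChange I p ((extChartAt I p).symm z)) z := by
  have h1 : MDifferentiableAt 𝓘(ℝ, E) I (extChartAt I p).symm z :=
    ((contMDiffOn_extChartAt_symm (n := ∞) p).contMDiffAt
      ((isOpen_extChartAt_target (I := I) p).mem_nhds hz)).mdifferentiableAt (by simp)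
  rw [h1.mfderiv]
  simp only [modelWithCornersSelf_coe, range_id, fderivWithin_univ]
  rfl

variable (h : ∀ p : N, TangentSpace I p →L[ℝ] TangentSpace I p →L[ℝ] ℝ)

/-- A field of bilinear forms, the tangent spaces being identified with the model space. -/
def modelForm (p : N) : E →L[ℝ] E →L[ℝ] ℝ := h p

theorem localMetric_apply {p r : N} {z : E} (hz : z ∈ (extChartAt I p).target)
    (hr : (extChartAt I p).symm z = r) (X Y : E) :
    localMetric I h p z X Y = modelForm I h r (fderiv ℝ (chartChange I p r) z X)
      (fderiv ℝ (chartChange I p r) z Y) := by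
  subst hr
  rw [← mfderiv_extChartAt_symm I hz]
  rfl

theorem localMetric_center (p : N) : localMetric I h p (extChartAt I p p) = modelForm I h p := by
  ext X Y
  rw [localMetric_apply I h (mem_extChartAt_target p) (extChartAt_to_inv p),
    fderiv_chartChange_self I (mem_extChartAt_target p)]
  rfl

theorem localMetric_chartChange {p q : N} {z : E} (hz : z ∈ chartOverlap I p q) (X Y : E) :
    localMetric I h p z X Y = localMetric I h q (chartChange I p q z)
      (fderiv ℝ (chartChange I p q) z X) (fderiv ℝ (chartChange I p q) z Y) := by
  rw [localMetric_apply I h ((mem_chartOverlap I).1 hz).1 rfl,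
    localMetric_apply I h (chartChange_mem I hz) (symm_chartChange I hz),
    fderiv_chartChange_comp I hz (mem_extChartAt_source _)]
  rfl

section Naturality

variable [FiniteDimensional ℝ E] {h} {f : N → ℝ}
  (hM : ∀ p, IsMetricOn (localMetric I h p) (extChartAt I p).target)
  (hf : ∀ p, ContDiffOn ℝ ∞ (localFun I f p) (extChartAt I p).target)
include hM

theorem isPullbackOn_localMetric (p q : N) :
    IsPullbackOn (localMetric I h p) (localMetric I h q) (chartChange I p q) (chartOverlap I p q)
      (extChartAt I q).target :=
  (hM q).isPullbackOn (isOpen_chartOverlap I p q) (contDiffOn_chartChange I p q)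
    (fun _ hz => chartChange_mem I hz) (fun _ hz => isInvertible_fderiv_chartChange I hz)
    (fun _ hz X Y => localMetric_chartChange I h hz X Y)

theorem riemann_localMetric_eq_zero (hflat : IsFlat I h) {p : N} {z : E}
    (hz : z ∈ (extChartAt I p).target) : riemann (localMetric I h p) z = 0 := by
  ext X Y Z
  have hz' := mem_chartOverlap_symm I hz
  have h1 := isPullbackOn_localMetric I hM p ((extChartAt I p).symm z)
  refine (h1.invertible z hz').injective ?_
  have h2 : riemann (localMetric I h ((extChartAt I p).symm z))
    (chartChange I p ((extChartAt I p).symm z) z) = 0 := hflat ((extChartAt I p).symm z)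
  rw [h1.map_riemann hz', h2]
  simp

include hf

/-- `weightedP` at `r` is computed in the chart at `r`, the left side in the chart at `p`;
naturality identifies them. Without this `g_u`, which varies from point to point, could not be
differentiated in a single chart. -/
theorem localP_eq_weightedP (lam : ℝ) {p : N} {z : E} (hz : z ∈ (extChartAt I p).target)
    {r : N} (hr : (extChartAt I p).symm z = r) (X Y : E) :
    localP (localMetric I h p) (localFun I f p) lam z X Y =
      modelForm I (weightedP I h f lam) r (fderiv ℝ (chartChange I p r) z X)
        (fderiv ℝ (chartChange I p r) z Y) := by
  have hz' := mem_chartOverlap_symm I hz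
  rw [hr] at hz'
  have h1 := isPullbackOn_localMetric I hM p r
  have h2 := h1.localP_eq (hf r) hz' lam X Y
  have h3 : localP (localMetric I h p) (localFun I f p) lam z =
      localP (localMetric I h p) (fun w => localFun I f r (chartChange I p r w)) lam z := by
    rw [localP, localP, hessian_congr (EventuallyEq.refl _ _)
      (localFun_chartChange_eventuallyEq I hz')]
  have h4 : chartChange I p r z = extChartAt I r r := by rw [chartChange, hr]
  rw [h3, h2, localP, h4, localMetric_center]
  rfl

theorem localY_eq_weightedY (lam : ℝ) {p : N} {z : E} (hz : z ∈ (extChartAt I p).target)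
    {r : N} (hr : (extChartAt I p).symm z = r) :
    localY (localMetric I h p) (localFun I f p) lam z = weightedY I h f lam r := by
  have hz' := mem_chartOverlap_symm I hz
  rw [hr] at hz'
  have h1 := isPullbackOn_localMetric I hM p r
  have h2 := h1.localY_eq (hf r) hz' lam
  have hfe := localFun_chartChange_eventuallyEq I (f := f) hz'
  have h3 : localY (localMetric I h p) (localFun I f p) lam z =
      localY (localMetric I h p) (fun w => localFun I f r (chartChange I p r w)) lam z := by
    rw [localY, localY, gradSq_congr (EventuallyEq.refl _ _) hfe, hfe.eq_of_nhds]
  have h4 : chartChange I p r z = extChartAt I r r := by rw [chartChange, hr]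
  have h5 : localFun I f r (extChartAt I r r) = f r := by rw [localFun, extChartAt_to_inv]
  rw [h3, h2, localY, h4, localMetric_center, h5]
  rfl

theorem metricSquare_eq_weightedPSq (lam : ℝ) {p : N} {z : E}
    (hz : z ∈ (extChartAt I p).target) {r : N} (hr : (extChartAt I p).symm z = r) (X Y : E) :
    metricSquare (localMetric I h p z) (localP (localMetric I h p) (localFun I f p) lam z) X Y =
      modelForm I (weightedPSq I h f lam) r (fderiv ℝ (chartChange I p r) z X)
        (fderiv ℝ (chartChange I p r) z Y) := by
  have hz' := mem_chartOverlap_symm I hz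
  rw [hr] at hz'
  have hK : (modelForm I h r).IsInvertible := by
    rw [← localMetric_center I h r]
    exact (hM r).invertible _ (mem_extChartAt_target r)
  have h1 := metricSquare_pullback (P := modelForm I (weightedP I h f lam) r) hK (isInvertible_fderiv_chartChange I hz')
    (fun X Y => localMetric_apply I h hz hr X Y)
    (fun X Y => localP_eq_weightedP I hM hf lam hz hr X Y) X Y
  have h2 : modelForm I (weightedPSq I h f lam) r =
    metricSquare (modelForm I h r) (modelForm I (weightedP I h f lam) r) := rfl
  rw [h1, h2]

theorem localMetric_metricFamily (lam u : ℝ) {p : N} {z : E} (hz : z ∈ (extChartAt I p).target) :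
    localMetric I (metricFamily I h f lam u) p z =
      localMetric I h p z + (2 * u) • localP (localMetric I h p) (localFun I f p) lam z
        + u ^ 2 • metricSquare (localMetric I h p z)
          (localP (localMetric I h p) (localFun I f p) lam z) := by
  ext X Y
  rw [localMetric_apply I _ hz rfl]
  simp only [add_apply, smul_apply]
  rw [localMetric_apply I _ hz rfl, localP_eq_weightedP I hM hf lam hz rfl,
    metricSquare_eq_weightedPSq I hM hf lam hz rfl]
  rfl

theorem isSolitonOrFlatOn_local (lam : ℝ) (hs : IsGradientRicciSoliton I h f lam ∨ IsFlat I h)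
    (p : N) :
    IsSolitonOrFlatOn (localMetric I h p) (localFun I f p) lam (extChartAt I p).target := by
  refine ⟨hM p, hf p, hs.imp (fun hs z hz => ?_) fun hs z hz =>
    riemann_localMetric_eq_zero I hM hs hz⟩
  ext X Y
  have h1 : modelForm I (weightedP I h f lam) ((extChartAt I p).symm z) = 0 := hs _
  rw [localP_eq_weightedP I hM hf lam hz rfl, h1]
  rfl

end Naturality

end Charts

/-! ### Smoothness of tensor fields as bundle sections and in charts. -/

section Sections

variable {E : Type*} [NormedAddCommGroup E] [NormedSpace ℝ E]
  {H : Type*} [TopologicalSpace H] (I : ModelWithCorners ℝ E H) [I.Boundaryless]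
  {N : Type*} [TopologicalSpace N] [ChartedSpace H N] [IsManifold I ∞ N]

theorem contMDiffAt_comp_extChartAt_iff {F : Type*} [NormedAddCommGroup F] [NormedSpace ℝ F]
    {c : E → F} {p : N} :
    ContMDiffAt I 𝓘(ℝ, F) ∞ (fun q => c (extChartAt I p q)) p ↔
      ContDiffAt ℝ ∞ c (extChartAt I p p) := by
  refine ⟨fun hc => ?_, fun hc => ?_⟩
  · have h1 : ContMDiffAt 𝓘(ℝ, E) I ∞ (extChartAt I p).symm (extChartAt I p p) :=
      (contMDiffOn_extChartAt_symm p).contMDiffAt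
        ((isOpen_extChartAt_target (I := I) p).mem_nhds (mem_extChartAt_target p))
    have h2 : ContMDiffAt 𝓘(ℝ, E) 𝓘(ℝ, F) ∞
        ((fun q => c (extChartAt I p q)) ∘ (extChartAt I p).symm) (extChartAt I p p) :=
      ContMDiffAt.comp _ (by rwa [extChartAt_to_inv]) h1
    refine h2.contDiffAt.congr_of_eventuallyEq ?_
    filter_upwards [(isOpen_extChartAt_target (I := I) p).mem_nhds (mem_extChartAt_target p)]
      with w hw
    simp only [Function.comp_apply]
    rw [(extChartAt I p).right_inv hw]
  · exact hc.contMDiffAt.comp p contMDiffAt_extChartAt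

variable (h : ∀ p : N, TangentSpace I p →L[ℝ] TangentSpace I p →L[ℝ] ℝ)

/-- A field of bilinear forms is smooth at `p` if and only if its expression in the preferred chart
at `p` is. -/
theorem contMDiffAt_form_iff (p : N) :
    ContMDiffAt I (I.prod 𝓘(ℝ, E →L[ℝ] E →L[ℝ] ℝ)) ∞
      (fun q : N => TotalSpace.mk' (E →L[ℝ] E →L[ℝ] ℝ)
        (E := fun q : N => TangentSpace I q →L[ℝ] TangentSpace I q →L[ℝ] ℝ) q (h q)) p ↔
      ContDiffAt ℝ ∞ (localMetric I h p) (extChartAt I p p) := by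
  rw [contMDiffAt_section, ← contMDiffAt_comp_extChartAt_iff I]
  refine Filter.EventuallyEq.contMDiffAt_iff ?_
  filter_upwards [chart_source_mem_nhds H p] with q hq
  have hq' : q ∈ (extChartAt I p).source := by rwa [extChartAt_source]
  ext X Y
  rw [hom_trivializationAt_apply]
  have h1 := inCoordinates_apply_eq₂ (𝕜 := ℝ) (F₁ := E) (F₂ := E) (F₃ := ℝ)
    (E₁ := fun q : N => TangentSpace I q) (E₂ := fun q : N => TangentSpace I q)
    (E₃ := Bundle.Trivial N ℝ) (x₀ := p) (x := q) (ϕ := h q) (v := X) (w := Y)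
    (by simpa using hq) (by simpa using hq) (by simp)
  refine h1.trans ?_
  -- The fibre at `q` of the trivialization centred at `p` is inverted by the derivative of the
  -- change of charts from `p` to `q`.
  have h2 (X : E) : (trivializationAt E (TangentSpace I) p).symm q X =
      fderiv ℝ (chartChange I p q) (extChartAt I p q) X := by
    have h3 := TangentBundle.symmL_trivializationAt_eq_core (I := I) (𝕜 := ℝ) (b₀ := p) (b := q) hq
    rw [tangentBundleCore_coordChange_achart, I.range_eq_univ, fderivWithin_univ] at h3
    have h4 := (trivializationAt E (TangentSpace I) p).symmL_apply (R := ℝ) (b := q)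
      (by simpa using hq) X
    exact h4.symm.trans (congrArg (fun A : E →L[ℝ] E => A X) h3)
  rw [localMetric_apply I h ((extChartAt I p).map_source hq') ((extChartAt I p).left_inv hq'),
    ← h2 X, ← h2 Y]
  simp
  rfl

/-- `contMDiffAt_form_iff` speaks only of the centre of a preferred chart; at any other point of the
target the chart centred there is used and the result transported by the change of charts. -/
theorem contDiffOn_localMetric (hs : ContMDiff I (I.prod 𝓘(ℝ, E →L[ℝ] E →L[ℝ] ℝ)) ∞
      (fun q : N => TotalSpace.mk' (E →L[ℝ] E →L[ℝ] ℝ)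
        (E := fun q : N => TangentSpace I q →L[ℝ] TangentSpace I q →L[ℝ] ℝ) q (h q)))
    [FiniteDimensional ℝ E] (p : N) :
    ContDiffOn ℝ ∞ (localMetric I h p) (extChartAt I p).target := by
  refine contDiffOn_clm_apply.2 fun X => contDiffOn_clm_apply.2 fun Y => fun z hz => ?_
  have hz' := mem_chartOverlap_symm I hz
  set q := (extChartAt I p).symm z with hq
  have h1 : ContDiffAt ℝ ∞ (localMetric I h q) (chartChange I p q z) :=
    (contMDiffAt_form_iff I h q).1 (hs q)
  have hn := (isOpen_chartOverlap I p q).mem_nhds hz'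
  have hΨ := (contDiffOn_chartChange I p q).contDiffAt hn
  have hD := (contDiffOn_fderiv (isOpen_chartOverlap I p q)
    (contDiffOn_chartChange I p q)).contDiffAt hn
  have h2 : ContDiffAt ℝ ∞ (fun w => localMetric I h q (chartChange I p q w)) z := h1.comp z hΨ
  refine ContDiffAt.contDiffWithinAt ?_
  refine ((h2.clm_apply (hD.clm_apply (contDiffAt_const (c := X)))).clm_apply
    (hD.clm_apply (contDiffAt_const (c := Y)))).congr_of_eventuallyEq ?_
  filter_upwards [hn] with w hw using localMetric_chartChange I h hw X Y

omit [I.Boundaryless] in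
theorem contDiffOn_localFun {f : N → ℝ} (hf : ContMDiff I 𝓘(ℝ, ℝ) ∞ f) (p : N) :
    ContDiffOn ℝ ∞ (localFun I f p) (extChartAt I p).target :=
  (hf.comp_contMDiffOn (contMDiffOn_extChartAt_symm p)).contDiffOn

end Sections

/-! ### Product charts on `ℝ × M × ℝ`. -/

section AmbientCharts

variable {n : ℕ} {M : Type*} [TopologicalSpace M] [ChartedSpace (EuclideanSpace ℝ (Fin n)) M]

theorem extChartAt_ambient_apply (p q : ℝ × M × ℝ) :
    extChartAt (ambientModel n) p q = (q.1, extChartAt (𝓡 n) p.2.1 q.2.1, q.2.2) := by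
  simp only [extChartAt_prod]
  rfl

theorem extChartAt_ambient_symm_apply (p : ℝ × M × ℝ) (z : ℝ × EuclideanSpace ℝ (Fin n) × ℝ) :
    (extChartAt (ambientModel n) p).symm z =
      (z.1, (extChartAt (𝓡 n) p.2.1).symm z.2.1, z.2.2) := by
  simp only [extChartAt_prod]
  rfl

theorem mem_extChartAt_ambient_target {p : ℝ × M × ℝ} {z : ℝ × EuclideanSpace ℝ (Fin n) × ℝ} :
    z ∈ (extChartAt (ambientModel n) p).target ↔ z.2.1 ∈ (extChartAt (𝓡 n) p.2.1).target := by
  simp only [extChartAt_prod, PartialEquiv.prod_target, Set.mem_prod, extChartAt_model_space_eq_id,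
    PartialEquiv.refl_target, mem_univ, true_and, and_true]

theorem mem_extChartAt_ambient_source {p q : ℝ × M × ℝ} :
    q ∈ (extChartAt (ambientModel n) p).source ↔ q.2.1 ∈ (extChartAt (𝓡 n) p.2.1).source := by
  simp only [extChartAt_prod, PartialEquiv.prod_source, Set.mem_prod, extChartAt_model_space_eq_id,
    PartialEquiv.refl_source, mem_univ, true_and, and_true]

theorem chartChange_ambient (p q : ℝ × M × ℝ) :
    chartChange (ambientModel n) p q = fun z : ℝ × EuclideanSpace ℝ (Fin n) × ℝ =>
      (z.1, chartChange (𝓡 n) p.2.1 q.2.1 z.2.1, z.2.2) := by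
  funext z
  rw [chartChange, extChartAt_ambient_symm_apply, extChartAt_ambient_apply]
  rfl

theorem modelForm_normalMetric
    (gu : ℝ → ∀ x : M, TangentSpace (𝓡 n) x →L[ℝ] TangentSpace (𝓡 n) x →L[ℝ] ℝ)
    (p : ℝ × M × ℝ) :
    modelForm (ambientModel n) (normalMetric gu) p =
      lorentzSum (modelForm (𝓡 n) (gu p.2.2) p.2.1) := rfl

variable [IsManifold (𝓡 n) ∞ M]

theorem fderiv_chartChange_ambient {p q : ℝ × M × ℝ} {z : ℝ × EuclideanSpace ℝ (Fin n) × ℝ}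
    (hz : z.2.1 ∈ chartOverlap (𝓡 n) p.2.1 q.2.1) (X : ℝ × EuclideanSpace ℝ (Fin n) × ℝ) :
    fderiv ℝ (chartChange (ambientModel n) p q) z X =
      (X.1, fderiv ℝ (chartChange (𝓡 n) p.2.1 q.2.1) z.2.1 X.2.1, X.2.2) := by
  have d1 := hasFDerivAt_comp_dxL (isOpen_chartOverlap (𝓡 n) p.2.1 q.2.1)
    (contDiffOn_chartChange (𝓡 n) p.2.1 q.2.1) hz
  have du : HasFDerivAt (fun p : ℝ × EuclideanSpace ℝ (Fin n) × ℝ => p.2.2)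
    (duL (EuclideanSpace ℝ (Fin n))) z := (duL (EuclideanSpace ℝ (Fin n))).hasFDerivAt
  have dv : HasFDerivAt (fun p : ℝ × EuclideanSpace ℝ (Fin n) × ℝ => p.1)
    (dvL (EuclideanSpace ℝ (Fin n))) z := (dvL (EuclideanSpace ℝ (Fin n))).hasFDerivAt
  rw [chartChange_ambient, (dv.prodMk (d1.prodMk du)).fderiv]
  rfl

theorem localMetric_normalMetric
    (gu : ℝ → ∀ x : M, TangentSpace (𝓡 n) x →L[ℝ] TangentSpace (𝓡 n) x →L[ℝ] ℝ)
    (p : ℝ × M × ℝ) {z : ℝ × EuclideanSpace ℝ (Fin n) × ℝ}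
    (hz : z.2.1 ∈ (extChartAt (𝓡 n) p.2.1).target) :
    localMetric (ambientModel n) (normalMetric gu) p z =
      lorentzSum (localMetric (𝓡 n) (gu z.2.2) p.2.1 z.2.1) := by
  refine ContinuousLinearMap.ext fun X => ContinuousLinearMap.ext fun Y => ?_
  have h1 := extChartAt_ambient_symm_apply p z
  have h2 := fderiv_chartChange_ambient (p := p) (z := z)
    (q := (z.1, (extChartAt (𝓡 n) p.2.1).symm z.2.1, z.2.2)) (mem_chartOverlap_symm (𝓡 n) hz)
  rw [localMetric_apply (ambientModel n) (normalMetric gu)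
    (mem_extChartAt_ambient_target.2 hz) h1, modelForm_normalMetric, h2, h2, lorentzSum_apply,
    lorentzSum_apply, localMetric_apply (𝓡 n) (gu z.2.2) hz rfl]

set_option maxHeartbeats 1000000 in
theorem contDiffOn_localMetric_inner (g : SmoothMetric n M) (x : M) :
    ContDiffOn ℝ ∞ (localMetric (𝓡 n) g.inner x) (extChartAt (𝓡 n) x).target := by
  have h1 := g.contMDiff
  have h2 := contDiffOn_localMetric (N := M) (𝓡 n) g.inner
  exact h2 h1 x

/-- A smooth Riemannian metric in a chart. -/
theorem isMetricOn_localMetric (g : SmoothMetric n M) (x : M) :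
    IsMetricOn (localMetric (𝓡 n) g.inner x) (extChartAt (𝓡 n) x).target where
  isOpen := isOpen_extChartAt_target x
  contDiffOn := contDiffOn_localMetric_inner g x
  symm := fun z hz X Y => by
    rw [localMetric_apply (𝓡 n) g.inner hz rfl, localMetric_apply (𝓡 n) g.inner hz rfl]
    exact g.symm _ _ _
  invertible := fun z hz => by
    refine isInvertible_of_injective finrank_dual_eq fun X hX => ?_
    have h1 : localMetric (𝓡 n) g.inner x z X X = 0 := by rw [hX]; rfl
    rw [localMetric_apply (𝓡 n) g.inner hz rfl] at h1
    refine (isInvertible_fderiv_chartChange (𝓡 n) (mem_chartOverlap_symm (𝓡 n) hz)).injective ?_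
    rw [map_zero]
    by_contra h2
    exact (g.pos _ _ h2).ne' h1

section

variable (g : SmoothMetric n M) {φ : M → ℝ} (hφ : ContMDiff (𝓡 n) 𝓘(ℝ, ℝ) ∞ φ) (lam : ℝ)
include hφ

theorem localMetric_ambient (p : ℝ × M × ℝ) {z : ℝ × EuclideanSpace ℝ (Fin n) × ℝ}
    (hz : z.2.1 ∈ (extChartAt (𝓡 n) p.2.1).target) :
    localMetric (ambientModel n) (normalMetric (metricFamily (𝓡 n) g.inner φ lam)) p z =
      ambientMetric (localMetric (𝓡 n) g.inner p.2.1) (localFun (𝓡 n) φ p.2.1) lam z := by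
  rw [localMetric_normalMetric _ p hz, localMetric_metricFamily (𝓡 n) (isMetricOn_localMetric g)
    (contDiffOn_localFun (𝓡 n) hφ) lam z.2.2 hz]
  rfl

theorem localFun_ambient (p : ℝ × M × ℝ) {z : ℝ × EuclideanSpace ℝ (Fin n) × ℝ}
    (hz : z.2.1 ∈ (extChartAt (𝓡 n) p.2.1).target) :
    localFun (ambientModel n) (normalPotential (potentialFamily (𝓡 n) g.inner φ lam) lam) p z =
      ambientPotential (localMetric (𝓡 n) g.inner p.2.1) (localFun (𝓡 n) φ p.2.1) lam z := by
  rw [localFun, extChartAt_ambient_symm_apply, ambientPotential,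
    localY_eq_weightedY (𝓡 n) (isMetricOn_localMetric g) (contDiffOn_localFun (𝓡 n) hφ) lam hz rfl]
  rfl

/-- The chart may be centred at any `x` whose domain contains the point. This freedom makes
nondegeneracy an open condition. -/
theorem nondegenerate_iff (h : IsGradientRicciSoliton (𝓡 n) g.inner φ lam ∨ IsFlat (𝓡 n) g.inner)
    (x : M) {p : ℝ × M × ℝ} (hp : p.2.1 ∈ (extChartAt (𝓡 n) x).source) :
    (∀ X : TangentSpace (𝓡 n) p.2.1, (∀ Y : TangentSpace (𝓡 n) p.2.1,
      metricFamily (𝓡 n) g.inner φ lam p.2.2 p.2.1 X Y = 0) → X = 0) ↔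
    (p.1, extChartAt (𝓡 n) x p.2.1, p.2.2) ∈ ambientDomain (localMetric (𝓡 n) g.inner x)
      (localFun (𝓡 n) φ x) lam (extChartAt (𝓡 n) x).target := by
  have hz := (extChartAt (𝓡 n) x).map_source hp
  have hr := (extChartAt (𝓡 n) x).left_inv hp
  have hs := isSolitonOrFlatOn_local (𝓡 n) (isMetricOn_localMetric g)
    (contDiffOn_localFun (𝓡 n) hφ) lam h x
  have hl := localMetric_metricFamily (𝓡 n) (isMetricOn_localMetric g)
    (contDiffOn_localFun (𝓡 n) hφ) lam p.2.2 hz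
  have hov := mem_chartOverlap_symm (𝓡 n) hz
  rw [hr] at hov
  have hT := isInvertible_fderiv_chartChange (𝓡 n) hov
  have ha := localMetric_apply (𝓡 n) (metricFamily (𝓡 n) g.inner φ lam p.2.2) hz hr
  refine ⟨fun hnd => hs.mem_ambientDomain hz fun ξ hξ => ?_, fun hmem X hX => ?_⟩
  · simp only at hξ
    rw [← hl] at hξ
    refine hT.injective ?_
    rw [map_zero]
    refine hnd _ fun Y' => ?_
    obtain ⟨Y, rfl⟩ := hT.surjective Y'
    have := hξ Y
    rwa [ha] at this
  · obtain ⟨ξ, rfl⟩ := hT.surjective X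
    have h0 : ξ = 0 := hs.nondegenerate_of_mem hmem fun η => by
      simp only
      rw [← hl, ha]
      exact hX _
    rw [h0]
    exact map_zero _

end

end AmbientCharts

/-! ### Lorentzian signature. -/

section Signature

variable {E : Type*} [NormedAddCommGroup E] [NormedSpace ℝ E] [FiniteDimensional ℝ E]

theorem exists_orthonormal_basis {B : E →L[ℝ] E →L[ℝ] ℝ} (hsymm : ∀ X Y, B X Y = B Y X)
    (hpos : ∀ X, X ≠ 0 → 0 < B X X) :
    ∃ e : Module.Basis (Fin (Module.finrank ℝ E)) ℝ E,
      ∀ i j, B (e i) (e j) = if i = j then 1 else 0 := by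
  let B' : LinearMap.BilinForm ℝ E := LinearMap.mk₂ ℝ (fun X Y => B X Y)
    (fun X X' Y => by simp) (fun c X Y => by simp) (fun X Y Y' => by simp) (fun c X Y => by simp)
  obtain ⟨e, he⟩ := LinearMap.BilinForm.exists_orthogonal_basis (B := B') ⟨fun X Y => hsymm X Y⟩
  have hp (i) : 0 < B (e i) (e i) := hpos _ (e.ne_zero i)
  refine ⟨e.isUnitSMul (w := fun i => (√(B (e i) (e i)))⁻¹) fun i =>
    isUnit_iff_ne_zero.2 (inv_ne_zero (Real.sqrt_pos.2 (hp i)).ne'), fun i j => ?_⟩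
  simp only [Module.Basis.isUnitSMul_apply, map_smul, smul_apply, smul_eq_mul]
  split_ifs with hij
  · subst hij
    have h1 := (Real.sqrt_pos.2 (hp i)).ne'
    field_simp
    exact (Real.sq_sqrt (hp i).le).symm
  · have h1 : B (e i) (e j) = 0 := he hij
    rw [h1, mul_zero, mul_zero]

/-- `2 du dv + B` is Lorentzian if `B` is positive definite. -/
theorem hasSignature_lorentzSum {B : E →L[ℝ] E →L[ℝ] ℝ} (hsymm : ∀ X Y, B X Y = B Y X)
    (hpos : ∀ X, X ≠ 0 → 0 < B X X) {n : ℕ} (hn : Module.finrank ℝ E = n) :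
    HasSignature (fun X Y => lorentzSum B X Y) (n + 1) 1 := by
  subst hn
  obtain ⟨e, he⟩ := exists_orthonormal_basis hsymm hpos
  -- The null plane of `v` and `u` is diagonalized by `∂_v ± (1/2) ∂_u`, whose squares are `±1`.
  let w : Fin (Module.finrank ℝ E + 1) ⊕ Fin 1 → ℝ × E × ℝ :=
    Sum.elim (Fin.cons (1, 0, 1 / 2) fun i => (0, e i, 0)) fun _ => (1, 0, -(1 / 2))
  have hw (i j) : lorentzSum B (w i) (w j) =
      if i = j then Sum.elim (fun _ => (1 : ℝ)) (fun _ => (-1 : ℝ)) i else 0 := by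
    rcases i with i | i <;> rcases j with j | j
    · refine Fin.cases ?_ (fun i => ?_) i <;> refine Fin.cases ?_ (fun j => ?_) j
      · norm_num [w, lorentzSum_apply]
      · simp [w, lorentzSum_apply, (Fin.succ_ne_zero j).symm]
      · simp [w, lorentzSum_apply]
      · simp [w, lorentzSum_apply, he]
    · refine Fin.cases ?_ (fun i => ?_) i <;> simp [w, lorentzSum_apply]
    · refine Fin.cases ?_ (fun i => ?_) j <;> simp [w, lorentzSum_apply]
    · norm_num [w, lorentzSum_apply, Subsingleton.elim i j]
  let K : LinearMap.BilinForm ℝ (ℝ × E × ℝ) := LinearMap.mk₂ ℝ (fun X Y => lorentzSum B X Y)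
    (fun X X' Y => by simp) (fun c X Y => by simp) (fun X Y Y' => by simp) (fun c X Y => by simp)
  have hli : LinearIndependent ℝ w := by
    refine LinearMap.linearIndependent_of_isOrthoᵢ (B := K)
      (LinearMap.isOrthoᵢ_def.2 fun i j hij => ?_) fun i => ?_
    · exact (hw i j).trans (if_neg hij)
    · have h1 : K (w i) (w i) = _ := (hw i i).trans (if_pos rfl)
      rw [h1]
      rcases i with i | i <;> norm_num
  refine ⟨basisOfLinearIndependentOfCardEqFinrank hli ?_, fun i j => ?_⟩
  · simp only [Fintype.card_sum, Fintype.card_fin, Module.finrank_prod, Module.finrank_self]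
    ring
  · simp only [coe_basisOfLinearIndependentOfCardEqFinrank, hw]

theorem HasSignature.pullback {V W : Type*} [AddCommGroup V] [Module ℝ V] [AddCommGroup W]
    [Module ℝ W] {B : W → W → ℝ} {a b : ℕ} (h : HasSignature B a b) (T : V ≃ₗ[ℝ] W) :
    HasSignature (fun X Y => B (T X) (T Y)) a b := by
  obtain ⟨e, he⟩ := h
  exact ⟨e.map T.symm, fun i j => by simp [he]⟩

theorem IsSolitonOrFlatOn.ambient_hasSignature {G : E → E →L[ℝ] E →L[ℝ] ℝ} {f : E → ℝ} {lam : ℝ}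
    {U : Set E} (h : IsSolitonOrFlatOn G f lam U) {p : ℝ × E × ℝ}
    (hp : p ∈ ambientDomain G f lam U) (hpos : ∀ X, X ≠ 0 → 0 < G p.2.1 X X) {n : ℕ}
    (hn : Module.finrank ℝ E = n) :
    HasSignature (fun X Y => ambientMetric G f lam p X Y) (n + 1) 1 := by
  obtain ⟨T, hT⟩ := hp.2
  have h1 := (hasSignature_lorentzSum (h.metric.symm _ hp.1) hpos hn).pullback T.toLinearEquiv
  refine cast (congrArg (fun B => HasSignature B (n + 1) 1) ?_) h1
  funext X Y
  rw [h.ambientMetric_eq hp.1, ← hT]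
  rfl

end Signature

/-! ### The coordinate results transferred to `ℝ × M × ℝ`. -/

section AmbientInvariants

variable {n : ℕ} {M : Type*} [TopologicalSpace M] [ChartedSpace (EuclideanSpace ℝ (Fin n)) M]
  [IsManifold (𝓡 n) ∞ M]
  (g : SmoothMetric n M) {φ : M → ℝ} (hφ : ContMDiff (𝓡 n) 𝓘(ℝ, ℝ) ∞ φ) (lam : ℝ)

section

include hφ

theorem localMetric_ambient_eventuallyEq (p : ℝ × M × ℝ) :
    localMetric (ambientModel n) (normalMetric (metricFamily (𝓡 n) g.inner φ lam)) p
      =ᶠ[𝓝 (extChartAt (ambientModel n) p p)]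
    ambientMetric (localMetric (𝓡 n) g.inner p.2.1) (localFun (𝓡 n) φ p.2.1) lam := by
  filter_upwards [(isOpen_extChartAt_target (I := ambientModel n) p).mem_nhds
    (mem_extChartAt_target p)] with z hz
  exact localMetric_ambient g hφ lam p (mem_extChartAt_ambient_target.1 hz)

theorem localFun_ambient_eventuallyEq (p : ℝ × M × ℝ) :
    localFun (ambientModel n) (normalPotential (potentialFamily (𝓡 n) g.inner φ lam) lam) p
      =ᶠ[𝓝 (extChartAt (ambientModel n) p p)]
    ambientPotential (localMetric (𝓡 n) g.inner p.2.1) (localFun (𝓡 n) φ p.2.1) lam := by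
  filter_upwards [(isOpen_extChartAt_target (I := ambientModel n) p).mem_nhds
    (mem_extChartAt_target p)] with z hz
  exact localFun_ambient g hφ lam p (mem_extChartAt_ambient_target.1 hz)

theorem modelForm_ambient (p : ℝ × M × ℝ) :
    modelForm (ambientModel n) (normalMetric (metricFamily (𝓡 n) g.inner φ lam)) p =
      ambientMetric (localMetric (𝓡 n) g.inner p.2.1) (localFun (𝓡 n) φ p.2.1) lam
        (extChartAt (ambientModel n) p p) := by
  rw [← localMetric_center]
  exact (localMetric_ambient_eventuallyEq g hφ lam p).eq_of_nhds

end

/-- The points where `g_u` is nondegenerate. -/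
def nondegenerateSet (φ : M → ℝ) : Set (ℝ × M × ℝ) :=
  {p | ∀ X : TangentSpace (𝓡 n) p.2.1, (∀ Y : TangentSpace (𝓡 n) p.2.1,
    metricFamily (𝓡 n) g.inner φ lam p.2.2 p.2.1 X Y = 0) → X = 0}

variable {g lam} (h : IsGradientRicciSoliton (𝓡 n) g.inner φ lam ∨ IsFlat (𝓡 n) g.inner)
include hφ h

theorem isSolitonOrFlatOn_chart (x : M) : IsSolitonOrFlatOn (localMetric (𝓡 n) g.inner x)
    (localFun (𝓡 n) φ x) lam (extChartAt (𝓡 n) x).target :=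
  isSolitonOrFlatOn_local (𝓡 n) (isMetricOn_localMetric g) (contDiffOn_localFun (𝓡 n) hφ) lam h x

variable {p : ℝ × M × ℝ} (hp : p ∈ nondegenerateSet g lam φ)
include hp

theorem extChartAt_mem_ambientDomain :
    extChartAt (ambientModel n) p p ∈ ambientDomain (localMetric (𝓡 n) g.inner p.2.1)
      (localFun (𝓡 n) φ p.2.1) lam (extChartAt (𝓡 n) p.2.1).target := by
  rw [extChartAt_ambient_apply]
  exact (nondegenerate_iff g hφ lam h p.2.1 (mem_extChartAt_source p.2.1)).1 hp

theorem weightedP_ambient :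
    weightedP (ambientModel n) (normalMetric (metricFamily (𝓡 n) g.inner φ lam))
      (normalPotential (potentialFamily (𝓡 n) g.inner φ lam) lam) lam p = 0 := by
  have h1 := (isSolitonOrFlatOn_chart hφ h p.2.1).ambient_weightedP
    (extChartAt_mem_ambientDomain hφ h hp)
  rw [localP, ← modelForm_ambient g hφ lam p, ← ricci_congr (localMetric_ambient_eventuallyEq g hφ lam p),
    ← hessian_congr (localMetric_ambient_eventuallyEq g hφ lam p)
      (localFun_ambient_eventuallyEq g hφ lam p)] at h1
  exact h1

theorem weightedF_ambient :
    weightedF (ambientModel n) (normalMetric (metricFamily (𝓡 n) g.inner φ lam))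
      (normalPotential (potentialFamily (𝓡 n) g.inner φ lam) lam) lam p = 0 := by
  have h1 := (isSolitonOrFlatOn_chart hφ h p.2.1).ambient_weightedF
    (extChartAt_mem_ambientDomain hφ h hp)
  have h2 := localFun_ambient_eventuallyEq g hφ lam p
  rw [← modelForm_ambient g hφ lam p, ← hessian_congr (localMetric_ambient_eventuallyEq g hφ lam p) h2,
    ← gradSq_congr (localMetric_ambient_eventuallyEq g hφ lam p) h2, ← h2.eq_of_nhds, localFun,
    extChartAt_to_inv] at h1
  exact h1

theorem christoffelAt_ambient_v_v :
    christoffelAt (ambientModel n) (normalMetric (metricFamily (𝓡 n) g.inner φ lam)) p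
      ((1, 0, 0) : ℝ × EuclideanSpace ℝ (Fin n) × ℝ)
      ((1, 0, 0) : ℝ × EuclideanSpace ℝ (Fin n) × ℝ) =
      (0 : ℝ × EuclideanSpace ℝ (Fin n) × ℝ) := by
  have h1 := (isSolitonOrFlatOn_chart hφ h p.2.1).ambient_christoffel_v_v
    (extChartAt_mem_ambientDomain hφ h hp)
  rw [← christoffel_congr (localMetric_ambient_eventuallyEq g hφ lam p)] at h1
  exact h1

theorem christoffel_ambient_u_u :
    christoffel (localMetric (ambientModel n) (normalMetric (metricFamily (𝓡 n) g.inner φ lam)) p)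
      (extChartAt (ambientModel n) p p) (0, 0, 1) (0, 0, 1) = 0 := by
  have h1 := (isSolitonOrFlatOn_chart hφ h p.2.1).ambient_christoffel_u_u
    (extChartAt_mem_ambientDomain hφ h hp)
  rwa [← christoffel_congr (localMetric_ambient_eventuallyEq g hφ lam p)] at h1

theorem contMDiffAt_ambientMetric : ContMDiffAt (ambientModel n)
    ((ambientModel n).prod 𝓘(ℝ, (ℝ × EuclideanSpace ℝ (Fin n) × ℝ) →L[ℝ]
      (ℝ × EuclideanSpace ℝ (Fin n) × ℝ) →L[ℝ] ℝ)) ∞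
    (fun p : ℝ × M × ℝ => TotalSpace.mk' ((ℝ × EuclideanSpace ℝ (Fin n) × ℝ) →L[ℝ]
      (ℝ × EuclideanSpace ℝ (Fin n) × ℝ) →L[ℝ] ℝ)
      (E := fun p : ℝ × M × ℝ =>
        TangentSpace (ambientModel n) p →L[ℝ] TangentSpace (ambientModel n) p →L[ℝ] ℝ)
      p (normalMetric (metricFamily (𝓡 n) g.inner φ lam) p)) p := by
  refine (contMDiffAt_form_iff (ambientModel n) _ p).2 ?_
  have h1 := (isSolitonOrFlatOn_chart hφ h p.2.1).ambient_isMetricOn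
  exact (h1.contDiffOn.contDiffAt
    (h1.isOpen.mem_nhds (extChartAt_mem_ambientDomain hφ h hp))).congr_of_eventuallyEq
    (localMetric_ambient_eventuallyEq g hφ lam p)

theorem hasSignature_ambientMetric :
    HasSignature (fun X Y : TangentSpace (ambientModel n) p =>
      normalMetric (metricFamily (𝓡 n) g.inner φ lam) p X Y) (n + 1) 1 := by
  have hx := extChartAt_mem_ambientDomain hφ h hp
  have h1 := (isSolitonOrFlatOn_chart hφ h p.2.1).ambient_hasSignature hx (n := n)
    (fun X hX => by
      rw [extChartAt_ambient_apply, localMetric_center]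
      exact g.pos p.2.1 X hX) (by simp)
  rw [← modelForm_ambient g hφ lam p] at h1
  exact h1

omit hp in
theorem contMDiff_ambientPotential : ContMDiff (ambientModel n) 𝓘(ℝ, ℝ) ∞
    (normalPotential (potentialFamily (𝓡 n) g.inner φ lam) lam) := by
  intro p
  have h0 := isSolitonOrFlatOn_chart hφ h p.2.1
  have hm : (extChartAt (ambientModel n) p p).2.1 ∈ (extChartAt (𝓡 n) p.2.1).target :=
    mem_extChartAt_ambient_target.1 (mem_extChartAt_target p)
  have h1 := (h0.contDiffOn_ambientPotential.contDiffAt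
    (h0.isOpen_preimage.mem_nhds hm)).congr_of_eventuallyEq
    (localFun_ambient_eventuallyEq g hφ lam p)
  refine ((contMDiffAt_comp_extChartAt_iff (ambientModel n)).2 h1).congr_of_eventuallyEq ?_
  filter_upwards [extChartAt_source_mem_nhds (I := ambientModel n) p] with q hq
  rw [localFun, (extChartAt (ambientModel n) p).left_inv hq]

end AmbientInvariants

/-! ### Existence of admissible domains. -/

section Domains

variable {n : ℕ} {M : Type*} [TopologicalSpace M] [ChartedSpace (EuclideanSpace ℝ (Fin n)) M]
  [IsManifold (𝓡 n) ∞ M] {g : SmoothMetric n M} {φ : M → ℝ} {lam : ℝ}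

theorem metricFamily_zero : metricFamily (𝓡 n) g.inner φ lam 0 = g.inner := by
  funext x
  simp only [metricFamily, mul_zero, zero_smul, add_zero, ne_eq, OfNat.ofNat_ne_zero,
    not_false_eq_true, zero_pow]

theorem mem_nondegenerateSet_zero (v : ℝ) (x : M) : (v, x, 0) ∈ nondegenerateSet g lam φ := by
  intro X hX
  by_contra h1
  refine (g.pos x X h1).ne' ?_
  have h2 := hX X
  simp only [metricFamily_zero] at h2
  exact h2

/-- In a chart the condition becomes invertibility of the frame change, which is open. -/
theorem isOpen_nondegenerateSet (hφ : ContMDiff (𝓡 n) 𝓘(ℝ, ℝ) ∞ φ)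
    (h : IsGradientRicciSoliton (𝓡 n) g.inner φ lam ∨ IsFlat (𝓡 n) g.inner) :
    IsOpen (nondegenerateSet g lam φ) := by
  refine isOpen_iff_mem_nhds.2 fun p hp => ?_
  have h1 := (isSolitonOrFlatOn_chart hφ h p.2.1).isOpen_ambientDomain
  have h2 := (continuousAt_extChartAt (I := ambientModel n) p).preimage_mem_nhds
    (h1.mem_nhds (extChartAt_mem_ambientDomain hφ h hp))
  filter_upwards [h2, extChartAt_source_mem_nhds (I := ambientModel n) p] with q hq hq'
  rw [mem_preimage, extChartAt_ambient_apply] at hq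
  exact (nondegenerate_iff g hφ lam h p.2.1 (mem_extChartAt_ambient_source.1 hq')).2 hq

theorem mem_nondegenerateSet_iff {v v' u : ℝ} {x : M} :
    (v, x, u) ∈ nondegenerateSet g lam φ ↔ (v', x, u) ∈ nondegenerateSet g lam φ := by
  simp only [nondegenerateSet, mem_ofPred_eq]

variable (g φ lam) in
/-- The points that can be joined to the cone within the set where `λ u ≠ 1` and `g_u` is
nondegenerate, along a `u`-line. -/
def maximalDomain : Set (ℝ × M × ℝ) :=
  {p | ∀ t ∈ Icc (0 : ℝ) 1, lam * (t * p.2.2) ≠ 1 ∧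
    (p.1, p.2.1, t * p.2.2) ∈ nondegenerateSet g lam φ}

/-- The defining condition is open for each `t`, and `t` runs over a compact interval. -/
theorem isOpen_maximalDomain (hφ : ContMDiff (𝓡 n) 𝓘(ℝ, ℝ) ∞ φ)
    (h : IsGradientRicciSoliton (𝓡 n) g.inner φ lam ∨ IsFlat (𝓡 n) g.inner) :
    IsOpen (maximalDomain g φ lam) := by
  refine isOpen_iff_mem_nhds.2 fun p hp =>
    isCompact_Icc.eventually_forall_of_forall_eventually fun t ht => ?_
  have h1 : Continuous fun z : (ℝ × M × ℝ) × ℝ => lam * (z.2 * z.1.2.2) := by fun_prop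
  have h2 : Continuous fun z : (ℝ × M × ℝ) × ℝ => (z.1.1, z.1.2.1, z.2 * z.1.2.2) := by fun_prop
  exact (h1.continuousAt.eventually_ne (hp t ht).1).and
    (h2.continuousAt.preimage_mem_nhds ((isOpen_nondegenerateSet hφ h).mem_nhds (hp t ht).2))

theorem mem_maximalDomain_zero (v : ℝ) (x : M) : (v, x, 0) ∈ maximalDomain g φ lam := by
  intro t _
  simp only [mul_zero]
  exact ⟨zero_ne_one, mem_nondegenerateSet_zero v x⟩

theorem smul_mem_maximalDomain {v u : ℝ} {x : M} (hu : (v, x, u) ∈ maximalDomain g φ lam) {r : ℝ}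
    (hr : r ∈ Icc (0 : ℝ) 1) : (v, x, r * u) ∈ maximalDomain g φ lam := by
  intro t ht
  have h1 := hu (t * r) ⟨mul_nonneg ht.1 hr.1, mul_le_one₀ ht.2 hr.1 hr.2⟩
  simp only [mul_assoc] at h1
  exact h1

/-- Each `u`-slice is star-shaped about `0`: a point between two others is a multiple, by a factor
in `[0, 1]`, of the endpoint of its own sign. -/
theorem ordConnected_maximalDomain (v : ℝ) (x : M) :
    OrdConnected {u : ℝ | (v, x, u) ∈ maximalDomain g φ lam} := by
  refine ⟨fun u₁ h₁ u₂ h₂ w hw => ?_⟩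
  rcases lt_trichotomy w 0 with h0 | h0 | h0
  · have h5 : u₁ < 0 := hw.1.trans_lt h0
    have h6 := smul_mem_maximalDomain h₁ (r := w / u₁)
      ⟨div_nonneg_of_nonpos h0.le h5.le, (div_le_one_of_neg h5).2 hw.1⟩
    rwa [div_mul_cancel₀ _ h5.ne] at h6
  · rw [h0]
    exact mem_maximalDomain_zero v x
  · have h5 : 0 < u₂ := h0.trans_le hw.2
    have h6 := smul_mem_maximalDomain h₂ (r := w / u₂)
      ⟨div_nonneg h0.le h5.le, (div_le_one h5).2 hw.2⟩
    rwa [div_mul_cancel₀ _ h5.ne'] at h6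

theorem of_mem_maximalDomain {p : ℝ × M × ℝ} (hp : p ∈ maximalDomain g φ lam) :
    lam * p.2.2 ≠ 1 ∧ p ∈ nondegenerateSet g lam φ := by
  have h1 := hp 1 (by simp)
  simp only [one_mul] at h1
  exact h1

theorem isNormalDomain_maximalDomain (hφ : ContMDiff (𝓡 n) 𝓘(ℝ, ℝ) ∞ φ)
    (h : IsGradientRicciSoliton (𝓡 n) g.inner φ lam ∨ IsFlat (𝓡 n) g.inner) :
    IsNormalDomain g φ lam (maximalDomain g φ lam) where
  isOpen := isOpen_maximalDomain hφ h
  cone_subset := mem_maximalDomain_zero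
  lam_mul_u_ne_one := fun _ hp => (of_mem_maximalDomain hp).1
  dilation_mem := fun _ hp _ t ht =>
    ⟨(hp t ht).1, mem_nondegenerateSet_iff.1 (hp t ht).2⟩
  interval := ordConnected_maximalDomain
  nondegenerate := fun _ hp => (of_mem_maximalDomain hp).2

end Domains

/-! ### Verification of the ambient space axioms and of the normal form. -/

section Ambient

variable {n : ℕ} {M : Type*} [TopologicalSpace M] [ChartedSpace (EuclideanSpace ℝ (Fin n)) M]

theorem lorentzSum_cone (B : EuclideanSpace ℝ (Fin n) →L[ℝ] EuclideanSpace ℝ (Fin n) →L[ℝ] ℝ)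
    (a b : ℝ) (ξ η : EuclideanSpace ℝ (Fin n)) :
    lorentzSum B (a, ξ, 0) (b, η, 0) = B ξ η := by
  simp [lorentzSum_apply]

theorem modelForm_normalMetric_vTranslation
    (gu : ℝ → ∀ x : M, TangentSpace (𝓡 n) x →L[ℝ] TangentSpace (𝓡 n) x →L[ℝ] ℝ) (s : ℝ)
    (p : ℝ × M × ℝ) :
    modelForm (ambientModel n) (normalMetric gu) (vTranslation s p) =
      modelForm (ambientModel n) (normalMetric gu) p := by
  rw [modelForm_normalMetric, modelForm_normalMetric]
  rfl

theorem mfderiv_vTranslation [IsManifold (𝓡 n) ∞ M] (s : ℝ) (p : ℝ × M × ℝ)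
    (X : ℝ × EuclideanSpace ℝ (Fin n) × ℝ) :
    (mfderiv (ambientModel n) (ambientModel n) (vTranslation s) p X :
      ℝ × EuclideanSpace ℝ (Fin n) × ℝ) = X := by
  have h1 : HasMFDerivAt 𝓘(ℝ, ℝ) 𝓘(ℝ, ℝ) (fun v : ℝ => v + s) p.1 (ContinuousLinearMap.id ℝ ℝ) :=
    ((hasFDerivAt_id p.1).add_const s).hasMFDerivAt
  have h2 : HasMFDerivAt ((𝓡 n).prod 𝓘(ℝ, ℝ)) ((𝓡 n).prod 𝓘(ℝ, ℝ)) (@id (M × ℝ)) p.2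
    (ContinuousLinearMap.id ℝ (TangentSpace ((𝓡 n).prod 𝓘(ℝ, ℝ)) p.2)) := hasMFDerivAt_id p.2
  have h3 := h1.prodMap h2
  rw [h1.mfderiv, h2.mfderiv] at h3
  have h4 : vTranslation s = Prod.map (fun v : ℝ => v + s) (@id (M × ℝ)) := rfl
  rw [h4, h3.mfderiv]
  rfl

theorem mfderiv_coneInclusion [IsManifold (𝓡 n) ∞ M] {φ : M → ℝ}
    (hφ : ContMDiff (𝓡 n) 𝓘(ℝ, ℝ) ∞ φ) (z : M × ℝ) (X : EuclideanSpace ℝ (Fin n) × ℝ) :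
    (mfderiv ((𝓡 n).prod 𝓘(ℝ, ℝ)) (ambientModel n) (coneInclusion φ) z X :
      ℝ × EuclideanSpace ℝ (Fin n) × ℝ) =
    ((mfderiv ((𝓡 n).prod 𝓘(ℝ, ℝ)) 𝓘(ℝ, ℝ) (fun z : M × ℝ => φ z.1 - z.2) z X : ℝ),
      (mfderiv ((𝓡 n).prod 𝓘(ℝ, ℝ)) (𝓡 n) Prod.fst z X : EuclideanSpace ℝ (Fin n)), (0 : ℝ)) := by
  have h0 : ContMDiff ((𝓡 n).prod 𝓘(ℝ, ℝ)) 𝓘(ℝ, ℝ) ∞ (fun z : M × ℝ => φ z.1 - z.2) :=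
    (hφ.comp contMDiff_fst).sub contMDiff_snd
  have h1 := ((h0 z).mdifferentiableAt (by simp)).hasMFDerivAt
  have h2 := (mdifferentiableAt_fst (I := 𝓡 n) (I' := 𝓘(ℝ, ℝ)) (x := z)).hasMFDerivAt
  have h3 := hasMFDerivAt_const (I := (𝓡 n).prod 𝓘(ℝ, ℝ)) (I' := 𝓘(ℝ, ℝ)) (0 : ℝ) z
  have h4 : coneInclusion φ = fun z : M × ℝ => (φ z.1 - z.2, z.1, (0 : ℝ)) := rfl
  rw [h4, (h1.prodMk (h2.prodMk h3)).mfderiv]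
  rfl

theorem extChartAt_ambient_line (v : ℝ) (x : M) (t s : ℝ) :
    extChartAt (ambientModel n) ((v, x, t) : ℝ × M × ℝ) (v, x, s) =
      (v, extChartAt (𝓡 n) x x, s) := extChartAt_ambient_apply _ _

variable [IsManifold (𝓡 n) ∞ M] {g : SmoothMetric n M} {φ : M → ℝ}
  (hφ : ContMDiff (𝓡 n) 𝓘(ℝ, ℝ) ∞ φ) {lam : ℝ}
  (h : IsGradientRicciSoliton (𝓡 n) g.inner φ lam ∨ IsFlat (𝓡 n) g.inner)
  {D : Set (ℝ × M × ℝ)} (hD : IsNormalDomain g φ lam D)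
include hφ h hD

omit hφ h in
theorem IsNormalDomain.eventually_mem (v : ℝ) (x : M) : ∀ᶠ u in 𝓝 (0 : ℝ), (v, x, u) ∈ D := by
  have h1 : Continuous fun u : ℝ => (v, x, u) := by fun_prop
  exact h1.continuousAt.preimage_mem_nhds (hD.isOpen.mem_nhds (hD.cone_subset v x))

theorem isPreAmbientSpace_of_isNormalDomain : IsPreAmbientSpace g φ lam D
    (normalMetric (metricFamily (𝓡 n) g.inner φ lam))
    (normalPotential (potentialFamily (𝓡 n) g.inner φ lam) lam) where
  isOpen := hD.isOpen
  cone_subset := fun z => hD.cone_subset _ _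
  lam_mul_u_ne_one := hD.lam_mul_u_ne_one
  dilation_mem := hD.dilation_mem
  smooth_metric := fun p hp =>
    (contMDiffAt_ambientMetric hφ h (hD.nondegenerate p hp)).contMDiffWithinAt
  signature := fun p hp => hasSignature_ambientMetric hφ h (hD.nondegenerate p hp)
  smooth_potential := (contMDiff_ambientPotential hφ h).contMDiffOn
  metric_invariant := fun p _ s X Y => by
    have h1 := mfderiv_vTranslation (n := n) s p
    refine (congrArg₂ (fun X Y => modelForm (ambientModel n)
      (normalMetric (metricFamily (𝓡 n) g.inner φ lam)) (vTranslation s p) X Y)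
      (h1 X) (h1 Y)).trans ?_
    rw [modelForm_normalMetric_vTranslation]
    rfl
  potential_dilation := fun p hp s => by
    -- The coefficient of `v` in the potential is `λu - 1`; the factor in the dilation is its
    -- inverse.
    have h1 : lam * p.2.2 - 1 ≠ 0 := sub_ne_zero.2 (hD.lam_mul_u_ne_one p hp)
    simp only [normalPotential, dilation]
    field_simp
    ring
  metric_on_cone := fun z X Y => by
    have h1 := mfderiv_coneInclusion hφ z
    refine (congrArg₂ (fun X Y => modelForm (ambientModel n)
      (normalMetric (metricFamily (𝓡 n) g.inner φ lam)) (coneInclusion φ z) X Y)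
      (h1 X) (h1 Y)).trans ?_
    simp only [modelForm_normalMetric, coneInclusion, metricFamily_zero]
    exact lorentzSum_cone _ _ _ _ _
  potential_on_cone := fun z => by
    simp [normalPotential, coneInclusion, potentialFamily]
  straight := fun v x => by
    refine (EventuallyEq.isBigO (f₂ := fun _ : ℝ => (0 : ℝ × EuclideanSpace ℝ (Fin n) × ℝ)) ?_).trans
      (isBigO_zero _ _)
    filter_upwards [hD.eventually_mem v x] with u hu
    exact christoffelAt_ambient_v_v hφ h (hD.nondegenerate _ hu)

theorem isWeightedAmbientSpace_of_isNormalDomain : IsWeightedAmbientSpace g φ lam D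
    (normalMetric (metricFamily (𝓡 n) g.inner φ lam))
    (normalPotential (potentialFamily (𝓡 n) g.inner φ lam) lam) where
  toIsPreAmbientSpace := isPreAmbientSpace_of_isNormalDomain hφ h hD
  weightedP_flat := fun v x X Y m => by
    refine (EventuallyEq.isBigO (f₂ := fun _ : ℝ => (0 : ℝ)) ?_).trans (isBigO_zero _ _)
    filter_upwards [hD.eventually_mem v x] with u hu
    rw [weightedP_ambient hφ h (hD.nondegenerate _ hu)]
    rfl
  weightedF_flat := fun v x m => by
    refine (EventuallyEq.isBigO (f₂ := fun _ : ℝ => (0 : ℝ)) ?_).trans (isBigO_zero _ _)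
    filter_upwards [hD.eventually_mem v x] with u hu
    exact weightedF_ambient hφ h (hD.nondegenerate _ hu)

theorem isInNormalForm_of_isNormalDomain :
    IsInNormalForm g D (normalMetric (metricFamily (𝓡 n) g.inner φ lam)) where
  interval := fun v x => by
    have h1 : Continuous fun u : ℝ => (v, x, u) := by fun_prop
    exact ⟨hD.isOpen.preimage h1, hD.interval v x, hD.cone_subset v x⟩
  geodesic := fun v x => by
    refine ⟨(contMDiff_const.prodMk (contMDiff_const.prodMk contMDiff_id)).contMDiffOn,
      fun t ht => ?_⟩
    -- In the product chart the `u`-line is affine with velocity `∂_u`, so the geodesic equation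
    -- reduces to `Γ(∂_u, ∂_u) = 0`.
    have h1 : (fun s : ℝ => extChartAt (ambientModel n) ((v, x, t) : ℝ × M × ℝ) (v, x, s)) =
        fun s => (v, extChartAt (𝓡 n) x x, s) := funext (extChartAt_ambient_line v x t)
    have h2 : deriv (fun s : ℝ => (v, extChartAt (𝓡 n) x x, s)) =
        fun _ => ((0, 0, 1) : ℝ × EuclideanSpace ℝ (Fin n) × ℝ) := by
      funext s
      exact ((hasDerivAt_const s v).prodMk
        ((hasDerivAt_const s (extChartAt (𝓡 n) x x)).prodMk (hasDerivAt_id s))).deriv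
    simp only [h1, h2, deriv_const, zero_add]
    have h3 := christoffel_ambient_u_u hφ h (hD.nondegenerate _ ht)
    rwa [extChartAt_ambient_line] at h3
  metric_at_cone := fun v x => by
    simp only [normalMetric, metricFamily_zero]
    rfl

end Ambient

end WeightedAmbient

end

open WeightedAmbient in
theorem theorem1p2 {n : ℕ} {M : Type*} [TopologicalSpace M]
    [ChartedSpace (EuclideanSpace ℝ (Fin n)) M] [IsManifold (𝓡 n) ∞ M]
    (g : SmoothMetric n M) (φ : M → ℝ) (hφ : ContMDiff (𝓡 n) 𝓘(ℝ, ℝ) ∞ φ) (lam : ℝ)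
    (h : IsGradientRicciSoliton (𝓡 n) g.inner φ lam ∨ IsFlat (𝓡 n) g.inner) :
    (∃ D : Set (ℝ × M × ℝ), IsNormalDomain g φ lam D) ∧
    ∀ D : Set (ℝ × M × ℝ), IsNormalDomain g φ lam D →
      IsWeightedAmbientSpace g φ lam D
        (normalMetric (metricFamily (𝓡 n) g.inner φ lam))
        (normalPotential (potentialFamily (𝓡 n) g.inner φ lam) lam) ∧
      IsInNormalForm g D (normalMetric (metricFamily (𝓡 n) g.inner φ lam)) ∧
      ∀ p ∈ D,
        weightedP (ambientModel n) (normalMetric (metricFamily (𝓡 n) g.inner φ lam))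
          (normalPotential (potentialFamily (𝓡 n) g.inner φ lam) lam) lam p = 0 ∧
        weightedF (ambientModel n) (normalMetric (metricFamily (𝓡 n) g.inner φ lam))
          (normalPotential (potentialFamily (𝓡 n) g.inner φ lam) lam) lam p = 0 := by
  refine ⟨⟨maximalDomain g φ lam, isNormalDomain_maximalDomain hφ h⟩, fun D hD =>
    ⟨isWeightedAmbientSpace_of_isNormalDomain hφ h hD, isInNormalForm_of_isNormalDomain hφ h hD,
      fun p hp => ⟨weightedP_ambient hφ h (hD.nondegenerate p hp),
        weightedF_ambient hφ h (hD.nondegenerate p hp)⟩⟩⟩
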